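/- Let $p\ge 7$ be a prime and $\epsilon\in\{0,1,-1\}$. Let $\varphi$ be the automorphism of $\mathbb{Q}_p^4$ whose matrix is the companion matrix of $X^4+\epsilon pX^2+p^2$, that is, $\varphi(e_1)=e_2$, $\varphi(e_2)=e_3$, $\varphi(e_3)=e_4$, $\varphi(e_4)=-p^2e_1-\epsilon p\,e_3$. Let $Y=\mathrm{Gr}(2,4)$, and for $P\in Y(\mathbb{Q}_p)$ let $V_P\subset\mathbb{Q}_p^4$ be the corresponding plane and $D_P$ the filtered $\varphi$-module $(\mathbb{Q}_p^4,\varphi,\mathrm{Fil}_\bullet)$ over $\mathbb{Q}_p$ with $\mathrm{Fil}_i=\mathbb{Q}_p^4$ for $i\le 0$, $\mathrm{Fil}_1=V_P$, $\mathrm{Fil}_i=0$ for $i\ge 2$. Let $Y(\mathbb{Q}_p)^{wa}$ be the set of $P\in Y(\mathbb{Q}_p)$ such that $D_P$ is (weakly) admissible. Let $\mathcal{M}^{wa}$ be the set of isomorphism classes of those admissible filtered $\varphi$-modules $D$ over $\mathbb{Q}_p$ with characteristic polynomial $\chi_\varphi(X)=X^4+\epsilon pX^2+p^2$ that come from abelian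 surfaces over $\mathbb{Q}_p$ with supersingular good reduction, i.e. (by Volkov's criterion) that satisfy: $\dim D=4$ and $h^0(D)=h^1(D)=2$; $\varphi$ is semisimple and $\chi_\varphi$ is a supersingular $p$-Weil polynomial; there is a nondegenerate skew form on $D$ for which $\varphi$ is a $p$-similitude and $\mathrm{Fil}_1D$ is totally isotropic. Let $U\subset Y$ be the open subvariety of the planes $V_P$ with $V_P\oplus\varphi(V_P)$ equal to the whole space, let $\mathrm{pr}_P$ be the projection onto $V_P$ along $\varphi(V_P)$, and let $c$ be the rational map $Y\dashrightarrow\mathbb{P}^1$ over $\mathbb{Q}_p$ given on $U$ by $P\mapsto[\mathrm{tr}(\mathrm{pr}_P\circ\varphi^2|_{V_P}):1]$. Let $Y^{df}\subset Y$ be its domain of definition, so that $c$ is a morphism $Y^{df}\to\mathbb{P}^1$. Then: 1. $Y(\mathbb{Q}_p)^{wa}=Y^{df}(\mathbb{Q}_p)$, and $P\mapsto[D_P]$ is a surjection $Y^{df}(\mathbb{Q}_p)\to\mathcal{M}^{wa}$. 2. After base change to $\overline{\mathbb{Q}}_p$, the morphism $c$ is a projective GIT quotient: let $G$ be the centralizer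 of $\varphi$ in $\mathrm{SL}_4$, acting on $Y$ with the linearization given by the Plücker embedding, and let $R(Y)$ be the homogeneous coordinate ring of $Y_{\overline{\mathbb{Q}}_p}$ in this embedding; then $Y^{df}_{\overline{\mathbb{Q}}_p}$ is the semistable locus $Y^{ss}$, and $c$ is the canonical map $Y^{ss}\to\mathrm{Proj}\,R(Y)^G$ followed by an isomorphism $\mathrm{Proj}\,R(Y)^G\simeq\mathbb{P}^1$ over $\overline{\mathbb{Q}}_p$. 3. There is a unique map of sets $\bar c:\mathcal{M}^{wa}\to\mathbb{P}^1(\mathbb{Q}_p)$ with $\bar c([D_P])=c(P)$ for all $P\in Y^{df}(\mathbb{Q}_p)$. 4. $\bar c$ is injective outside the fiber $\bar c^{-1}([-\epsilon p:1])$. 5. If $X^2+\epsilon pX+p^2$ has no root in $\mathbb{Q}_p$, then $\bar c^{-1}([-\epsilon p:1])$ is a single point, and hence $\bar c$ is injective. 6. If $X^2+\epsilon pX+p^2$ splits over $\mathbb{Q}_p$, then $\bar c^{-1}([-\epsilon p:1])$ consists of exactly three points. -/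

import Mathlib

open scoped LinearAlgebra.Projectivization Polynomial
open Module

noncomputable section

namespace FilPhi

/-! ### Filtered `φ`-modules over `ℚ_[p]` -/

/-- A filtered `φ`-module over `ℚ_[p]`: here the maximal unramified subfield is `ℚ_[p]` itself and
its Frobenius is the identity, so that `φ` is linear. -/
structure FilteredPhiModule (p : ℕ) [Fact p.Prime] : Type 1 where
  carrier : Type
  [addCommGroup : AddCommGroup carrier]
  [module : Module ℚ_[p] carrier]
  [finite : Module.Finite ℚ_[p] carrier]
  φ : carrier ≃ₗ[ℚ_[p]] carrier
  Fil : ℤ → Submodule ℚ_[p] carrier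
  antitone : Antitone Fil
  exhaustive : ⨆ i, Fil i = ⊤
  separated : ⨅ i, Fil i = ⊥

attribute [instance] FilteredPhiModule.addCommGroup FilteredPhiModule.module
  FilteredPhiModule.finite

namespace FilteredPhiModule

variable {p : ℕ} [Fact p.Prime]

/-- Isomorphism of filtered `φ`-modules. -/
def Iso (D E : FilteredPhiModule p) : Prop :=
  ∃ e : D.carrier ≃ₗ[ℚ_[p]] E.carrier,
    (∀ x, e (D.φ x) = E.φ (e x)) ∧
    ∀ i, (D.Fil i).map (e : D.carrier →ₗ[ℚ_[p]] E.carrier) = E.Fil i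

theorem Iso.refl (D : FilteredPhiModule p) : D.Iso D :=
  ⟨LinearEquiv.refl _ _, fun _ => rfl, fun _ => Submodule.map_id _⟩

theorem Iso.symm {D E : FilteredPhiModule p} (h : D.Iso E) : E.Iso D := by
  obtain ⟨e, h1, h2⟩ := h
  refine ⟨e.symm, fun x => ?_, fun i => ?_⟩
  · rw [LinearEquiv.symm_apply_eq, h1, LinearEquiv.apply_symm_apply]
  · rw [← h2 i, ← Submodule.map_comp]
    simp

theorem Iso.trans {D E F : FilteredPhiModule p} (h : D.Iso E) (h' : E.Iso F) : D.Iso F := by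
  obtain ⟨e, h1, h2⟩ := h
  obtain ⟨f, h3, h4⟩ := h'
  refine ⟨e.trans f, fun x => ?_, fun i => ?_⟩
  · simp [h1, h3]
  · rw [← h4 i, ← h2 i, ← Submodule.map_comp]
    rfl

/-- The Hodge number `h^i(D) = dim (Fil i / Fil (i+1))`. -/
def hodge (D : FilteredPhiModule p) (i : ℤ) : ℤ :=
  (finrank ℚ_[p] (D.Fil i) : ℤ) - finrank ℚ_[p] (D.Fil (i + 1))

/-- The Hodge invariant `t_H(W)` of a subspace with the induced filtration (a sum with only
finitely many nonzero terms). -/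
def tH (D : FilteredPhiModule p) (W : Submodule ℚ_[p] D.carrier) : ℤ :=
  ∑ᶠ i : ℤ, i * ((finrank ℚ_[p] (W ⊓ D.Fil i : Submodule ℚ_[p] D.carrier) : ℤ)
    - finrank ℚ_[p] (W ⊓ D.Fil (i + 1) : Submodule ℚ_[p] D.carrier))

/-- `φ` as a linear endomorphism. -/
def frob (D : FilteredPhiModule p) : Module.End ℚ_[p] D.carrier := D.φ.toLinearMap

/-- The Newton invariant `t_N(W) = v_p(det (φ | W))` of a `φ`-stable subspace. -/
def tN (D : FilteredPhiModule p) (W : Submodule ℚ_[p] D.carrier) (hW : ∀ x ∈ W, D.frob x ∈ W) :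
    ℤ :=
  (LinearMap.det (D.frob.restrict hW)).valuation

/-- (Weak) admissibility: `t_H(D) = t_N(D)`, and `t_H(W) ≤ t_N(W)` for every sub-`φ`-module. -/
def Admissible (D : FilteredPhiModule p) : Prop :=
  D.tH ⊤ = D.tN ⊤ (fun _ _ => trivial) ∧
  ∀ (W : Submodule ℚ_[p] D.carrier) (hW : ∀ x ∈ W, D.frob x ∈ W), D.tH W ≤ D.tN W hW

end FilteredPhiModule

/-- Supersingular `p`-Weil polynomials: monic integral polynomials all of whose complex roots are
`√p` times a root of unity, and in which `T² - p` has even multiplicity. -/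
def IsSupersingularWeil (p : ℕ) (f : ℤ[X]) : Prop :=
  f.Monic ∧
  (∀ α : ℂ, Polynomial.aeval α f = 0 →
    ∃ (ζ : ℂ) (m : ℕ), 0 < m ∧ ζ ^ m = 1 ∧ α = (Real.sqrt p : ℂ) * ζ) ∧
  Even (multiplicity (Polynomial.X ^ 2 - Polynomial.C (p : ℤ)) f)

namespace FilteredPhiModule

variable {p : ℕ} [Fact p.Prime]

/-- Dimension `4` and Hodge numbers `h^0 = h^1 = 2`. -/
def HodgeCondition (D : FilteredPhiModule p) : Prop :=
  finrank ℚ_[p] D.carrier = 4 ∧ D.hodge 0 = 2 ∧ D.hodge 1 = 2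

/-- `φ` is semisimple and its characteristic polynomial is a supersingular `p`-Weil polynomial. -/
def FrobeniusCondition (D : FilteredPhiModule p) : Prop :=
  D.frob.IsSemisimple ∧
  ∃ f : ℤ[X], IsSupersingularWeil p f ∧ f.map (Int.castRingHom ℚ_[p]) = D.frob.charpoly

/-- There is a nondegenerate skew form for which `φ` is a `p`-similitude and `Fil 1` is totally
isotropic. -/
def PolarizationCondition (D : FilteredPhiModule p) : Prop :=
  ∃ B : LinearMap.BilinForm ℚ_[p] D.carrier,
    B.IsAlt ∧ B.Nondegenerate ∧
    (∀ x y, B (D.φ x) (D.φ y) = (p : ℚ_[p]) * B x y) ∧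
    ∀ x ∈ D.Fil 1, ∀ y ∈ D.Fil 1, B x y = 0

/-- The filtered `φ`-modules that come from abelian surfaces over `ℚ_[p]` with supersingular good
reduction, described by Volkov's criterion, with characteristic polynomial
`X ^ 4 + ε p X ^ 2 + p ^ 2`. -/
def IsSupersingular (D : FilteredPhiModule p) (ε : ℤ) : Prop :=
  D.Admissible ∧ D.HodgeCondition ∧ D.FrobeniusCondition ∧ D.PolarizationCondition ∧
  D.frob.charpoly = Polynomial.X ^ 4 + Polynomial.C ((ε : ℚ_[p]) * p) * Polynomial.X ^ 2
    + Polynomial.C ((p : ℚ_[p]) ^ 2)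

end FilteredPhiModule

/-- Isomorphism as an equivalence relation on the supersingular objects. -/
instance isoSetoid (p : ℕ) [Fact p.Prime] (ε : ℤ) :
    Setoid {D : FilteredPhiModule p // D.IsSupersingular ε} where
  r D E := D.1.Iso E.1
  iseqv := ⟨fun D => .refl D.1, fun h => h.symm, fun h h' => h.trans h'⟩

/-- The set `M^wa` of isomorphism classes. -/
def Mwa (p : ℕ) [Fact p.Prime] (ε : ℤ) : Type 1 := Quotient (isoSetoid p ε)

/-- The isomorphism class of `D`. -/
def Mwa.mk {p : ℕ} [Fact p.Prime] {ε : ℤ} (D : FilteredPhiModule p) (h : D.IsSupersingular ε) :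
    Mwa p ε :=
  Quotient.mk (isoSetoid p ε) ⟨D, h⟩

/-! ### The Grassmannian and the filtered `φ`-modules `D_P` -/

/-- The matrix of `φ` (the companion matrix of `X ^ 4 + ε p X ^ 2 + p ^ 2`) over a field `K`. -/
def phiMat (K : Type*) [Field K] (p : ℕ) (ε : ℤ) : Matrix (Fin 4) (Fin 4) K :=
  !![0, 0, 0, -(p : K) ^ 2;
     1, 0, 0, 0;
     0, 1, 0, -((ε : K) * p);
     0, 0, 1, 0]

/-- `φ` as an endomorphism of `K⁴`. -/
def phi (K : Type*) [Field K] (p : ℕ) (ε : ℤ) : (Fin 4 → K) →ₗ[K] (Fin 4 → K) :=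
  Matrix.toLin' (phiMat K p ε)

theorem det_phiMat (K : Type*) [Field K] (p : ℕ) (ε : ℤ) : (phiMat K p ε).det = (p : K) ^ 2 := by
  simp [phiMat, Matrix.det_succ_row_zero, Fin.sum_univ_succ, Fin.succAbove]
  ring

theorem isUnit_det_phi (p : ℕ) [Fact p.Prime] (ε : ℤ) :
    IsUnit (LinearMap.det (phi ℚ_[p] p ε)) := by
  rw [phi, LinearMap.det_toLin', det_phiMat]
  exact (pow_ne_zero 2 (Nat.cast_ne_zero.2 (Fact.out : p.Prime).ne_zero)).isUnit

/-- `Y(K)`, where `Y = Gr(2,4)`: the planes in `K⁴`. -/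
def Gr (K : Type*) [Field K] : Type _ := {V : Submodule K (Fin 4 → K) // finrank K V = 2}

/-- The filtration `Fil i = K⁴` for `i ≤ 0`, `Fil 1 = V`, `Fil i = 0` for `i ≥ 2`. -/
def twoStep {K : Type*} [Field K] (V : Submodule K (Fin 4 → K)) (i : ℤ) :
    Submodule K (Fin 4 → K) :=
  if i ≤ 0 then ⊤ else if i = 1 then V else ⊥

theorem twoStep_antitone {K : Type*} [Field K] (V : Submodule K (Fin 4 → K)) :
    Antitone (twoStep V) := by
  intro i j hij
  unfold twoStep
  split_ifs <;> first | exact le_top | exact bot_le | exact le_rfl | omega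

/-- The filtered `φ`-module `D_P` on `ℚ_[p]⁴`. -/
def DP {p : ℕ} [Fact p.Prime] (ε : ℤ) (P : Gr ℚ_[p]) : FilteredPhiModule p where
  carrier := Fin 4 → ℚ_[p]
  φ := LinearEquiv.ofIsUnitDet
    (v := Pi.basisFun ℚ_[p] (Fin 4)) (v' := Pi.basisFun ℚ_[p] (Fin 4)) (f := phi ℚ_[p] p ε)
    (by rw [LinearMap.det_toMatrix]; exact isUnit_det_phi p ε)
  Fil := twoStep P.1
  antitone := twoStep_antitone P.1
  exhaustive := top_le_iff.1 (le_iSup_of_le 0 (by simp [twoStep]))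
  separated := le_bot_iff.1 (iInf_le_of_le 2 (by simp [twoStep]))

/-- `Y(ℚ_[p])^wa`: the planes `P` for which `D_P` is admissible. -/
def Ywa (p : ℕ) [Fact p.Prime] (ε : ℤ) : Set (Gr ℚ_[p]) := {P | (DP ε P).Admissible}

/-! ### The rational map `c` -/

/-- `P ∈ U(K)`: the plane satisfies `K⁴ = V_P ⊕ φ(V_P)`. -/
def InU {K : Type*} [Field K] (p : ℕ) (ε : ℤ) (P : Gr K) : Prop :=
  IsCompl P.1 (P.1.map (phi K p ε))

/-- `tr (pr_P ∘ φ² | V_P)`, with `pr_P` the projection onto `V_P` along `φ(V_P)`. -/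
def cU {K : Type*} [Field K] {p : ℕ} {ε : ℤ} (P : Gr K) (h : InU p ε P) : K :=
  LinearMap.trace K P.1
    ((P.1.projectionOnto (P.1.map (phi K p ε)) h) ∘ₗ (phi K p ε ∘ₗ phi K p ε) ∘ₗ P.1.subtype)

/-- The indices `i < j` of the Plücker coordinates. -/
abbrev PIdx : Type := {ij : Fin 4 × Fin 4 // ij.1 < ij.2}

/-- The Plücker coordinates `x_{ij} = v_i w_j - v_j w_i` of the plane spanned by `v` and `w`. -/
def plucker {K : Type*} [Field K] (v w : Fin 4 → K) (ij : PIdx) : K :=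
  v ij.1.1 * w ij.1.2 - v ij.1.2 * w ij.1.1

/-- `v, w` span the plane `P`. -/
def Spans {K : Type*} [Field K] (P : Gr K) (v w : Fin 4 → K) : Prop :=
  Submodule.span K {v, w} = P.1

/-- `[F : G]`, with `F` and `G` homogeneous polynomials of the same degree in the Plücker
coordinates and with coefficients in `k`, is an expression of the rational map `c` on `Y`, that is,
`[F : G] = [tr (pr_P ∘ φ² | V_P) : 1]` at all `P` in `U(K)` that are not common zeros of `F`
and `G`. -/
def IsExpression (k K : Type*) [Field k] [Field K] [Algebra k K] (p : ℕ) (ε : ℤ)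
    (F G : MvPolynomial PIdx k) : Prop :=
  (∃ n, F.IsHomogeneous n ∧ G.IsHomogeneous n) ∧
  ∀ (P : Gr K) (h : InU p ε P) (v w : Fin 4 → K), Spans P v w →
    MvPolynomial.aeval (plucker v w) F = cU P h * MvPolynomial.aeval (plucker v w) G

/-- The pair `(F, G)` evaluated at the Plücker coordinates. -/
def evalPair {k K : Type*} [Field k] [Field K] [Algebra k K] (F G : MvPolynomial PIdx k)
    (v w : Fin 4 → K) : Fin 2 → K :=
  ![MvPolynomial.aeval (plucker v w) F, MvPolynomial.aeval (plucker v w) G]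

/-- `Y^df(K)`, where `Y^df` is the domain of definition, as an open subvariety of `Y` over `k`, of
the rational map `c`: the points at which `c` is given by some expression `[F : G]` over `k`, with
`F` and `G` not both vanishing at the point. -/
def Ydf (k K : Type*) [Field k] [Field K] [Algebra k K] (p : ℕ) (ε : ℤ) : Set (Gr K) :=
  {P | ∃ F G : MvPolynomial PIdx k, IsExpression k K p ε F G ∧
    ∃ v w, Spans P v w ∧ evalPair F G v w ≠ 0}

/-- The point `[a : 1]` of the projective line. -/
def affinePt {K : Type*} [Field K] (a : K) : ℙ K (Fin 2 → K) :=
  Projectivization.mk K ![a, 1] (fun h => one_ne_zero (congrFun h 1))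

/-- `c : Y^df(K) → ℙ¹(K)` is (on `K`-points) the morphism over `k` that extends
`P ↦ [tr (pr_P ∘ φ² | V_P) : 1]` from `U` to `Y^df`. -/
def IsExtension (k : Type*) {K : Type*} [Field k] [Field K] [Algebra k K] (p : ℕ) (ε : ℤ)
    (c : Ydf k K p ε → ℙ K (Fin 2 → K)) : Prop :=
  (∀ (P : Gr K) (h : InU p ε P), ∃ hP : P ∈ Ydf k K p ε, c ⟨P, hP⟩ = affinePt (cU P h)) ∧
  ∀ F G : MvPolynomial PIdx k, IsExpression k K p ε F G →
    ∀ (P : Ydf k K p ε) (v w : Fin 4 → K), Spans P.1 v w → ∀ h : evalPair F G v w ≠ 0,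
      c P = Projectivization.mk K (evalPair F G v w) h

/-! ### The projective GIT quotient of `Y` by the centralizer of `φ` in `SL₄` -/

section GIT

variable (K : Type*) [Field K] (p : ℕ) (ε : ℤ)

/-- The group `G(K)` of the `g` in `SL₄(K)` that commute with `φ`. -/
def centralizer : Set (Matrix.SpecialLinearGroup (Fin 4) K) :=
  {g | g.1 * phiMat K p ε = phiMat K p ε * g.1}

/-- The invariant ring `R(Y)^G`. Here `R(Y)`, the homogeneous coordinate ring of `Y` in its Plücker
embedding, is realized as the ring of polynomial functions on the affine cone over `Y`, that is, as
functions of the pairs `(v, w)` that are polynomial in the Plücker coordinates of `(v, w)`. -/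
def invRing : Subalgebra K ((Fin 4 → K) × (Fin 4 → K) → K) where
  carrier := {f | (∃ F : MvPolynomial PIdx K, ∀ v w, f (v, w) = MvPolynomial.eval (plucker v w) F) ∧
    ∀ g ∈ centralizer K p ε, ∀ v w, f (g.1.mulVec v, g.1.mulVec w) = f (v, w)}
  mul_mem' := by
    rintro a b ⟨⟨F, hF⟩, ha⟩ ⟨⟨G, hG⟩, hb⟩
    refine ⟨⟨F * G, fun v w => by simp [hF, hG]⟩, fun g hg v w => ?_⟩
    simp only [Pi.mul_apply]
    rw [ha g hg, hb g hg]
  add_mem' := by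
    rintro a b ⟨⟨F, hF⟩, ha⟩ ⟨⟨G, hG⟩, hb⟩
    refine ⟨⟨F + G, fun v w => by simp [hF, hG]⟩, fun g hg v w => ?_⟩
    simp only [Pi.add_apply]
    rw [ha g hg, hb g hg]
  algebraMap_mem' r :=
    ⟨⟨MvPolynomial.C r, fun v w => by simp⟩, fun g hg v w => by simp⟩

/-- The part of degree `n` of `R(Y)^G`, that is, `Γ(Y, 𝒪_Y(n))^G`. -/
def invGrading (n : ℕ) : Submodule K (invRing K p ε) where
  carrier := {f | ∃ F : MvPolynomial PIdx K, F.IsHomogeneous n ∧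
    ∀ v w, f.1 (v, w) = MvPolynomial.eval (plucker v w) F}
  add_mem' := by
    rintro a b ⟨F, hF, ha⟩ ⟨G, hG, hb⟩
    exact ⟨F + G, hF.add hG, fun v w => by simp [ha, hb]⟩
  zero_mem' := ⟨0, MvPolynomial.isHomogeneous_zero _ _ _, fun v w => by simp⟩
  smul_mem' := by
    rintro r a ⟨F, hF, ha⟩
    refine ⟨MvPolynomial.C r * F, ?_, fun v w => by simp [ha]⟩
    simpa using (MvPolynomial.isHomogeneous_C _ r).mul hF

variable {K p ε}

theorem plucker_smul (t : K) (v w : Fin 4 → K) : plucker (t • v) w = t • plucker v w := by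
  funext ij
  simp only [plucker, Pi.smul_apply, smul_eq_mul]
  ring

theorem eval_smul_of_isHomogeneous {F : MvPolynomial PIdx K} {n : ℕ} (hF : F.IsHomogeneous n)
    (t : K) (x : PIdx → K) :
    MvPolynomial.eval (t • x) F = t ^ n * MvPolynomial.eval x F := by
  rw [MvPolynomial.eval_eq, MvPolynomial.eval_eq, Finset.mul_sum]
  refine Finset.sum_congr rfl fun d hd => ?_
  have hdeg : ∑ i, d i = n := by
    have h := hF (MvPolynomial.mem_support_iff.1 hd)
    rw [Finsupp.weight_apply, Finsupp.sum_fintype _ _ (by simp)] at h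
    simpa using h
  have : ∏ i ∈ d.support, (t • x) i ^ d i = t ^ n * ∏ i ∈ d.support, x i ^ d i := by
    simp only [Pi.smul_apply, smul_eq_mul, mul_pow, Finset.prod_mul_distrib]
    congr 1
    rw [Finset.prod_pow_eq_pow_sum, ← hdeg]
    congr 1
    exact Finset.sum_subset (Finset.subset_univ _) (by simp)
  rw [this]
  ring

/-- Coefficients of a polynomial function on an infinite field are determined by its values. -/
theorem coeff_eq_zero_of_sum [Infinite K] (s : Finset ℕ) (a : ℕ → K)
    (h : ∀ t : K, ∑ n ∈ s, t ^ n * a n = 0) {n : ℕ} (hn : n ∈ s) : a n = 0 := by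
  have h0 : (∑ m ∈ s, Polynomial.monomial m (a m) : K[X]) = 0 := by
    refine Polynomial.funext fun t => ?_
    rw [Polynomial.eval_finsetSum, Polynomial.eval_zero, ← h t]
    exact Finset.sum_congr rfl fun m _ => by rw [Polynomial.eval_monomial, mul_comm]
  have h1 := congrArg (fun q : K[X] => q.coeff n) h0
  simpa [Polynomial.finsetSum_coeff, Polynomial.coeff_monomial, hn] using h1

theorem invGrading_smul {n : ℕ} {f : invRing K p ε} (hf : f ∈ invGrading K p ε n)
    (t : K) (v w : Fin 4 → K) : f.1 (t • v, w) = t ^ n * f.1 (v, w) := by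
  obtain ⟨F, hF, h⟩ := hf
  rw [h, h, plucker_smul, eval_smul_of_isHomogeneous hF]

theorem iSup_invGrading [Infinite K] : ⨆ n, invGrading K p ε n = ⊤ := by
  rw [eq_top_iff]
  rintro ⟨f, ⟨F, hF⟩, hinv⟩ -
  set s := Finset.range (F.totalDegree + 1) with hs
  have hsum : ∀ v w, f (v, w) = ∑ n ∈ s,
      MvPolynomial.eval (plucker v w) (MvPolynomial.homogeneousComponent n F) := by
    intro v w
    rw [hF, ← map_sum, MvPolynomial.sum_homogeneousComponent]
  have hcomp : ∀ n ∈ s, ∀ g ∈ centralizer K p ε, ∀ v w,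
      MvPolynomial.eval (plucker (g.1.mulVec v) (g.1.mulVec w))
        (MvPolynomial.homogeneousComponent n F) =
      MvPolynomial.eval (plucker v w) (MvPolynomial.homogeneousComponent n F) := by
    intro n hn g hg v w
    refine sub_eq_zero.1 (coeff_eq_zero_of_sum s (fun m =>
      MvPolynomial.eval (plucker (g.1.mulVec v) (g.1.mulVec w))
        (MvPolynomial.homogeneousComponent m F) -
      MvPolynomial.eval (plucker v w) (MvPolynomial.homogeneousComponent m F)) ?_ hn)
    intro t
    have h1 := hinv g hg (t • v) w
    rw [Matrix.mulVec_smul, hsum, hsum, ← sub_eq_zero, ← Finset.sum_sub_distrib] at h1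
    rw [← h1]
    refine Finset.sum_congr rfl fun m _ => ?_
    rw [plucker_smul, plucker_smul,
      eval_smul_of_isHomogeneous (MvPolynomial.homogeneousComponent_isHomogeneous m F),
      eval_smul_of_isHomogeneous (MvPolynomial.homogeneousComponent_isHomogeneous m F), mul_sub]
  let q : ℕ → invRing K p ε := fun n =>
    if hn : n ∈ s then
      ⟨fun x => MvPolynomial.eval (plucker x.1 x.2) (MvPolynomial.homogeneousComponent n F),
        ⟨_, fun _ _ => rfl⟩, fun g hg v w => hcomp n hn g hg v w⟩
    else 0
  have hq : (⟨f, ⟨F, hF⟩, hinv⟩ : invRing K p ε) = ∑ n ∈ s, q n := by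
    refine Subtype.ext (funext fun x => ?_)
    rw [AddSubmonoidClass.coe_finsetSum, Finset.sum_apply]
    refine (hsum x.1 x.2).trans (Finset.sum_congr rfl fun n hn => ?_)
    simp only [q, dif_pos hn]
  rw [hq]
  refine Submodule.sum_mem _ fun n hn => Submodule.mem_iSup_of_mem n ?_
  simp only [q, dif_pos hn]
  exact ⟨_, MvPolynomial.homogeneousComponent_isHomogeneous n F, fun _ _ => rfl⟩

theorem iSupIndep_of_scaling [Infinite K] {M X : Type*} [AddCommGroup M] [Module K M]
    (A : ℕ → Submodule K M) (ev : X → M →ₗ[K] K) (hev : ∀ f, (∀ x, ev x f = 0) → f = 0)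
    (s : K → X → X) (hs : ∀ t x n, ∀ f ∈ A n, ev (s t x) f = t ^ n * ev x f) : iSupIndep A := by
  classical
  refine iSupIndep_of_dfinsupp_lsum_injective _ ?_
  refine (injective_iff_map_eq_zero _).2 fun m hm => ?_
  have h0 : ∀ x, ∑ n ∈ m.support, ev x (m n) = 0 := by
    intro x
    have h1 := congrArg (ev x) hm
    simpa [DFinsupp.lsum_apply_apply, DFinsupp.sumAddHom_apply, DFinsupp.sum] using h1
  refine DFinsupp.ext fun n => Subtype.ext (hev _ fun x => ?_)
  by_cases hn : n ∈ m.support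
  · refine coeff_eq_zero_of_sum m.support (fun n => ev x (m n)) (fun t => ?_) hn
    rw [← h0 (s t x)]
    exact Finset.sum_congr rfl fun k _ => (hs t x k _ (m k).2).symm
  · rw [DFinsupp.notMem_support_iff.1 hn]
    simp

theorem iSupIndep_invGrading [Infinite K] : iSupIndep (invGrading K p ε) :=
  iSupIndep_of_scaling (X := (Fin 4 → K) × (Fin 4 → K)) (invGrading K p ε)
    (fun x => (LinearMap.proj x) ∘ₗ (invRing K p ε).val.toLinearMap)
    (fun _ hf => Subtype.ext (funext hf)) (fun t x => (t • x.1, x.2))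
    (fun t x _ _ hf => invGrading_smul hf t x.1 x.2)

instance invGradedAlgebra [Infinite K] : GradedAlgebra (invGrading K p ε) where
  one_mem := ⟨1, MvPolynomial.isHomogeneous_one _ _, fun v w => by simp⟩
  mul_mem := by
    rintro i j a b ⟨F, hF, ha⟩ ⟨G, hG, hb⟩
    exact ⟨F * G, hF.mul hG, fun v w => by simp [ha, hb]⟩
  toDecomposition := (DirectSum.isInternal_submodule_of_iSupIndep_of_iSup_eq_top
    iSupIndep_invGrading iSup_invGrading).chooseDecomposition

variable (K p ε)

/-- The semistable locus `Y^ss(K)`: the points at which some homogeneous invariant of positive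
degree does not vanish. -/
def Yss : Set (Gr K) :=
  {P | ∃ n, 0 < n ∧ ∃ f ∈ invGrading K p ε n, ∃ v w, Spans P v w ∧ f.1 (v, w) ≠ 0}

end GIT

attribute [local instance] MvPolynomial.gradedAlgebra

/-- The structure morphism `Proj 𝒜 ⟶ Spec K` of a graded `K`-algebra. -/
def projToSpec {K A : Type} [Field K] [CommRing A] [Algebra K A] (𝒜 : ℕ → Submodule K A)
    [GradedAlgebra 𝒜] :
    AlgebraicGeometry.Proj 𝒜 ⟶ AlgebraicGeometry.Spec (CommRingCat.of K) :=
  CategoryTheory.CategoryStruct.comp (AlgebraicGeometry.Proj.toSpecZero 𝒜)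
    (AlgebraicGeometry.Spec.map (CommRingCat.ofHom (algebraMap K (𝒜 0))))

/-- A map `c` from a set of `K`-points of `Y` to `ℙ¹(K)`, for `K` algebraically closed, is the
projective GIT quotient of `Y` by the centralizer of `φ` in `SL₄`, linearized by the Plücker
embedding: it is defined on the semistable locus, and it is the canonical map
`Y^ss ⟶ Proj R(Y)^G` (which sends `P` to the ideal of the invariants that vanish at `P`) followed
by an isomorphism of `K`-schemes from `Proj R(Y)^G` to `ℙ¹ = Proj K[X₀, X₁]`. -/
def IsProjectiveGITQuotient {K : Type} [Field K] [Infinite K] (p : ℕ) (ε : ℤ)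
    {S : Set (Gr K)} (c : S → ℙ K (Fin 2 → K)) : Prop :=
  S = Yss K p ε ∧
  ∃ e : AlgebraicGeometry.Proj (invGrading K p ε) ≅
      AlgebraicGeometry.Proj (MvPolynomial.homogeneousSubmodule (Fin 2) K),
    CategoryTheory.CategoryStruct.comp e.hom
      (projToSpec (MvPolynomial.homogeneousSubmodule (Fin 2) K)) = projToSpec (invGrading K p ε) ∧
    ∀ P : S, ∃ x : AlgebraicGeometry.Proj (invGrading K p ε),
      (∀ f : invRing K p ε, f ∈ x.asHomogeneousIdeal ↔ ∀ v w, Spans P.1 v w → f.1 (v, w) = 0) ∧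
      ∀ h : MvPolynomial (Fin 2) K, h ∈ (e.hom x).asHomogeneousIdeal ↔
        ∀ a ∈ (c P).submodule, MvPolynomial.eval a h = 0

/-- After base change from `k` to the (algebraically closed) field `K`, the morphism
`c : Y^df ⟶ ℙ¹` over `k` is a projective GIT quotient. -/
def BecomesProjectiveGITQuotient (k : Type*) (K : Type) [Field k] [Field K] [Algebra k K]
    [Infinite K] (p : ℕ) (ε : ℤ) : Prop :=
  ∃ c : Ydf k K p ε → ℙ K (Fin 2 → K), IsExtension k p ε c ∧ IsProjectiveGITQuotient p ε c

end FilPhi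

end

open FilPhi

/-! On a plane `P = ⟨v, w⟩`, Cramer's rule writes `c` as `[num : den]`, with `den = det (v, w, φ v,
φ w)` and `num` quadratic forms in the Plücker coordinates (`cU_mul_den`). A linear map commuting
with `φ` multiplies both by its determinant (`num_map`, `den_map`), so `c` depends only on the class
of `D_P`.

Identify `K⁴` with the algebra `K[X] / (X⁴ + εpX² + p²)`. Over `ℚ_p` the quartic has no root, and a
nonzero vector is either cyclic, that is, a unit of this algebra, or an eigenvector of `φ²` with
eigenvalue a root of `X² + εpX + p²` (`linearIndependent_krylov`). The proper nonzero `φ`-stable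
subspaces are therefore the eigenplanes of `φ²`, with `t_N = 1`, and `D_P` fails to be admissible
exactly when `P` is one of them (`admissible_DP_iff`). A plane with a cyclic vector is a translate
of some `⟨1, y⟩`, where `num` and `den` are explicit, and this shows that the eigenplanes are also
their only common zeros (`num_den_eq_zero_iff`). No other expression of `c` reaches a common zero:
through such a point pass curves on which `num` and `den` vanish to second order with prescribed
leading coefficients, and these force every expression `[F : G]` to vanish there
(`IsExpression.aeval_eq_zero`). Hence the admissible locus is the domain of definition. Surjectivity
onto the isomorphism classes comes from a cyclic vector in every object (`exists_cyclic`), and the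
polarization from a pencil of skew forms whose nonzero members are all nondegenerate
(`exists_isAlt_similitude`).

For the fibers, `⟨1, y⟩` and `⟨1, z⟩` have the same image if and only if `1, y, z, yz` are dependent
(`wedge_mul_eq`). A relation gives `u` in `⟨1, y⟩` with `u z` in `⟨1, y⟩`, so multiplication by `u`
identifies the two planes as soon as `u` is a unit (`iso_of_ratio_eq`). This can fail only if the
plane meets an eigenplane of `φ²`, and then the value of `c` is `-εp` (`num_add_den_eq_zero`). When
the two eigenplanes exist, the fiber over `-εp` has three classes: planes that meet both, only the
first, or only the second (`exists_fiber_representatives`).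

Over the algebraic closure `φ` is diagonal with eigenvalues `a, -a, b, -b`, and the diagonal torus
of `SL₄` centralizes it. The products of complementary Plücker coordinates are torus invariants,
linearly related by the Plücker relation, and `num`, `den` form a basis of their span. A slice for
the torus action, on which `num` and `den` are coordinates, shows that the invariant ring is the
polynomial ring in these two forms of degree 2 (`exists_slice`, `invEquiv`). Its `Proj` is `ℙ¹`
through an isomorphism of rings that doubles degrees (`exists_projIso_over`). -/

noncomputable section

namespace FilPhi

/-! ### Determinantal formulas for the numerator and denominator of `c` -/

section Coordinates

variable {K : Type*} [Field K]

theorem phi_apply (p : ℕ) (ε : ℤ) (v : Fin 4 → K) :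
    phi K p ε v = ![-((p : K) ^ 2 * v 3), v 0, v 1 - (ε : K) * p * v 3, v 2] := by
  funext i
  fin_cases i <;>
    simp [phi, phiMat, Matrix.toLin'_apply, Matrix.mulVec, dotProduct, Fin.sum_univ_succ]
  ring

/-- The determinant of four vectors of `K⁴`. -/
def wedge (a b c d : Fin 4 → K) : K := (Pi.basisFun K (Fin 4)).det ![a, b, c, d]

theorem wedge_eq (a b c d : Fin 4 → K) :
    wedge a b c d =
      (a 0 * b 1 - a 1 * b 0) * (c 2 * d 3 - c 3 * d 2)
      - (a 0 * b 2 - a 2 * b 0) * (c 1 * d 3 - c 3 * d 1)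
      + (a 0 * b 3 - a 3 * b 0) * (c 1 * d 2 - c 2 * d 1)
      + (a 1 * b 2 - a 2 * b 1) * (c 0 * d 3 - c 3 * d 0)
      - (a 1 * b 3 - a 3 * b 1) * (c 0 * d 2 - c 2 * d 0)
      + (a 2 * b 3 - a 3 * b 2) * (c 0 * d 1 - c 1 * d 0) := by
  rw [wedge, Pi.basisFun_det_apply]
  simp [Matrix.det_succ_row_zero, Fin.sum_univ_succ, Fin.succAbove]
  ring

theorem wedge_map (g : (Fin 4 → K) →ₗ[K] (Fin 4 → K)) (a b c d : Fin 4 → K) :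
    wedge (g a) (g b) (g c) (g d) = LinearMap.det g * wedge a b c d := by
  rw [wedge, wedge, ← Basis.det_comp]
  congr 1
  funext i
  fin_cases i <;> rfl

theorem wedge_ne_zero_iff (a b c d : Fin 4 → K) :
    wedge a b c d ≠ 0 ↔ LinearIndependent K ![a, b, c, d] := by
  rw [wedge, ← isUnit_iff_ne_zero, ← Basis.is_basis_iff_det]
  exact ⟨fun h => h.1, fun h => ⟨h, h.span_eq_top_of_card_eq_finrank' (by simp)⟩⟩

/-- The denominator `det (v, w, φ v, φ w)` of the rational map `c`. -/
def den (p : ℕ) (ε : ℤ) (v w : Fin 4 → K) : K := wedge v w (phi K p ε v) (phi K p ε w)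

/-- The numerator `det (φ² v, w, φ v, φ w) + det (v, φ² w, φ v, φ w)` of the rational map `c`. -/
def num (p : ℕ) (ε : ℤ) (v w : Fin 4 → K) : K :=
  wedge (phi K p ε (phi K p ε v)) w (phi K p ε v) (phi K p ε w) +
    wedge v (phi K p ε (phi K p ε w)) (phi K p ε v) (phi K p ε w)

/-- `den` as a quadratic form in the Plücker coordinates. -/
def denForm {R : Type*} [CommRing R] (e q x01 x02 x03 x12 x13 x23 : R) : R :=
  x01 * (x12 + e * x23) - x02 * x02 + x03 * (x01 - e * x03) + x12 * (q * x23) - x13 * (q * x13)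
    + x23 * (q * x03)

/-- `num` as a quadratic form in the Plücker coordinates. -/
def numForm {R : Type*} [CommRing R] (e q x01 x02 x03 x12 x13 x23 : R) : R :=
  q * (x12 - x03) * (x12 + e * x23) + e * x02 * x02 + (x01 - e * x03 - q * x23) * (x01 - e * x03)
    + (q * x23 - x01 - e * x12) * (q * x23) + e * x13 * (q * x13)
    + (x03 - x12 - 2 * (e * x23)) * (q * x03)

theorem den_eq (p : ℕ) (ε : ℤ) (v w : Fin 4 → K) :
    den p ε v w = denForm ((ε : K) * p) ((p : K) ^ 2) (v 0 * w 1 - v 1 * w 0)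
      (v 0 * w 2 - v 2 * w 0) (v 0 * w 3 - v 3 * w 0) (v 1 * w 2 - v 2 * w 1)
      (v 1 * w 3 - v 3 * w 1) (v 2 * w 3 - v 3 * w 2) := by
  simp only [den, wedge_eq, phi_apply, denForm]
  simp
  ring

theorem num_eq (p : ℕ) (ε : ℤ) (v w : Fin 4 → K) :
    num p ε v w = numForm ((ε : K) * p) ((p : K) ^ 2) (v 0 * w 1 - v 1 * w 0)
      (v 0 * w 2 - v 2 * w 0) (v 0 * w 3 - v 3 * w 0) (v 1 * w 2 - v 2 * w 1)
      (v 1 * w 3 - v 3 * w 1) (v 2 * w 3 - v 3 * w 2) := by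
  simp only [num, wedge_eq, phi_apply, numForm]
  simp
  ring

/-- The Plücker coordinate of index `(i, j)` as a variable. -/
def plX (k : Type*) [Field k] (i j : Fin 4) (h : i < j) : MvPolynomial PIdx k :=
  MvPolynomial.X ⟨(i, j), h⟩

/-- `den` as a polynomial in the Plücker coordinates. -/
def denPoly (k : Type*) [Field k] (p : ℕ) (ε : ℤ) : MvPolynomial PIdx k :=
  denForm (MvPolynomial.C ((ε : k) * p)) (MvPolynomial.C ((p : k) ^ 2))
    (plX k 0 1 (by decide)) (plX k 0 2 (by decide)) (plX k 0 3 (by decide))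
    (plX k 1 2 (by decide)) (plX k 1 3 (by decide)) (plX k 2 3 (by decide))

/-- `num` as a polynomial in the Plücker coordinates. -/
def numPoly (k : Type*) [Field k] (p : ℕ) (ε : ℤ) : MvPolynomial PIdx k :=
  numForm (MvPolynomial.C ((ε : k) * p)) (MvPolynomial.C ((p : k) ^ 2))
    (plX k 0 1 (by decide)) (plX k 0 2 (by decide)) (plX k 0 3 (by decide))
    (plX k 1 2 (by decide)) (plX k 1 3 (by decide)) (plX k 2 3 (by decide))

theorem isHomogeneous_plX (k : Type*) [Field k] (i j : Fin 4) (h : i < j) :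
    (plX k i j h).IsHomogeneous 1 := MvPolynomial.isHomogeneous_X _ _

theorem isHomogeneous_C_mul {σ k : Type*} [Field k] (a : k) {f : MvPolynomial σ k} {n : ℕ}
    (hf : f.IsHomogeneous n) : (MvPolynomial.C a * f).IsHomogeneous n := by
  simpa using (MvPolynomial.isHomogeneous_C _ a).mul hf

theorem isHomogeneous_denPoly (k : Type*) [Field k] (p : ℕ) (ε : ℤ) :
    (denPoly k p ε).IsHomogeneous 2 := by
  have m : ∀ {f g : MvPolynomial PIdx k}, f.IsHomogeneous 1 → g.IsHomogeneous 1 →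
    (f * g).IsHomogeneous 2 := fun hf hg => hf.mul hg
  have x := isHomogeneous_plX k
  have c := fun (a : k) (f : MvPolynomial PIdx k) (hf : f.IsHomogeneous 1) =>
    isHomogeneous_C_mul a hf
  exact (((((m (x _ _ _) ((x _ _ _).add (c _ _ (x _ _ _)))).sub (m (x _ _ _) (x _ _ _))).add
    (m (x _ _ _) ((x _ _ _).sub (c _ _ (x _ _ _))))).add (m (x _ _ _) (c _ _ (x _ _ _)))).sub
    (m (x _ _ _) (c _ _ (x _ _ _)))).add (m (x _ _ _) (c _ _ (x _ _ _)))

theorem isHomogeneous_numPoly (k : Type*) [Field k] (p : ℕ) (ε : ℤ) :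
    (numPoly k p ε).IsHomogeneous 2 := by
  have h2 : (2 : MvPolynomial PIdx k) = MvPolynomial.C 2 :=
    (map_ofNat MvPolynomial.C 2).symm
  have m : ∀ {f g : MvPolynomial PIdx k}, f.IsHomogeneous 1 → g.IsHomogeneous 1 →
    (f * g).IsHomogeneous 2 := fun hf hg => hf.mul hg
  have x := isHomogeneous_plX k
  have c := fun (a : k) (f : MvPolynomial PIdx k) (hf : f.IsHomogeneous 1) =>
    isHomogeneous_C_mul a hf
  unfold numPoly numForm
  rw [h2]
  exact (((((m (c _ _ ((x _ _ _).sub (x _ _ _))) ((x _ _ _).add (c _ _ (x _ _ _)))).add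
    (m (c _ _ (x _ _ _)) (x _ _ _))).add
    (m (((x _ _ _).sub (c _ _ (x _ _ _))).sub (c _ _ (x _ _ _)))
      ((x _ _ _).sub (c _ _ (x _ _ _))))).add
    (m (((c _ _ (x _ _ _)).sub (x _ _ _)).sub (c _ _ (x _ _ _))) (c _ _ (x _ _ _)))).add
    (m (c _ _ (x _ _ _)) (c _ _ (x _ _ _)))).add
    (m (((x _ _ _).sub (x _ _ _)).sub (c _ _ (c _ _ (x _ _ _)))) (c _ _ (x _ _ _)))

theorem aeval_denPoly (k : Type*) [Field k] [Algebra k K] (p : ℕ) (ε : ℤ) (v w : Fin 4 → K) :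
    MvPolynomial.aeval (plucker v w) (denPoly k p ε) = den p ε v w := by
  simp [den_eq, denPoly, denForm, plX, plucker]

theorem aeval_numPoly (k : Type*) [Field k] [Algebra k K] (p : ℕ) (ε : ℤ) (v w : Fin 4 → K) :
    MvPolynomial.aeval (plucker v w) (numPoly k p ε) = num p ε v w := by
  simp [num_eq, numPoly, numForm, plX, plucker]

theorem den_map (p : ℕ) (ε : ℤ) {g : (Fin 4 → K) →ₗ[K] (Fin 4 → K)}
    (hg : ∀ x, g (phi K p ε x) = phi K p ε (g x)) (v w : Fin 4 → K) :
    den p ε (g v) (g w) = LinearMap.det g * den p ε v w := by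
  simp only [den, ← hg, wedge_map]

theorem num_map (p : ℕ) (ε : ℤ) {g : (Fin 4 → K) →ₗ[K] (Fin 4 → K)}
    (hg : ∀ x, g (phi K p ε x) = phi K p ε (g x)) (v w : Fin 4 → K) :
    num p ε (g v) (g w) = LinearMap.det g * num p ε v w := by
  simp only [num, ← hg, wedge_map, mul_add]

end Coordinates

/-! ### Bases of planes, and `c` as the quotient of `num` by `den` -/

section Planes

variable {K : Type*} [Field K]

theorem exists_span_pair_eq {M : Type*} [AddCommGroup M] [Module K M] {V : Submodule K M}
    (hV : finrank K V = 2) : ∃ v w, Submodule.span K {v, w} = V := by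
  have : Module.Finite K V := Module.finite_of_finrank_pos (by rw [hV]; norm_num)
  have b := finBasisOfFinrankEq K V hV
  refine ⟨b 0, b 1, ?_⟩
  have h := congrArg (Submodule.map V.subtype) b.span_eq
  rw [Submodule.map_span, Submodule.map_top, Submodule.range_subtype] at h
  refine Eq.trans ?_ h
  congr 1
  ext x
  simp [Fin.exists_fin_two, eq_comm]

theorem exists_spans (P : Gr K) : ∃ v w, Spans P v w := exists_span_pair_eq P.2

theorem Spans.linearIndependent {P : Gr K} {v w : Fin 4 → K} (h : Spans P v w) :
    LinearIndependent K ![v, w] := by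
  rw [linearIndependent_iff_card_eq_finrank_span]
  have : Set.range ![v, w] = {v, w} := by simp [Matrix.range_cons, Matrix.range_empty, Set.pair_comm]
  rw [Set.finrank, this, h, P.2]
  simp

theorem Spans.left_mem {P : Gr K} {v w : Fin 4 → K} (h : Spans P v w) : v ∈ P.1 :=
  h ▸ Submodule.subset_span (by simp)

theorem Spans.right_mem {P : Gr K} {v w : Fin 4 → K} (h : Spans P v w) : w ∈ P.1 :=
  h ▸ Submodule.subset_span (by simp)

theorem finrank_span_pair_of_linearIndependent {M : Type*} [AddCommGroup M] [Module K M] {v w : M}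
    (h : LinearIndependent K ![v, w]) : finrank K (Submodule.span K {v, w}) = 2 := by
  have := finrank_span_eq_card h
  have h2 : Set.range ![v, w] = {v, w} := by simp [Matrix.range_cons, Matrix.range_empty, Set.pair_comm]
  rw [h2] at this
  simpa using this

/-- The plane spanned by two independent vectors. -/
def planeOf {v w : Fin 4 → K} (h : LinearIndependent K ![v, w]) : Gr K :=
  ⟨Submodule.span K {v, w}, finrank_span_pair_of_linearIndependent h⟩

theorem spans_planeOf {v w : Fin 4 → K} (h : LinearIndependent K ![v, w]) :
    Spans (planeOf h) v w := rfl

theorem spans_of_mem {P : Gr K} {v w : Fin 4 → K} (hv : v ∈ P.1) (hw : w ∈ P.1)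
    (h : LinearIndependent K ![v, w]) : Spans P v w := by
  have : Module.Finite K P.1 := Module.finite_of_finrank_pos (by rw [P.2]; norm_num)
  exact Submodule.eq_of_le_of_finrank_eq (Submodule.span_le.2 (by simp [Set.insert_subset_iff, hv, hw]))
    (by rw [finrank_span_pair_of_linearIndependent h, P.2])

theorem exists_spans_left {P : Gr K} {v : Fin 4 → K} (hv : v ∈ P.1) (h0 : v ≠ 0) :
    ∃ w, Spans P v w := by
  obtain ⟨a, b, hab⟩ := exists_spans P
  have hind := hab.linearIndependent
  by_cases h : LinearIndependent K ![v, a]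
  · exact ⟨a, spans_of_mem hv hab.left_mem h⟩
  · refine ⟨b, spans_of_mem hv hab.right_mem ?_⟩
    rw [LinearIndependent.pair_iff] at h hind ⊢
    push Not at h
    obtain ⟨s, t, hst, hne⟩ := h
    have hs : t ≠ 0 := by
      rintro rfl
      have : s = 0 := by simpa [h0] using hst
      exact hne this rfl
    have ha : a = (-(t⁻¹ * s)) • v := by
      have : t • a = -(s • v) := by rw [eq_neg_iff_add_eq_zero, add_comm, hst]
      rw [neg_smul, mul_smul, ← smul_neg, ← this, smul_smul, inv_mul_cancel₀ hs, one_smul]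
    intro c d hcd
    by_cases hd : d = 0
    · subst hd
      exact ⟨by simpa [h0] using hcd, rfl⟩
    · exfalso
      have hb : b = (-(d⁻¹ * c)) • v := by
        have : d • b = -(c • v) := by rw [eq_neg_iff_add_eq_zero, add_comm, hcd]
        rw [neg_smul, mul_smul, ← smul_neg, ← this, smul_smul, inv_mul_cancel₀ hd, one_smul]
      by_cases hv0 : -(t⁻¹ * s) = 0
      · have := (hind 1 0 (by rw [ha, hv0]; simp)).1
        exact one_ne_zero this
      · have := hind (-(d⁻¹ * c)) (t⁻¹ * s) (by rw [ha, hb, smul_smul, smul_smul, ← add_smul]; simp; left; ring)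
        exact hv0 (by rw [this.2, neg_zero])

/-- The Plücker coordinates of two bases of a plane are proportional. -/
theorem Spans.exists_smul {P : Gr K} {v w v' w' : Fin 4 → K} (h : Spans P v w)
    (h' : Spans P v' w') : ∃ t : K, t ≠ 0 ∧
      ∀ i j, v' i * w' j - v' j * w' i = t * (v i * w j - v j * w i) := by
  obtain ⟨a, b, rfl⟩ := Submodule.mem_span_pair.1 ((h : _ = P.1) ▸ h'.left_mem)
  obtain ⟨c, d, rfl⟩ := Submodule.mem_span_pair.1 ((h : _ = P.1) ▸ h'.right_mem)
  refine ⟨a * d - b * c, fun h0 => ?_, fun i j => ?_⟩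
  · have hl := h'.linearIndependent
    rw [LinearIndependent.pair_iff] at hl
    have h1 := hl d (-b) (by
      rw [smul_add, smul_add, smul_smul, smul_smul, smul_smul, smul_smul, add_add_add_comm,
        ← add_smul, ← add_smul, show d * a + -b * c = 0 by linear_combination h0,
        show d * b + -b * d = 0 by ring]
      simp)
    have h2 := hl c (-a) (by
      rw [smul_add, smul_add, smul_smul, smul_smul, smul_smul, smul_smul, add_add_add_comm,
        ← add_smul, ← add_smul, show c * b + -a * d = 0 by linear_combination -h0,
        show c * a + -a * c = 0 by ring]
      simp)
    refine LinearIndependent.ne_zero 0 h'.linearIndependent ?_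
    simp [neg_eq_zero.1 h1.2, neg_eq_zero.1 h2.2]
  · simp only [Pi.add_apply, Pi.smul_apply, smul_eq_mul]
    ring

theorem den_eq_of_minors {p : ℕ} {ε : ℤ} {v w v' w' : Fin 4 → K} {t : K}
    (h : ∀ i j, v' i * w' j - v' j * w' i = t * (v i * w j - v j * w i)) :
    den p ε v' w' = t ^ 2 * den p ε v w := by
  simp only [den_eq, h, denForm]
  ring

theorem num_eq_of_minors {p : ℕ} {ε : ℤ} {v w v' w' : Fin 4 → K} {t : K}
    (h : ∀ i j, v' i * w' j - v' j * w' i = t * (v i * w j - v j * w i)) :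
    num p ε v' w' = t ^ 2 * num p ε v w := by
  simp only [num_eq, h, numForm]
  ring

/-- Since `φ(P)` has dimension at most 2, `P + φ(P) = K⁴` already forces the sum to be direct, so
only the independence of `v, w, φ v, φ w` matters. -/
theorem inU_iff {p : ℕ} {ε : ℤ} {P : Gr K} {v w : Fin 4 → K} (h : Spans P v w) :
    InU p ε P ↔ den p ε v w ≠ 0 := by
  have hmap : P.1.map (phi K p ε) = Submodule.span K {phi K p ε v, phi K p ε w} := by
    rw [← h, Submodule.map_span, Set.image_pair]
  have hr : Set.range ![v, w, phi K p ε v, phi K p ε w] =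
      {v, w} ∪ {phi K p ε v, phi K p ε w} := by
    ext x
    simp [Matrix.range_cons, Matrix.range_empty]
    tauto
  have htop : P.1 ⊔ P.1.map (phi K p ε) =
      Submodule.span K (Set.range ![v, w, phi K p ε v, phi K p ε w]) := by
    rw [hr, Submodule.span_union, ← hmap, h]
  have hfr : finrank K (P.1.map (phi K p ε)) ≤ 2 := (Submodule.finrank_map_le _ _).trans_eq P.2
  rw [InU, den, wedge_ne_zero_iff]
  constructor
  · intro hc
    refine linearIndependent_of_top_le_span_of_card_eq_finrank ?_ (by simp)
    rw [← htop, hc.sup_eq_top]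
  · intro hl
    have h1 : P.1 ⊔ P.1.map (phi K p ε) = ⊤ := by
      rw [htop]
      exact hl.span_eq_top_of_card_eq_finrank' (by simp)
    refine ⟨?_, codisjoint_iff.2 h1⟩
    rw [disjoint_iff, ← Submodule.finrank_eq_zero (R := K)]
    have h2 := Submodule.finrank_sup_add_finrank_inf_eq P.1 (P.1.map (phi K p ε))
    rw [h1, finrank_top, P.2] at h2
    simp at h2
    omega

theorem mem_span_pair_iff_of_spans {P : Gr K} {v w x : Fin 4 → K} (h : Spans P v w) :
    x ∈ P.1 ↔ ∃ a b : K, a • v + b • w = x := by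
  rw [← h, Submodule.mem_span_pair]

theorem sub_projectionOnto_mem {M : Type*} [AddCommGroup M] [Module K M] {V W : Submodule K M}
    (h : IsCompl V W) (x : M) : x - (V.projectionOnto W h x : M) ∈ W := by
  have : V.projectionOnto W h (x - (V.projectionOnto W h x : M)) = 0 := by
    rw [map_sub, Submodule.projectionOnto_apply_left, sub_self]
  exact (Submodule.projectionOnto_apply_eq_zero_iff h).1 this

/-- Cramer's rule: when `φ² v` and `φ² w` are expanded in the basis `v, w, φ v, φ w`, the two
determinants of `num` pick out the diagonal coefficients, and the components along `φ(P)` drop out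
as repeated columns. -/
theorem cU_mul_den {p : ℕ} {ε : ℤ} {P : Gr K} (hU : InU p ε P) {v w : Fin 4 → K}
    (h : Spans P v w) : cU P hU * den p ε v w = num p ε v w := by
  let b : Basis (Fin 2) K P.1 := Basis.mk (v := ![⟨v, h.left_mem⟩, ⟨w, h.right_mem⟩])
    (by
      have := h.linearIndependent
      refine LinearIndependent.of_comp P.1.subtype ?_
      convert this using 1
      funext i
      fin_cases i <;> rfl)
    (by
      rintro ⟨x, hx⟩ -
      obtain ⟨a, b, rfl⟩ := (mem_span_pair_iff_of_spans h).1 hx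
      have : (⟨a • v + b • w, hx⟩ : P.1) = a • ⟨v, h.left_mem⟩ + b • ⟨w, h.right_mem⟩ := rfl
      rw [this]
      exact Submodule.add_mem _ (Submodule.smul_mem _ _ (Submodule.subset_span ⟨0, rfl⟩))
        (Submodule.smul_mem _ _ (Submodule.subset_span ⟨1, rfl⟩)))
  have hb0 : ((b 0 : P.1) : Fin 4 → K) = v := by simp [b]
  have hb1 : ((b 1 : P.1) : Fin 4 → K) = w := by simp [b]
  set T := (P.1.projectionOnto (P.1.map (phi K p ε)) hU) ∘ₗ (phi K p ε ∘ₗ phi K p ε) ∘ₗ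
    P.1.subtype with hT
  have key : ∀ x : P.1, ∃ c d : K, phi K p ε (phi K p ε x) =
      (b.repr (T x) 0) • v + (b.repr (T x) 1) • w + c • phi K p ε v + d • phi K p ε w := by
    intro x
    have h1 : phi K p ε (phi K p ε x) - (T x : Fin 4 → K) ∈ P.1.map (phi K p ε) :=
      sub_projectionOnto_mem hU _
    obtain ⟨y, hy, hy'⟩ := h1
    obtain ⟨c, d, rfl⟩ := (mem_span_pair_iff_of_spans h).1 hy
    refine ⟨c, d, ?_⟩
    have h2 := congrArg (Subtype.val) (b.sum_repr (T x))
    rw [Fin.sum_univ_two] at h2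
    simp only [Submodule.coe_add, Submodule.coe_smul, hb0, hb1] at h2
    rw [h2, add_assoc, ← map_smul, ← map_smul, ← map_add, hy']
    abel
  have htr : cU P hU = b.repr (T (b 0)) 0 + b.repr (T (b 1)) 1 := by
    rw [cU, ← hT, LinearMap.trace_eq_matrix_trace K b, Matrix.trace, Fin.sum_univ_two]
    simp [LinearMap.toMatrix_apply]
  obtain ⟨c, d, h0⟩ := key (b 0)
  obtain ⟨c', d', h1⟩ := key (b 1)
  rw [hb0] at h0
  rw [hb1] at h1
  rw [htr, num, h0, h1, den]
  simp only [wedge_eq, Pi.add_apply, Pi.smul_apply, smul_eq_mul]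
  ring

theorem isExpression_num_den (k : Type*) [Field k] [Algebra k K] (p : ℕ) (ε : ℤ) :
    IsExpression k K p ε (numPoly k p ε) (denPoly k p ε) :=
  ⟨⟨2, isHomogeneous_numPoly k p ε, isHomogeneous_denPoly k p ε⟩, fun P h v w hs => by
    rw [aeval_numPoly, aeval_denPoly, cU_mul_den h hs]⟩

end Planes

/-! ### Valuations and the roots of the quartic and of `X² + εpX + p²` -/

section Arithmetic

variable {p : ℕ} [Fact p.Prime]

theorem natCast_prime_ne_zero : (p : ℚ_[p]) ≠ 0 :=
  Nat.cast_ne_zero.2 (Fact.out : p.Prime).ne_zero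

/-- An integer that is a nonzero multiple of `p` exactly once is not a square in `ℚ_[p]`. -/
theorem sq_ne_intCast_mul_prime {u : ℤ} (hu : ¬ (p : ℤ) ∣ u) (t : ℚ_[p]) :
    t ^ 2 ≠ (u : ℚ_[p]) * p := by
  intro h
  have hu0 : (u : ℚ_[p]) ≠ 0 := by
    rintro h0
    exact hu (by simp [Int.cast_eq_zero.1 h0])
  have h1 := congrArg Padic.valuation h
  rw [Padic.valuation_pow, Padic.valuation_mul hu0 natCast_prime_ne_zero, Padic.valuation_p,
    Padic.valuation_intCast, padicValInt.eq_zero_of_not_dvd hu] at h1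
  push_cast at h1
  omega

theorem not_dvd_small {p : ℕ} (hp : 7 ≤ p) {u : ℤ} (h0 : u ≠ 0) (h1 : -3 ≤ u) (h2 : u ≤ 3) :
    ¬ (p : ℤ) ∣ u := by
  rintro ⟨c, rfl⟩
  have hc : c ≠ 0 := by rintro rfl; simp at h0
  rcases lt_or_gt_of_ne hc with h | h
  · nlinarith
  · nlinarith

/-- `X ^ 4 + ε p X ^ 2 + p ^ 2` has no root in `ℚ_[p]`. -/
theorem quartic_ne_zero (hp : 7 ≤ p) {ε : ℤ} (hε : ε = 0 ∨ ε = 1 ∨ ε = -1) (r : ℚ_[p]) :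
    r ^ 4 + (ε : ℚ_[p]) * p * r ^ 2 + (p : ℚ_[p]) ^ 2 ≠ 0 := by
  intro h
  have hr : r ≠ 0 := by
    rintro rfl
    simp [(Fact.out : p.Prime).ne_zero] at h
  -- A root `r` would give `(r² + p)² = (2 - ε) p r²`, hence a square of odd valuation.
  refine sq_ne_intCast_mul_prime (p := p) (u := 2 - ε)
    (not_dvd_small hp (by omega) (by omega) (by omega)) ((r ^ 2 + p) / r) ?_
  field_simp
  push_cast
  linear_combination h

/-- `a` is a root of `X ^ 2 + ε p X + p ^ 2`. -/
def IsQuadRoot (ε : ℤ) (a : ℚ_[p]) : Prop := a ^ 2 + (ε : ℚ_[p]) * p * a + (p : ℚ_[p]) ^ 2 = 0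

theorem IsQuadRoot.ne_zero {ε : ℤ} {a : ℚ_[p]} (h : IsQuadRoot ε a) : a ≠ 0 := by
  rintro rfl
  simp [IsQuadRoot, (Fact.out : p.Prime).ne_zero] at h

theorem IsQuadRoot.conj {ε : ℤ} {a : ℚ_[p]} (h : IsQuadRoot ε a) :
    IsQuadRoot ε (-((ε : ℚ_[p]) * (p : ℚ_[p])) - a) := by
  unfold IsQuadRoot at *
  linear_combination h

theorem IsQuadRoot.ne_conj {ε : ℤ} (hε : ε = 0 ∨ ε = 1 ∨ ε = -1) {a : ℚ_[p]}
    (h : IsQuadRoot ε a) : a ≠ -((ε : ℚ_[p]) * p) - a := by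
  intro h1
  have h2 : ((ε : ℚ_[p]) ^ 2 - 4) * (p : ℚ_[p]) ^ 2 = 0 := by
    unfold IsQuadRoot at h
    linear_combination (-4) * h + (2 * a + (ε : ℚ_[p]) * p) * h1
  rcases mul_eq_zero.1 h2 with h3 | h3
  · rcases hε with rfl | rfl | rfl <;> norm_num at h3
  · exact natCast_prime_ne_zero (pow_eq_zero_iff two_ne_zero |>.1 h3)

theorem IsQuadRoot.eq_or_eq {ε : ℤ} {a b : ℚ_[p]} (h : IsQuadRoot ε a) (hb : IsQuadRoot ε b) :
    b = a ∨ b = -((ε : ℚ_[p]) * p) - a := by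
  have : (b - a) * (b - (-((ε : ℚ_[p]) * p) - a)) = 0 := by
    unfold IsQuadRoot at *
    linear_combination hb - h
  rcases mul_eq_zero.1 this with h | h
  · exact Or.inl (sub_eq_zero.1 h)
  · exact Or.inr (sub_eq_zero.1 h)

/-- The quotient `a / p` is a root of `X² + εX + 1`, a cyclotomic polynomial of order 4, 3 or 6, so
it is a 12th root of unity. -/
theorem IsQuadRoot.valuation {ε : ℤ} (hε : ε = 0 ∨ ε = 1 ∨ ε = -1) {a : ℚ_[p]}
    (h : IsQuadRoot ε a) : a.valuation = 1 := by
  have hp0 := natCast_prime_ne_zero (p := p)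
  have h12 : a ^ 12 = (p : ℚ_[p]) ^ 12 := by
    unfold IsQuadRoot at h
    have h6 : a ^ 6 = (p : ℚ_[p]) ^ 6 ∨ a ^ 6 = - (p : ℚ_[p]) ^ 6 := by
      rcases hε with rfl | rfl | rfl
      · right
        push_cast at h
        have : a ^ 2 = - (p : ℚ_[p]) ^ 2 := by linear_combination h
        rw [show a ^ 6 = (a ^ 2) ^ 3 by ring, this]
        ring
      · left
        push_cast at h
        have : a ^ 3 = (p : ℚ_[p]) ^ 3 := by linear_combination (a - p) * h
        rw [show a ^ 6 = (a ^ 3) ^ 2 by ring, this]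
        ring
      · left
        push_cast at h
        have : a ^ 3 = - (p : ℚ_[p]) ^ 3 := by linear_combination (a + p) * h
        rw [show a ^ 6 = (a ^ 3) ^ 2 by ring, this]
        ring
    rw [show a ^ 12 = (a ^ 6) ^ 2 by ring]
    rcases h6 with h6 | h6 <;> rw [h6] <;> ring
  have h1 := congrArg Padic.valuation h12
  rw [Padic.valuation_pow, Padic.valuation_pow, Padic.valuation_p] at h1
  push_cast at h1
  omega

end Arithmetic

/-! ### Cyclic vectors -/

section Krylov

variable {p : ℕ} [Fact p.Prime] {M : Type*} [AddCommGroup M] [Module ℚ_[p] M]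

theorem eq_smul_of_smul_add_eq_zero {K : Type*} [Field K] {M : Type*} [AddCommGroup M] [Module K M]
    {c : K} (hc : c ≠ 0) {x y : M} (h : c • x + y = 0) : x = (-c⁻¹) • y := by
  rw [eq_neg_of_add_eq_zero_right h, neg_smul, smul_neg, neg_neg, smul_smul, inv_mul_cancel₀ hc,
    one_smul]

/-- A nonzero vector that is not an eigenvector of `f²` is cyclic, for an endomorphism `f` killed by
`X ^ 4 + ε p X ^ 2 + p ^ 2`. -/
theorem linearIndependent_krylov (hp : 7 ≤ p) {ε : ℤ} (hε : ε = 0 ∨ ε = 1 ∨ ε = -1)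
    (f : M →ₗ[ℚ_[p]] M)
    (hf : ∀ x, f (f (f (f x))) + ((ε : ℚ_[p]) * p) • f (f x) + ((p : ℚ_[p]) ^ 2) • x = 0)
    {v : M} (hv : v ≠ 0) (hroot : ∀ a : ℚ_[p], IsQuadRoot ε a → f (f v) ≠ a • v) :
    LinearIndependent ℚ_[p] ![v, f v, f (f v), f (f (f v))] := by
  have h4 := hf v
  have i1 : ∀ c0 c1 : ℚ_[p], c1 • f v + c0 • v = 0 → c1 = 0 ∧ c0 = 0 := by
    intro c0 c1 h
    have hc1 : c1 = 0 := by
      by_contra hc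
      have h1 := eq_smul_of_smul_add_eq_zero hc h
      rw [smul_smul] at h1
      generalize -c1⁻¹ * c0 = r at h1
      simp only [h1, map_smul, smul_smul, ← add_smul] at h4
      refine quartic_ne_zero hp hε r ?_
      rcases smul_eq_zero.1 h4 with h5 | h5
      · linear_combination h5
      · exact absurd h5 hv
    subst hc1
    simpa [hv] using h
  have i2 : ∀ c0 c1 c2 : ℚ_[p], c2 • f (f v) + (c1 • f v + c0 • v) = 0 →
      c2 = 0 ∧ c1 = 0 ∧ c0 = 0 := by
    intro c0 c1 c2 h
    have hc2 : c2 = 0 := by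
      by_contra hc
      have h1 := eq_smul_of_smul_add_eq_zero hc h
      rw [smul_add, smul_smul, smul_smul] at h1
      generalize -c2⁻¹ * c1 = m at h1
      generalize -c2⁻¹ * c0 = n at h1
      -- The remainder of the quartic modulo `X² - mX - n`; by `i1` both of its coefficients vanish.
      have h5 : (m ^ 3 + 2 * (m * n) + (ε : ℚ_[p]) * p * m) • f v +
          (m ^ 2 * n + n ^ 2 + (ε : ℚ_[p]) * p * n + (p : ℚ_[p]) ^ 2) • v = 0 := by
        rw [← h4]
        simp only [h1, map_smul, map_add]
        module
      obtain ⟨h6, h7⟩ := i1 _ _ h5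
      by_cases hm : m = 0
      · subst hm
        refine hroot n ?_ (by simpa using h1)
        unfold IsQuadRoot
        linear_combination h7
      · have h8 : m ^ 2 + 2 * n + (ε : ℚ_[p]) * p = 0 := by
          refine (mul_eq_zero.1 (?_ : m * _ = 0)).resolve_left hm
          linear_combination h6
        -- A quadratic factor with `m ≠ 0` has `n = ±p`, so that `m²` is `(-2 - ε) p` or `(2 - ε)
        -- p`, again of odd valuation.
        have h9 : (n - p) * (n + p) = 0 := by linear_combination n * h8 - h7
        rcases mul_eq_zero.1 h9 with h | h
        · refine sq_ne_intCast_mul_prime (p := p) (u := -2 - ε)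
            (not_dvd_small hp (by omega) (by omega) (by omega)) m ?_
          push_cast
          linear_combination h8 - 2 * h
        · refine sq_ne_intCast_mul_prime (p := p) (u := 2 - ε)
            (not_dvd_small hp (by omega) (by omega) (by omega)) m ?_
          push_cast
          linear_combination h8 - 2 * h
    subst hc2
    exact ⟨rfl, i1 _ _ (by simpa using h)⟩
  rw [Fintype.linearIndependent_iff]
  intro g hg
  simp only [Fin.sum_univ_four, Matrix.cons_val_zero, Matrix.cons_val_one, Matrix.cons_val] at hg
  have h : g 3 • f (f (f v)) + (g 2 • f (f v) + (g 1 • f v + g 0 • v)) = 0 := by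
    rw [← hg]
    abel
  have hc3 : g 3 = 0 := by
    by_contra hc
    have h1 := eq_smul_of_smul_add_eq_zero hc h
    rw [smul_add, smul_add, smul_smul, smul_smul, smul_smul] at h1
    generalize -(g 3)⁻¹ * g 2 = l at h1
    generalize -(g 3)⁻¹ * g 1 = m at h1
    generalize -(g 3)⁻¹ * g 0 = n at h1
    have h5 : (l ^ 2 + m + (ε : ℚ_[p]) * p) • f (f v) + ((l * m + n) • f v +
        (l * n + (p : ℚ_[p]) ^ 2) • v) = 0 := by
      rw [← h4]
      simp only [h1, map_smul, map_add]
      module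
    obtain ⟨h6, h7, h8⟩ := i2 _ _ _ h5
    -- The quartic would be `(X³ - lX² - mX - n)(X + l)`; it is even, so with `-l` also `l` would be
    -- a root.
    exact quartic_ne_zero hp hε l (by linear_combination h8 - l * h7 + l ^ 2 * h6)
  rw [hc3] at h
  obtain ⟨h2, h1, h0⟩ := i2 _ _ _ (by simpa using h)
  intro i
  fin_cases i <;> assumption

end Krylov

/-! ### The algebra structure on `K⁴` and the normal form `⟨1, y⟩` -/

section MulBy

variable {K : Type*} [Field K]

theorem phi_charpoly_apply (p : ℕ) (ε : ℤ) (x : Fin 4 → K) :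
    phi K p ε (phi K p ε (phi K p ε (phi K p ε x))) +
      ((ε : K) * p) • phi K p ε (phi K p ε x) + ((p : K) ^ 2) • x = 0 := by
  funext i
  fin_cases i <;> simp [phi_apply] <;> ring

/-- Multiplication by `v`, when `K⁴` is identified with `K[X] / (X ^ 4 + ε p X ^ 2 + p ^ 2)`. -/
def mulBy (p : ℕ) (ε : ℤ) (v : Fin 4 → K) : (Fin 4 → K) →ₗ[K] (Fin 4 → K) :=
  v 0 • LinearMap.id + v 1 • phi K p ε + v 2 • (phi K p ε ∘ₗ phi K p ε) +
    v 3 • (phi K p ε ∘ₗ phi K p ε ∘ₗ phi K p ε)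

theorem mulBy_apply (p : ℕ) (ε : ℤ) (v x : Fin 4 → K) :
    mulBy p ε v x = v 0 • x + v 1 • phi K p ε x + v 2 • phi K p ε (phi K p ε x) +
      v 3 • phi K p ε (phi K p ε (phi K p ε x)) := rfl

theorem mulBy_comm (p : ℕ) (ε : ℤ) (v w : Fin 4 → K) : mulBy p ε v w = mulBy p ε w v := by
  funext i
  fin_cases i <;> simp [mulBy_apply, phi_apply, -Matrix.cons_add, -Matrix.add_cons] <;> ring

theorem mulBy_phi (p : ℕ) (ε : ℤ) (v x : Fin 4 → K) :
    mulBy p ε v (phi K p ε x) = phi K p ε (mulBy p ε v x) := by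
  simp only [mulBy_apply, map_add, map_smul]

/-- The unit of `K[X] / (X ^ 4 + ε p X ^ 2 + p ^ 2)`. -/
def unitVec : Fin 4 → K := ![1, 0, 0, 0]

theorem mulBy_unitVec (p : ℕ) (ε : ℤ) (v : Fin 4 → K) : mulBy p ε v unitVec = v := by
  funext i
  fin_cases i <;> simp [mulBy_apply, phi_apply, unitVec]

/-- `v` is a cyclic vector for `φ`. -/
def IsCyclicVec (p : ℕ) (ε : ℤ) (v : Fin 4 → K) : Prop :=
  LinearIndependent K ![v, phi K p ε v, phi K p ε (phi K p ε v),
    phi K p ε (phi K p ε (phi K p ε v))]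

theorem IsCyclicVec.ne_zero {p : ℕ} {ε : ℤ} {v : Fin 4 → K} (h : IsCyclicVec p ε v) : v ≠ 0 :=
  LinearIndependent.ne_zero 0 h

theorem IsCyclicVec.injective {p : ℕ} {ε : ℤ} {v : Fin 4 → K} (h : IsCyclicVec p ε v) :
    Function.Injective (mulBy p ε v) := by
  rw [← LinearMap.ker_eq_bot, LinearMap.ker_eq_bot']
  intro x hx
  rw [mulBy_comm, mulBy_apply] at hx
  rw [IsCyclicVec, Fintype.linearIndependent_iff] at h
  have := h x (by simpa [Fin.sum_univ_four] using hx)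
  exact funext this

/-- Multiplication by a cyclic vector is an automorphism. -/
def IsCyclicVec.mulEquiv {p : ℕ} {ε : ℤ} {v : Fin 4 → K} (h : IsCyclicVec p ε v) :
    (Fin 4 → K) ≃ₗ[K] (Fin 4 → K) :=
  LinearEquiv.ofInjectiveEndo (mulBy p ε v) h.injective

theorem IsCyclicVec.mulEquiv_apply {p : ℕ} {ε : ℤ} {v : Fin 4 → K} (h : IsCyclicVec p ε v)
    (x : Fin 4 → K) : h.mulEquiv x = mulBy p ε v x := rfl

theorem IsCyclicVec.mulEquiv_phi {p : ℕ} {ε : ℤ} {v : Fin 4 → K} (h : IsCyclicVec p ε v)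
    (x : Fin 4 → K) : h.mulEquiv (phi K p ε x) = phi K p ε (h.mulEquiv x) := mulBy_phi p ε v x

theorem IsCyclicVec.mulEquiv_symm_phi {p : ℕ} {ε : ℤ} {v : Fin 4 → K} (h : IsCyclicVec p ε v)
    (x : Fin 4 → K) : h.mulEquiv.symm (phi K p ε x) = phi K p ε (h.mulEquiv.symm x) := by
  rw [LinearEquiv.symm_apply_eq, h.mulEquiv_phi, LinearEquiv.apply_symm_apply]

theorem det_mulBy_ne_zero {p : ℕ} {ε : ℤ} {v : Fin 4 → K} (h : IsCyclicVec p ε v) :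
    LinearMap.det (mulBy p ε v) ≠ 0 :=
  (LinearEquiv.isUnit_det' h.mulEquiv).ne_zero

theorem den_unitVec (p : ℕ) (ε : ℤ) (w : Fin 4 → K) :
    den p ε unitVec w = w 3 * (w 1 - (ε : K) * p * w 3) - w 2 ^ 2 := by
  simp [den_eq, denForm, unitVec]
  ring

/-- In this form `num + εp · den` is visibly a binary quadratic form in `w 1, w 3`. It factors as
`(w 1 + a w 3)(w 1 + b w 3)` when `a, b` are the roots of `X² + εpX + p²`, which governs the fiber
over `-εp`. -/
theorem num_unitVec (p : ℕ) (ε : ℤ) (w : Fin 4 → K) :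
    num p ε unitVec w = w 1 ^ 2 - (ε : K) * p * (w 1 * w 3) + (p : K) ^ 2 * w 3 ^ 2
      - (ε : K) * p * den p ε unitVec w := by
  rw [den_unitVec]
  simp [num_eq, numForm, unitVec]
  ring

/-- A plane with a cyclic vector is a translate of a plane that contains the unit. -/
theorem exists_mulBy_of_isCyclicVec {p : ℕ} {ε : ℤ} {P : Gr K} {v : Fin 4 → K} (hv : v ∈ P.1)
    (hc : IsCyclicVec p ε v) : ∃ w, LinearIndependent K ![unitVec, w] ∧ w 0 = 0 ∧
      Spans P v (mulBy p ε v w) := by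
  obtain ⟨w, hw⟩ := exists_spans_left hv hc.ne_zero
  have hu := hw.linearIndependent
  -- Dividing the basis `v, w` by the unit `v` gives `1, w / v`; a multiple of `1` is then
  -- subtracted to clear the coordinate of index 0.
  set w' := hc.mulEquiv.symm w - (hc.mulEquiv.symm w 0) • (unitVec : Fin 4 → K) with hw'
  have h1 : mulBy p ε v w' = w - (hc.mulEquiv.symm w 0) • v := by
    rw [hw', map_sub, map_smul, mulBy_unitVec, ← hc.mulEquiv_apply, LinearEquiv.apply_symm_apply]
  have h2 : LinearIndependent K ![v, mulBy p ε v w'] := by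
    rw [h1, LinearIndependent.pair_iff]
    rw [LinearIndependent.pair_iff] at hu
    intro s t hst
    obtain ⟨h3, h4⟩ := hu (s - t * (hc.mulEquiv.symm w 0)) t (by rw [← hst]; module)
    subst h4
    exact ⟨by simpa using h3, rfl⟩
  refine ⟨w', ?_, by rw [hw', Pi.sub_apply, Pi.smul_apply]; simp [unitVec], spans_of_mem hv ?_ h2⟩
  · refine LinearIndependent.of_comp (mulBy p ε v) ?_
    convert h2 using 1
    funext i
    fin_cases i
    · exact mulBy_unitVec p ε v
    · rfl
  · rw [h1]
    exact Submodule.sub_mem _ hw.right_mem (Submodule.smul_mem _ _ hv)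

end MulBy

/-! ### Eigenplanes of `φ²`, stable subspaces and common zeros of `num` and `den` -/

section Eigenplanes

variable {p : ℕ} [Fact p.Prime]

/-- The kernel of `φ² - a`. -/
def eigenplane (ε : ℤ) (a : ℚ_[p]) : Submodule ℚ_[p] (Fin 4 → ℚ_[p]) :=
  LinearMap.ker (phi ℚ_[p] p ε ∘ₗ phi ℚ_[p] p ε - a • LinearMap.id)

theorem mem_eigenplane {ε : ℤ} {a : ℚ_[p]} {x : Fin 4 → ℚ_[p]} :
    x ∈ eigenplane ε a ↔ phi ℚ_[p] p ε (phi ℚ_[p] p ε x) = a • x := by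
  simp [eigenplane, sub_eq_zero]

theorem isCyclicVec_of (hp : 7 ≤ p) {ε : ℤ} (hε : ε = 0 ∨ ε = 1 ∨ ε = -1) {v : Fin 4 → ℚ_[p]}
    (hv : v ≠ 0) (h : ∀ a, IsQuadRoot ε a → v ∉ eigenplane ε a) : IsCyclicVec p ε v :=
  linearIndependent_krylov hp hε (phi ℚ_[p] p ε) (phi_charpoly_apply p ε) hv
    fun a ha h' => h a ha (mem_eigenplane.2 h')

theorem phi_mem_eigenplane {ε : ℤ} {a : ℚ_[p]} {v : Fin 4 → ℚ_[p]} (h : v ∈ eigenplane ε a) :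
    phi ℚ_[p] p ε v ∈ eigenplane ε a := by
  rw [mem_eigenplane] at *
  rw [h, map_smul]

/-- The vector `(φ² - b) 1`, where `b` is the other root; it lies in the eigenplane of `a`. -/
def eigenvec (ε : ℤ) (a : ℚ_[p]) : Fin 4 → ℚ_[p] := ![(ε : ℚ_[p]) * p + a, 0, 1, 0]

theorem eigenvec_ne_zero (ε : ℤ) (a : ℚ_[p]) : eigenvec ε a ≠ 0 := fun h => by
  simpa [eigenvec] using congrFun h 2

theorem eigenvec_mem {ε : ℤ} {a : ℚ_[p]} (ha : IsQuadRoot ε a) :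
    eigenvec ε a ∈ eigenplane ε a := by
  rw [mem_eigenplane]
  unfold IsQuadRoot at ha
  funext i
  fin_cases i <;> simp [phi_apply, eigenvec]
  linear_combination -ha

theorem eq_of_mem_eigenplane {ε : ℤ} {a : ℚ_[p]} {x : Fin 4 → ℚ_[p]} (hx : x ∈ eigenplane ε a) :
    x = x 2 • eigenvec ε a + x 3 • phi ℚ_[p] p ε (eigenvec ε a) := by
  have h := mem_eigenplane.1 hx
  have h2 := congrFun h 2
  have h3 := congrFun h 3
  simp [phi_apply] at h2 h3
  funext i
  fin_cases i <;> simp [phi_apply, eigenvec]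
  · linear_combination h2
  · linear_combination h3

theorem linearIndependent_pair_phi (hp : 7 ≤ p) {ε : ℤ} (hε : ε = 0 ∨ ε = 1 ∨ ε = -1)
    {v : Fin 4 → ℚ_[p]} (hv : v ≠ 0) : LinearIndependent ℚ_[p] ![v, phi ℚ_[p] p ε v] := by
  rw [LinearIndependent.pair_iff]
  intro s t h
  have ht : t = 0 := by
    by_contra ht
    have h1 := eq_smul_of_smul_add_eq_zero ht ((add_comm _ _).trans h)
    rw [smul_smul] at h1
    generalize -t⁻¹ * s = r at h1
    have h4 := phi_charpoly_apply (K := ℚ_[p]) p ε v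
    simp only [h1, map_smul, smul_smul, ← add_smul] at h4
    refine quartic_ne_zero hp hε r ?_
    rcases smul_eq_zero.1 h4 with h5 | h5
    · linear_combination h5
    · exact absurd h5 hv
  subst ht
  exact ⟨by simpa [hv] using h, rfl⟩

theorem finrank_eigenplane (hp : 7 ≤ p) {ε : ℤ} (hε : ε = 0 ∨ ε = 1 ∨ ε = -1) {a : ℚ_[p]}
    (ha : IsQuadRoot ε a) : finrank ℚ_[p] (eigenplane ε a) = 2 := by
  have : eigenplane ε a =
      Submodule.span ℚ_[p] {eigenvec ε a, phi ℚ_[p] p ε (eigenvec ε a)} := by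
    refine le_antisymm (fun x hx => ?_) (Submodule.span_le.2 ?_)
    · rw [eq_of_mem_eigenplane hx]
      exact Submodule.mem_span_pair.2 ⟨_, _, rfl⟩
    · simp [Set.insert_subset_iff, eigenvec_mem ha, phi_mem_eigenplane (eigenvec_mem ha)]
  rw [this, finrank_span_pair_of_linearIndependent
    (linearIndependent_pair_phi hp hε (eigenvec_ne_zero ε a))]

theorem mem_span_pair_of_mem_eigenplane (hp : 7 ≤ p) {ε : ℤ} (hε : ε = 0 ∨ ε = 1 ∨ ε = -1)
    {a : ℚ_[p]} (ha : IsQuadRoot ε a) {v x : Fin 4 → ℚ_[p]} (hv : v ∈ eigenplane ε a)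
    (hv0 : v ≠ 0) (hx : x ∈ eigenplane ε a) : ∃ c d : ℚ_[p], c • v + d • phi ℚ_[p] p ε v = x :=
  (mem_span_pair_iff_of_spans (P := ⟨eigenplane ε a, finrank_eigenplane hp hε ha⟩)
    (spans_of_mem hv (phi_mem_eigenplane hv) (linearIndependent_pair_phi hp hε hv0))).1 hx

/-- A nonzero subspace without cyclic vectors lies in one of the eigenplanes of `φ²`. -/
theorem exists_le_eigenplane (hp : 7 ≤ p) {ε : ℤ} (hε : ε = 0 ∨ ε = 1 ∨ ε = -1)
    {W : Submodule ℚ_[p] (Fin 4 → ℚ_[p])} (hW : W ≠ ⊥) (h : ∀ v ∈ W, ¬ IsCyclicVec p ε v) :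
    ∃ a, IsQuadRoot ε a ∧ W ≤ eigenplane ε a := by
  have key : ∀ v ∈ W, v ≠ 0 → ∃ a, IsQuadRoot ε a ∧ v ∈ eigenplane ε a := by
    intro v hv h0
    by_contra! hn
    exact h v hv (isCyclicVec_of hp hε h0 hn)
  obtain ⟨v, hv, h0⟩ := Submodule.exists_mem_ne_zero_of_ne_bot hW
  obtain ⟨a, ha, hva⟩ := key v hv h0
  refine ⟨a, ha, fun x hx => ?_⟩
  by_cases hx0 : x = 0
  · subst hx0
    exact Submodule.zero_mem _
  obtain ⟨b, hb, hxb⟩ := key x hx hx0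
  by_cases hs : v + x = 0
  · rw [eq_neg_of_add_eq_zero_right hs]
    exact Submodule.neg_mem _ hva
  obtain ⟨c, hc, hsc⟩ := key _ (W.add_mem hv hx) hs
  rw [mem_eigenplane] at *
  rw [map_add, map_add, hva, hxb, smul_add] at hsc
  -- If `a ≠ b`, the sum of nonzero eigenvectors `v` and `x` is not an eigenvector: applying `φ²` to
  -- the relation and eliminating gives `a = c = b`.
  by_cases hab : b = a
  · rw [hxb, hab]
  exfalso
  have h1 : (a - c) • v + (b - c) • x = 0 := by
    have := sub_eq_zero.2 hsc
    rw [← this]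
    module
  have h2 : (a * (a - c)) • v + (b * (b - c)) • x = 0 := by
    have := congrArg (fun y => phi ℚ_[p] p ε (phi ℚ_[p] p ε y)) h1
    simp only [map_add, map_smul, hva, hxb, map_zero] at this
    rw [← this]
    module
  have h3 : ((b - a) * (b - c)) • x = 0 := by
    have : (a : ℚ_[p]) • ((a - c) • v + (b - c) • x) = 0 := by rw [h1, smul_zero]
    rw [← sub_eq_zero.2 (h2.trans this.symm)]
    module
  have h4 : ((a - b) * (a - c)) • v = 0 := by
    have : (b : ℚ_[p]) • ((a - c) • v + (b - c) • x) = 0 := by rw [h1, smul_zero]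
    rw [← sub_eq_zero.2 (h2.trans this.symm)]
    module
  have h5 := (mul_eq_zero.1 ((smul_eq_zero.1 h3).resolve_right hx0)).resolve_left (sub_ne_zero.2 hab)
  have h6 := (mul_eq_zero.1 ((smul_eq_zero.1 h4).resolve_right h0)).resolve_left
    (sub_ne_zero.2 (Ne.symm hab))
  exact hab (by linear_combination h5 - h6)

/-- A cyclic vector in `W` generates everything. Without one, `W` lies in an eigenplane, and any
nonzero `v` there spans the eigenplane together with `φ v`. -/
theorem stable_cases (hp : 7 ≤ p) {ε : ℤ} (hε : ε = 0 ∨ ε = 1 ∨ ε = -1)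
    {W : Submodule ℚ_[p] (Fin 4 → ℚ_[p])} (hW : ∀ x ∈ W, phi ℚ_[p] p ε x ∈ W) :
    W = ⊥ ∨ W = ⊤ ∨ ∃ a, IsQuadRoot ε a ∧ W = eigenplane ε a := by
  by_cases h0 : W = ⊥
  · exact Or.inl h0
  right
  by_cases hc : ∃ v ∈ W, IsCyclicVec p ε v
  · left
    obtain ⟨v, hv, hvc⟩ := hc
    rw [eq_top_iff, ← hvc.span_eq_top_of_card_eq_finrank' (by simp), Submodule.span_le]
    rintro _ ⟨i, rfl⟩
    fin_cases i
    · exact hv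
    · exact hW _ hv
    · exact hW _ (hW _ hv)
    · exact hW _ (hW _ (hW _ hv))
  · right
    push Not at hc
    obtain ⟨a, ha, hle⟩ := exists_le_eigenplane hp hε h0 hc
    refine ⟨a, ha, le_antisymm hle fun x hx => ?_⟩
    obtain ⟨v, hv, hv0⟩ := Submodule.exists_mem_ne_zero_of_ne_bot h0
    obtain ⟨c, d, rfl⟩ := mem_span_pair_of_mem_eigenplane hp hε ha (hle hv) hv0 hx
    exact W.add_mem (W.smul_mem _ hv) (W.smul_mem _ (hW _ hv))

/-- The numerator and denominator of `c` vanish simultaneously exactly at the eigenplanes. -/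
theorem num_den_eq_zero_iff (hp : 7 ≤ p) {ε : ℤ} (hε : ε = 0 ∨ ε = 1 ∨ ε = -1) {P : Gr ℚ_[p]}
    {v w : Fin 4 → ℚ_[p]} (h : Spans P v w) :
    (num p ε v w = 0 ∧ den p ε v w = 0) ↔ ∃ a, IsQuadRoot ε a ∧ P.1 = eigenplane ε a := by
  constructor
  · rintro ⟨hn, hd⟩
    by_cases hc : ∃ x ∈ P.1, IsCyclicVec p ε x
    · exfalso
      obtain ⟨x, hx, hxc⟩ := hc
      obtain ⟨y, hy, hy0, hs⟩ := exists_mulBy_of_isCyclicVec hx hxc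
      obtain ⟨t, -, hm⟩ := h.exists_smul hs
      have hn' := num_eq_of_minors (p := p) (ε := ε) hm
      have hd' := den_eq_of_minors (p := p) (ε := ε) hm
      rw [hn, mul_zero] at hn'
      rw [hd, mul_zero] at hd'
      nth_rewrite 1 [← mulBy_unitVec p ε x] at hn' hd'
      rw [num_map p ε (mulBy_phi p ε x)] at hn'
      rw [den_map p ε (mulBy_phi p ε x)] at hd'
      replace hn' := (mul_eq_zero.1 hn').resolve_left (det_mulBy_ne_zero hxc)
      replace hd' := (mul_eq_zero.1 hd').resolve_left (det_mulBy_ne_zero hxc)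
      rw [num_unitVec, hd'] at hn'
      rw [den_unitVec] at hd'
      by_cases h3 : y 3 = 0
      · have h1 : y 1 = 0 := by simpa [h3] using hn'
        have h2 : y 2 = 0 := by simpa [h3] using hd'
        refine LinearIndependent.ne_zero 1 hy ?_
        funext i
        fin_cases i <;> simp [hy0, h1, h2, h3]
      -- With `r = y 2 / y 3`, the vanishing of `den` says `y 1 / y 3 = r² + εp`; substituting this
      -- in `num` leaves the quartic at `r`.
      · refine quartic_ne_zero hp hε (y 2 / y 3) ?_
        field_simp
        linear_combination (-(y 2 ^ 2) - y 3 * y 1) * hd' + y 3 ^ 2 * hn'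
    · push Not at hc
      obtain ⟨a, ha, hle⟩ := exists_le_eigenplane hp hε
        (fun h0 => LinearIndependent.ne_zero 0 h.linearIndependent
          ((Submodule.mem_bot _).1 (h0 ▸ h.left_mem))) hc
      exact ⟨a, ha, Submodule.eq_of_le_of_finrank_eq hle
        (P.2.trans (finrank_eigenplane hp hε ha).symm)⟩
  · rintro ⟨a, ha, hP⟩
    have hv := mem_eigenplane.1 (hP ▸ h.left_mem)
    have hw := mem_eigenplane.1 (hP ▸ h.right_mem)
    have hd : den p ε v w = 0 := by
      by_contra hd
      have hU := (inU_iff h).2 hd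
      have h1 : phi ℚ_[p] p ε v ∈ P.1 := by
        rw [hP]
        exact phi_mem_eigenplane (hP ▸ h.left_mem)
      have h2 := (Submodule.disjoint_def.1 hU.disjoint) _ h1 (Submodule.mem_map_of_mem h.left_mem)
      exact LinearIndependent.ne_zero 2 ((wedge_ne_zero_iff _ _ _ _).1 hd) h2
    refine ⟨?_, hd⟩
    -- Both determinants of `num` acquire the factor `a`, as `φ²` is the scalar `a` on the plane.
    have : num p ε v w = 2 * a * den p ε v w := by
      simp only [num, hv, hw, den, wedge_eq, Pi.smul_apply, smul_eq_mul]
      ring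
    rw [this, hd, mul_zero]

end Eigenplanes

/-! ### Admissibility and Volkov's conditions for `D_P` -/

section Filtered

variable {p : ℕ} [Fact p.Prime]

theorem FilteredPhiModule.tH_eq (D : FilteredPhiModule p) (h0 : ∀ i ≤ 0, D.Fil i = ⊤)
    (h2 : ∀ i, 2 ≤ i → D.Fil i = ⊥) (W : Submodule ℚ_[p] D.carrier) :
    D.tH W = finrank ℚ_[p] (W ⊓ D.Fil 1 : Submodule ℚ_[p] D.carrier) := by
  rw [FilteredPhiModule.tH, finsum_eq_single _ 1]
  · rw [show (1 : ℤ) + 1 = 2 by norm_num, h2 2 le_rfl]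
    simp
  · intro i hi
    rcases lt_trichotomy i 0 with h | h | h
    · rw [h0 i h.le, h0 (i + 1) (by omega)]
      simp
    · simp [h]
    · rw [h2 i (by omega), h2 (i + 1) (by omega)]
      simp

theorem twoStep_of_nonpos {K : Type*} [Field K] (V : Submodule K (Fin 4 → K)) {i : ℤ}
    (h : i ≤ 0) : twoStep V i = ⊤ := if_pos h

theorem twoStep_one {K : Type*} [Field K] (V : Submodule K (Fin 4 → K)) : twoStep V 1 = V := by
  simp [twoStep]

theorem twoStep_of_two_le {K : Type*} [Field K] (V : Submodule K (Fin 4 → K)) {i : ℤ}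
    (h : 2 ≤ i) : twoStep V i = ⊥ := by
  rw [twoStep, if_neg (by omega), if_neg (by omega)]

theorem DP_fil_one (ε : ℤ) (P : Gr ℚ_[p]) : (DP ε P).Fil 1 = P.1 := twoStep_one P.1

theorem tH_DP (ε : ℤ) (P : Gr ℚ_[p]) (W : Submodule ℚ_[p] (Fin 4 → ℚ_[p])) :
    (DP ε P).tH W = finrank ℚ_[p] (W ⊓ P.1 : Submodule ℚ_[p] (Fin 4 → ℚ_[p])) := by
  rw [(DP ε P).tH_eq (fun _ => twoStep_of_nonpos P.1) (fun _ => twoStep_of_two_le P.1) W,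
    DP_fil_one]
  rfl

theorem det_restrict_top {K M : Type*} [Field K] [AddCommGroup M] [Module K M] (f : M →ₗ[K] M)
    (h : ∀ x ∈ (⊤ : Submodule K M), f x ∈ (⊤ : Submodule K M)) :
    LinearMap.det (f.restrict h) = LinearMap.det f := by
  rw [← LinearMap.det_conj (f.restrict h) Submodule.topEquiv]
  rfl

theorem det_phi (ε : ℤ) : LinearMap.det (phi ℚ_[p] p ε) = (p : ℚ_[p]) ^ 2 := by
  rw [phi, LinearMap.det_toLin', det_phiMat]

/-- On this plane `φ² = a`, so the determinant of `φ` squares to `a²`, and `a` has valuation 1. -/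
theorem valuation_det_restrict_eigenplane (hp : 7 ≤ p) {ε : ℤ} (hε : ε = 0 ∨ ε = 1 ∨ ε = -1)
    {a : ℚ_[p]} (ha : IsQuadRoot ε a)
    (h : ∀ x ∈ eigenplane ε a, phi ℚ_[p] p ε x ∈ eigenplane ε a) :
    (LinearMap.det ((phi ℚ_[p] p ε).restrict h)).valuation = 1 := by
  set r := (phi ℚ_[p] p ε).restrict h
  have h1 : r ∘ₗ r = a • LinearMap.id := by
    ext x : 2
    exact mem_eigenplane.1 x.2
  have h2 := congrArg LinearMap.det h1
  rw [LinearMap.det_comp, LinearMap.det_smul, LinearMap.det_id, finrank_eigenplane hp hε ha,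
    mul_one, ← pow_two] at h2
  have h3 := congrArg Padic.valuation h2
  rw [Padic.valuation_pow, Padic.valuation_pow, ha.valuation hε] at h3
  push_cast at h3
  omega

/-- Here `t_H(W) = dim (W ∩ P)`. The only subspaces to test besides `0` and the whole space are
eigenplanes, where `t_N = 1`; the inequality fails when the intersection has dimension 2, that is,
when the two planes coincide. -/
theorem admissible_DP_iff (hp : 7 ≤ p) {ε : ℤ} (hε : ε = 0 ∨ ε = 1 ∨ ε = -1) (P : Gr ℚ_[p]) :
    (DP ε P).Admissible ↔ ¬ ∃ a, IsQuadRoot ε a ∧ P.1 = eigenplane ε a := by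
  have htop : ∀ h : ∀ x ∈ (⊤ : Submodule ℚ_[p] (Fin 4 → ℚ_[p])), phi ℚ_[p] p ε x ∈
      (⊤ : Submodule ℚ_[p] (Fin 4 → ℚ_[p])),
      (LinearMap.det ((phi ℚ_[p] p ε).restrict h)).valuation = 2 := by
    intro h
    rw [det_restrict_top, det_phi, Padic.valuation_pow, Padic.valuation_p]
    norm_num
  have hPtop : (DP ε P).tH (⊤ : Submodule ℚ_[p] (Fin 4 → ℚ_[p])) = 2 := by
    rw [tH_DP, top_inf_eq]
    exact_mod_cast P.2
  constructor
  · rintro ⟨-, h⟩ ⟨a, ha, hP⟩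
    have h1 : (DP ε P).tH (eigenplane ε a) ≤ _ :=
      h (eigenplane ε a) (fun x hx => phi_mem_eigenplane hx)
    rw [tH_DP, hP, inf_idem, finrank_eigenplane hp hε ha] at h1
    have h2 := valuation_det_restrict_eigenplane hp hε ha (fun x hx => phi_mem_eigenplane hx)
    have h3 : (2 : ℤ) ≤ 1 := h1.trans_eq h2
    norm_num at h3
  · intro hn
    have key : ∀ (W : Submodule ℚ_[p] (Fin 4 → ℚ_[p])) (hW : ∀ x ∈ W, phi ℚ_[p] p ε x ∈ W),
        (finrank ℚ_[p] (W ⊓ P.1 : Submodule ℚ_[p] (Fin 4 → ℚ_[p])) : ℤ) ≤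
          (LinearMap.det ((phi ℚ_[p] p ε).restrict hW)).valuation := by
      intro W hW
      rcases stable_cases hp hε hW with rfl | rfl | ⟨a, ha, rfl⟩
      · rw [bot_inf_eq, finrank_bot, LinearMap.det_eq_one_of_finrank_eq_zero (by simp)]
        simp
      · rw [htop, top_inf_eq]
        exact_mod_cast P.2.le
      · rw [valuation_det_restrict_eigenplane hp hε ha]
        by_contra! hlt
        have h2 : 2 ≤ finrank ℚ_[p]
            (eigenplane ε a ⊓ P.1 : Submodule ℚ_[p] (Fin 4 → ℚ_[p])) := by omega
        have e1 : eigenplane ε a ⊓ P.1 = eigenplane ε a :=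
          Submodule.eq_of_le_of_finrank_le inf_le_left (by rwa [finrank_eigenplane hp hε ha])
        have e2 : eigenplane ε a ⊓ P.1 = P.1 :=
          Submodule.eq_of_le_of_finrank_le inf_le_right (P.2.trans_le h2)
        exact hn ⟨a, ha, e2.symm.trans e1⟩
    exact ⟨hPtop.trans (htop _).symm, fun W hW => (tH_DP ε P W).trans_le (key W hW)⟩

theorem hodgeCondition_DP (ε : ℤ) (P : Gr ℚ_[p]) : (DP ε P).HodgeCondition := by
  have h4 : finrank ℚ_[p] (DP ε P).carrier = 4 := by
    change finrank ℚ_[p] (Fin 4 → ℚ_[p]) = 4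
    simp
  have h0 : (DP ε P).Fil 0 = ⊤ := twoStep_of_nonpos P.1 le_rfl
  have h1 : finrank ℚ_[p] ((DP ε P).Fil 1) = 2 := by
    rw [DP_fil_one]
    exact P.2
  have h2 : (DP ε P).Fil 2 = ⊥ := twoStep_of_two_le P.1 le_rfl
  refine ⟨h4, ?_, ?_⟩
  · rw [FilteredPhiModule.hodge, h0, finrank_top, h4, zero_add, h1]
    norm_num
  · rw [FilteredPhiModule.hodge, h1, show (1 : ℤ) + 1 = 2 by norm_num, h2, finrank_bot]
    norm_num

theorem charpoly_phi (K : Type*) [Field K] (p : ℕ) (ε : ℤ) :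
    (phi K p ε).charpoly = Polynomial.X ^ 4 + Polynomial.C ((ε : K) * p) * Polynomial.X ^ 2
      + Polynomial.C ((p : K) ^ 2) := by
  rw [phi, Matrix.charpoly_toLin', Matrix.charpoly, phiMat]
  simp [Matrix.det_succ_row_zero, Fin.sum_univ_succ, Fin.succAbove, Matrix.charmatrix_apply]
  ring

/-- An explicit Bézout relation with the derivative. Its denominators come from the discriminant `16
q (e² - 4q)²`. -/
theorem separable_quartic {K : Type*} [Field K] [CharZero K] {e q : K} (hq : q ≠ 0)
    (hd : e ^ 2 - 4 * q ≠ 0) : (Polynomial.X ^ 4 + Polynomial.C e * Polynomial.X ^ 2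
      + Polynomial.C q).Separable := by
  rw [Polynomial.separable_def']
  set d := (e ^ 2 - 4 * q)⁻¹ with hd'
  have h2 : (2 : K) ≠ 0 := two_ne_zero
  refine ⟨Polynomial.C ((2 * q)⁻¹) * (2 + Polynomial.C (4 * e * d) * Polynomial.X ^ 2),
    Polynomial.C ((2 * q)⁻¹) * (- Polynomial.C (1 / 2) * Polynomial.X -
      Polynomial.C (e * d) * Polynomial.X * (Polynomial.C (e / 2) + Polynomial.X ^ 2)), ?_⟩
  refine Polynomial.funext fun x => ?_
  have h3 : (e ^ 2 - 4 * q) * d = 1 := mul_inv_cancel₀ hd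
  simp
  field_simp
  linear_combination (-2 * e * x ^ 2) * h3

theorem isSupersingularWeil_quartic {ε : ℤ} (hε : ε = 0 ∨ ε = 1 ∨ ε = -1) :
    IsSupersingularWeil p (Polynomial.X ^ 4 + Polynomial.C (ε * p) * Polynomial.X ^ 2
      + Polynomial.C ((p : ℤ) ^ 2)) := by
  have hp0 : (0 : ℝ) < p := by exact_mod_cast (Fact.out : p.Prime).pos
  have hs : (Real.sqrt p : ℂ) ^ 2 = p := by
    rw [← Complex.ofReal_pow, Real.sq_sqrt hp0.le]
    simp
  have hs0 : (Real.sqrt p : ℂ) ≠ 0 := by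
    rw [Ne, Complex.ofReal_eq_zero]
    exact (Real.sqrt_pos.2 hp0).ne'
  have hpc : (p : ℂ) ≠ 0 := by exact_mod_cast (Fact.out : p.Prime).ne_zero
  -- For `ε = 0, 1, -1` the number `α / √p` is a root of unity of order dividing 8, 6, 12; the
  -- exponent 24 serves all three cases.
  refine ⟨by monicity!, fun α hα => ⟨α / Real.sqrt p, 24, by norm_num, ?_, by field_simp⟩, ?_⟩
  · simp at hα
    set z := α / (Real.sqrt p : ℂ) with hz
    have hαz : α = Real.sqrt p * z := by rw [hz]; field_simp
    have h4 : z ^ 4 + ε * z ^ 2 + 1 = 0 := by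
      have : (p : ℂ) ^ 2 * (z ^ 4 + ε * z ^ 2 + 1) = 0 := by
        rw [← hα, hαz, mul_pow, mul_pow, hs, show (Real.sqrt p : ℂ) ^ 4 = (p : ℂ) ^ 2 by
          rw [← hs]; ring]
        ring
      exact (mul_eq_zero.1 this).resolve_left (pow_ne_zero 2 hpc)
    rcases hε with rfl | rfl | rfl
    · have : z ^ 4 = -1 := by push_cast at h4; linear_combination h4
      rw [show z ^ 24 = (z ^ 4) ^ 6 by ring, this]
      norm_num
    · have : z ^ 6 = 1 := by push_cast at h4; linear_combination (z ^ 2 - 1) * h4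
      rw [show z ^ 24 = (z ^ 6) ^ 4 by ring, this]
      norm_num
    · have : z ^ 6 = -1 := by push_cast at h4; linear_combination (z ^ 2 + 1) * h4
      rw [show z ^ 24 = (z ^ 6) ^ 4 by ring, this]
      norm_num
  -- The multiplicity of `X² - p` is zero: the value of the quartic at `√p` is `(2 + ε) p²`.
  · rw [multiplicity_eq_zero.2]
    · exact Even.zero
    · intro h
      have h1 := Polynomial.eval_dvd (x := (Real.sqrt p : ℂ)) (Polynomial.map_dvd (Int.castRingHom ℂ) h)
      simp [hs] at h1
      rw [show (Real.sqrt p : ℂ) ^ 4 = (p : ℂ) ^ 2 by rw [← hs]; ring] at h1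
      have h2 : ((2 + ε : ℤ) : ℂ) * (p : ℂ) ^ 2 = 0 := by
        push_cast
        linear_combination h1
      rcases mul_eq_zero.1 h2 with h3 | h3
      · have := Int.cast_eq_zero.1 h3
        omega
      · exact pow_ne_zero 2 hpc h3

theorem frobeniusCondition_DP {ε : ℤ} (hε : ε = 0 ∨ ε = 1 ∨ ε = -1) (P : Gr ℚ_[p]) :
    (DP ε P).FrobeniusCondition := by
  have hp0 := natCast_prime_ne_zero (p := p)
  refine ⟨?_, _, isSupersingularWeil_quartic hε, ?_⟩
  · change Module.End.IsSemisimple (phi ℚ_[p] p ε)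
    refine Module.End.isSemisimple_of_squarefree_aeval_eq_zero (p := (phi ℚ_[p] p ε).charpoly) ?_
      (LinearMap.aeval_self_charpoly _)
    rw [charpoly_phi]
    refine (separable_quartic (pow_ne_zero 2 hp0) ?_).squarefree
    rw [show ((ε : ℚ_[p]) * p) ^ 2 - 4 * (p : ℚ_[p]) ^ 2 = ((ε ^ 2 - 4 : ℤ) : ℚ_[p]) * (p : ℚ_[p]) ^ 2 by
      push_cast; ring]
    refine mul_ne_zero (Int.cast_ne_zero.2 ?_) (pow_ne_zero 2 hp0)
    rcases hε with rfl | rfl | rfl <;> norm_num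
  · refine Eq.trans ?_ (charpoly_phi ℚ_[p] p ε).symm
    simp

/-- The Gram matrix of the skew form with parameters `r`, `s` for which `φ` is a `p`-similitude. -/
def gram (p : ℕ) (ε : ℤ) {K : Type*} [Field K] (r s : K) : Matrix (Fin 4) (Fin 4) K :=
  !![0, r, s, p * (1 - ε) * r;
     -r, 0, p * r, p * s;
     -s, -(p * r), 0, p ^ 2 * r;
     -(p * (1 - ε) * r), -(p * s), -(p ^ 2 * r), 0]

theorem toBilin'_gram (p : ℕ) (ε : ℤ) {K : Type*} [Field K] (r s : K) (x y : Fin 4 → K) :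
    Matrix.toBilin' (gram p ε r s) x y =
      r * ((x 0 * y 1 - x 1 * y 0) + p * (x 1 * y 2 - x 2 * y 1) + p ^ 2 * (x 2 * y 3 - x 3 * y 2)
        + p * (1 - ε) * (x 0 * y 3 - x 3 * y 0))
      + s * ((x 0 * y 2 - x 2 * y 0) + p * (x 1 * y 3 - x 3 * y 1)) := by
  simp [Matrix.toBilin'_apply, gram, Fin.sum_univ_succ]
  ring

theorem det_gram (p : ℕ) (ε : ℤ) {K : Type*} [Field K] (r s : K) :
    (gram p ε r s).det = ((p : K) ^ 2 * (2 - ε) * r ^ 2 - p * s ^ 2) ^ 2 := by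
  simp [gram, Matrix.det_succ_row_zero, Fin.sum_univ_succ, Fin.succAbove]
  ring

/-- Isotropy of `P` is a single linear equation on the pencil of forms with parameters `(r, s)`, so
it has a nonzero solution. Every nonzero member is nondegenerate, because the Gram determinant is
the square of `p ((2 - ε) p r² - s²)` and `(2 - ε) p` is not a square. -/
theorem exists_isAlt_similitude (hp : 7 ≤ p) {ε : ℤ} (hε : ε = 0 ∨ ε = 1 ∨ ε = -1)
    (P : Gr ℚ_[p]) : ∃ B : LinearMap.BilinForm ℚ_[p] (Fin 4 → ℚ_[p]), B.IsAlt ∧ B.Nondegenerate ∧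
      (∀ x y, B (phi ℚ_[p] p ε x) (phi ℚ_[p] p ε y) = (p : ℚ_[p]) * B x y) ∧
      ∀ x ∈ P.1, ∀ y ∈ P.1, B x y = 0 := by
  have hp0 := natCast_prime_ne_zero (p := p)
  obtain ⟨v, w, h⟩ := exists_spans P
  obtain ⟨r, s, hrs, hiso⟩ : ∃ r s : ℚ_[p], (r ≠ 0 ∨ s ≠ 0) ∧
      Matrix.toBilin' (gram p ε r s) v w = 0 := by
    simp only [toBilin'_gram]
    generalize (v 0 * w 1 - v 1 * w 0) + p * (v 1 * w 2 - v 2 * w 1) +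
      p ^ 2 * (v 2 * w 3 - v 3 * w 2) + p * (1 - ε) * (v 0 * w 3 - v 3 * w 0) = A
    generalize (v 0 * w 2 - v 2 * w 0) + p * (v 1 * w 3 - v 3 * w 1) = B
    by_cases hA : A = 0
    · exact ⟨1, 0, Or.inl one_ne_zero, by simp [hA]⟩
    · exact ⟨-B, A, Or.inr hA, by ring⟩
  have hdet : (gram p ε r s).det ≠ 0 := by
    rw [det_gram]
    refine pow_ne_zero 2 fun h0 => ?_
    have h1 : s ^ 2 = (2 - ε) * p * r ^ 2 := by
      refine mul_left_cancel₀ hp0 ?_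
      linear_combination -h0
    have hr : r ≠ 0 := by
      rintro rfl
      refine hrs.elim (· rfl) (· ?_)
      simpa using h1
    refine sq_ne_intCast_mul_prime (p := p) (u := 2 - ε)
      (not_dvd_small hp (by omega) (by omega) (by omega)) (s / r) ?_
    push_cast
    field_simp
    linear_combination h1
  refine ⟨Matrix.toBilin' (gram p ε r s), fun x => ?_,
    LinearMap.BilinForm.nondegenerate_toBilin'_iff_det_ne_zero.2 hdet, fun x y => ?_, ?_⟩
  · rw [toBilin'_gram]
    ring
  · rw [toBilin'_gram, toBilin'_gram]
    simp [phi_apply]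
    ring
  · intro x hx y hy
    obtain ⟨a, b, rfl⟩ := (mem_span_pair_iff_of_spans h).1 hx
    obtain ⟨c, d, rfl⟩ := (mem_span_pair_iff_of_spans h).1 hy
    rw [toBilin'_gram] at *
    simp
    linear_combination (a * d - b * c) * hiso

theorem polarizationCondition_DP (hp : 7 ≤ p) {ε : ℤ} (hε : ε = 0 ∨ ε = 1 ∨ ε = -1)
    (P : Gr ℚ_[p]) : (DP ε P).PolarizationCondition := by
  obtain ⟨B, h1, h2, h3, h4⟩ := exists_isAlt_similitude hp hε P
  refine ⟨B, h1, h2, h3, ?_⟩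
  rw [DP_fil_one]
  exact h4

theorem isSupersingular_DP (hp : 7 ≤ p) {ε : ℤ} (hε : ε = 0 ∨ ε = 1 ∨ ε = -1) {P : Gr ℚ_[p]}
    (h : (DP ε P).Admissible) : (DP ε P).IsSupersingular ε :=
  ⟨h, hodgeCondition_DP ε P, frobeniusCondition_DP hε P, polarizationCondition_DP hp hε P,
    charpoly_phi ℚ_[p] p ε⟩

end Filtered

/-! ### Isomorphisms, and the reduction of every object to some `D_P` -/

section Isomorphisms

variable {p : ℕ} [Fact p.Prime]

theorem FilteredPhiModule.Iso.admissible {D E : FilteredPhiModule p} (h : D.Iso E)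
    (hD : D.Admissible) : E.Admissible := by
  obtain ⟨e, h1, h2⟩ := h
  have hfr : ∀ (W : Submodule ℚ_[p] E.carrier) (i : ℤ),
      finrank ℚ_[p] (W.comap (e : D.carrier →ₗ[ℚ_[p]] E.carrier) ⊓ D.Fil i :
        Submodule ℚ_[p] D.carrier) = finrank ℚ_[p] (W ⊓ E.Fil i : Submodule ℚ_[p] E.carrier) := by
    intro W i
    rw [← LinearEquiv.finrank_map_eq e, ← h2 i, Submodule.map_inf _ e.injective,
      Submodule.map_comap_eq_of_surjective e.surjective]
  have htH : ∀ W : Submodule ℚ_[p] E.carrier,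
      D.tH (W.comap (e : D.carrier →ₗ[ℚ_[p]] E.carrier)) = E.tH W := by
    intro W
    simp only [FilteredPhiModule.tH, hfr]
  have hfrob : ∀ x, e (D.frob x) = E.frob (e x) := h1
  have hst : ∀ (W : Submodule ℚ_[p] E.carrier), (∀ x ∈ W, E.frob x ∈ W) →
      ∀ x ∈ W.comap (e : D.carrier →ₗ[ℚ_[p]] E.carrier),
        D.frob x ∈ W.comap (e : D.carrier →ₗ[ℚ_[p]] E.carrier) := by
    intro W hW x hx
    rw [Submodule.mem_comap] at hx ⊢
    have := hW _ hx
    rwa [LinearEquiv.coe_coe, ← hfrob] at this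
  have htN : ∀ (W : Submodule ℚ_[p] E.carrier) (hW : ∀ x ∈ W, E.frob x ∈ W)
      (hW' : ∀ x ∈ W.comap (e : D.carrier →ₗ[ℚ_[p]] E.carrier),
        D.frob x ∈ W.comap (e : D.carrier →ₗ[ℚ_[p]] E.carrier)),
      D.tN (W.comap (e : D.carrier →ₗ[ℚ_[p]] E.carrier)) hW' = E.tN W hW := by
    intro W hW hW'
    let e' : W.comap (e : D.carrier →ₗ[ℚ_[p]] E.carrier) ≃ₗ[ℚ_[p]] W :=
      e.ofSubmodule' W
    rw [FilteredPhiModule.tN, FilteredPhiModule.tN, ← LinearMap.det_conj _ e']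
    congr 2
    refine LinearMap.ext fun x => Subtype.ext ?_
    obtain ⟨y, rfl⟩ := e'.surjective x
    change e (D.frob (e'.symm (e' y))) = E.frob (e' y)
    rw [LinearEquiv.symm_apply_apply, hfrob]
    rfl
  refine ⟨?_, fun W hW => ?_⟩
  · exact (htH ⊤).symm.trans
      (hD.1.trans (htN ⊤ (fun _ _ => trivial) (hst ⊤ fun _ _ => trivial)))
  · rw [← htH, ← htN W hW (hst W hW)]
    exact hD.2 _ _

theorem iso_of_map_fil_one {D E : FilteredPhiModule p} (hD0 : ∀ i ≤ 0, D.Fil i = ⊤)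
    (hD2 : ∀ i, 2 ≤ i → D.Fil i = ⊥) (hE0 : ∀ i ≤ 0, E.Fil i = ⊤)
    (hE2 : ∀ i, 2 ≤ i → E.Fil i = ⊥) (e : D.carrier ≃ₗ[ℚ_[p]] E.carrier)
    (h1 : ∀ x, e (D.φ x) = E.φ (e x))
    (h2 : (D.Fil 1).map (e : D.carrier →ₗ[ℚ_[p]] E.carrier) = E.Fil 1) : D.Iso E := by
  refine ⟨e, h1, fun i => ?_⟩
  rcases lt_trichotomy i 1 with h | rfl | h
  · rw [hD0 i (by omega), hE0 i (by omega), Submodule.map_top]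
    exact LinearEquiv.range e
  · exact h2
  · rw [hD2 i (by omega), hE2 i (by omega), Submodule.map_bot]

theorem iso_DP_iff {ε : ℤ} {P Q : Gr ℚ_[p]} : (DP ε P).Iso (DP ε Q) ↔
    ∃ g : (Fin 4 → ℚ_[p]) ≃ₗ[ℚ_[p]] (Fin 4 → ℚ_[p]),
      (∀ x, g (phi ℚ_[p] p ε x) = phi ℚ_[p] p ε (g x)) ∧
      P.1.map (g : (Fin 4 → ℚ_[p]) →ₗ[ℚ_[p]] (Fin 4 → ℚ_[p])) = Q.1 := by
  constructor
  · rintro ⟨g, h1, h2⟩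
    have h3 := h2 1
    rw [DP_fil_one, DP_fil_one] at h3
    exact ⟨g, h1, h3⟩
  · rintro ⟨g, h1, h2⟩
    refine iso_of_map_fil_one (fun _ => twoStep_of_nonpos P.1) (fun _ => twoStep_of_two_le P.1)
      (fun _ => twoStep_of_nonpos Q.1) (fun _ => twoStep_of_two_le Q.1) g h1 ?_
    rw [DP_fil_one, DP_fil_one]
    exact h2

/-- The two Hodge numbers add up to `dim Fil 0 - dim Fil 2 = 4`, which is the full dimension; so
`Fil 0` is everything and `Fil 2` is zero. -/
theorem FilteredPhiModule.HodgeCondition.fil {D : FilteredPhiModule p} (h : D.HodgeCondition) :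
    (∀ i ≤ 0, D.Fil i = ⊤) ∧ (∀ i, 2 ≤ i → D.Fil i = ⊥) ∧ finrank ℚ_[p] (D.Fil 1) = 2 := by
  obtain ⟨h4, h0, h1⟩ := h
  rw [FilteredPhiModule.hodge] at h0 h1
  rw [zero_add] at h0
  rw [show (1 : ℤ) + 1 = 2 by norm_num] at h1
  have hle := Submodule.finrank_le (D.Fil 0)
  rw [h4] at hle
  refine ⟨fun i hi => ?_, fun i hi => ?_, by omega⟩
  · refine top_le_iff.1 (le_trans ?_ (D.antitone hi))
    rw [Submodule.eq_top_of_finrank_eq (S := D.Fil 0) (by omega)]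
  · refine le_bot_iff.1 ((D.antitone hi).trans ?_)
    rw [le_bot_iff, ← Submodule.finrank_eq_zero (R := ℚ_[p])]
    omega

theorem exists_notMem_union {K M : Type*} [Field K] [AddCommGroup M] [Module K M]
    {A B : Submodule K M} (hA : A ≠ ⊤) (hB : B ≠ ⊤) : ∃ x, x ∉ A ∧ x ∉ B := by
  obtain ⟨u, hu⟩ : ∃ u, u ∉ A := by
    by_contra! h
    exact hA (eq_top_iff.2 fun x _ => h x)
  obtain ⟨w, hw⟩ : ∃ w, w ∉ B := by
    by_contra! h
    exact hB (eq_top_iff.2 fun x _ => h x)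
  by_cases h1 : u ∈ B
  · by_cases h2 : w ∈ A
    · exact ⟨u + w, fun h => hu ((A.add_mem_iff_left h2).1 h),
        fun h => hw ((B.add_mem_iff_right h1).1 h)⟩
    · exact ⟨w, h2, hw⟩
  · exact ⟨u, hu, h1⟩

section Cyclic

variable {M : Type*} [AddCommGroup M] [Module ℚ_[p] M] [Module.Finite ℚ_[p] M]

/-- If `f² = c`, then `χ(x) χ(-x) = det (c - x²) = (c - x²)⁴`. As `χ` is even with the distinct
roots `c` and `-εp - c` in `X²`, comparing the two sides leaves `2x² = -εp` for every `x` with `x² ≠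
c`. -/
theorem sq_ne_smul_of_charpoly {ε : ℤ} (hε : ε = 0 ∨ ε = 1 ∨ ε = -1) (f : M →ₗ[ℚ_[p]] M)
    (h4 : finrank ℚ_[p] M = 4)
    (hf : f.charpoly = Polynomial.X ^ 4 + Polynomial.C ((ε : ℚ_[p]) * p) * Polynomial.X ^ 2
      + Polynomial.C ((p : ℚ_[p]) ^ 2)) {c : ℚ_[p]} (hc : IsQuadRoot ε c) :
    LinearMap.ker (f ∘ₗ f - c • LinearMap.id) ≠ ⊤ := by
  intro htop
  have hff : f ∘ₗ f = c • LinearMap.id := sub_eq_zero.1 (LinearMap.ker_eq_top.1 htop)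
  have hv := hc.valuation hε
  have key : ∀ x : ℚ_[p], x ^ 2 ≠ c → 2 * x ^ 2 = -((ε : ℚ_[p]) * p) := by
    intro x hx
    have e1 := LinearMap.eval_charpoly f x
    have e2 := LinearMap.eval_charpoly f (-x)
    have e3 : (algebraMap ℚ_[p] (M →ₗ[ℚ_[p]] M) x - f) ∘ₗ
        (algebraMap ℚ_[p] (M →ₗ[ℚ_[p]] M) (-x) - f) = (c - x ^ 2) • LinearMap.id := by
      ext y
      have := LinearMap.congr_fun hff y
      simp only [LinearMap.comp_apply, LinearMap.smul_apply, LinearMap.id_apply] at this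
      simp [Module.algebraMap_end_apply, this]
      module
    have e4 := congrArg LinearMap.det e3
    rw [LinearMap.det_comp, ← e1, ← e2, hf, LinearMap.det_smul, LinearMap.det_id, h4] at e4
    simp at e4
    unfold IsQuadRoot at hc
    have e5 : (c - x ^ 2) ^ 2 * ((2 * c + (ε : ℚ_[p]) * p) * (2 * x ^ 2 + (ε : ℚ_[p]) * p)) = 0 := by
      linear_combination e4 - (x ^ 4 + (ε : ℚ_[p]) * p * x ^ 2 + (p : ℚ_[p]) ^ 2 +
        (x ^ 2 - c) * (x ^ 2 + (ε : ℚ_[p]) * p + c)) * hc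
    have hcx : c - x ^ 2 ≠ 0 := sub_ne_zero.2 (Ne.symm hx)
    have h6 := (mul_eq_zero.1 e5).resolve_left (pow_ne_zero 2 hcx)
    rcases mul_eq_zero.1 h6 with h7 | h7
    · exact absurd (show c = -((ε : ℚ_[p]) * p) - c by linear_combination h7)
        (IsQuadRoot.ne_conj hε hc)
    · linear_combination h7
  -- The values `x = 0` and `x = 1` contradict each other; `c = 1` is excluded because `c` has
  -- valuation 1.
  have k0 := key 0 (by simpa using hc.ne_zero.symm)
  have k1 := key 1 (by
    intro h
    rw [← h] at hv
    simp at hv)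
  rw [← k0] at k1
  norm_num at k1

/-- A vector outside the eigenspaces of `f²` is cyclic. There are at most two of these and both are
proper, so their union is not everything; the basis `v, f v, f² v, f³ v` then turns `f` into the
companion matrix. -/
theorem exists_cyclic (hp : 7 ≤ p) {ε : ℤ} (hε : ε = 0 ∨ ε = 1 ∨ ε = -1) (f : M →ₗ[ℚ_[p]] M)
    (h4 : finrank ℚ_[p] M = 4)
    (hf : f.charpoly = Polynomial.X ^ 4 + Polynomial.C ((ε : ℚ_[p]) * p) * Polynomial.X ^ 2
      + Polynomial.C ((p : ℚ_[p]) ^ 2)) :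
    ∃ e : (Fin 4 → ℚ_[p]) ≃ₗ[ℚ_[p]] M, ∀ x, e (phi ℚ_[p] p ε x) = f (e x) := by
  have hχ : ∀ x, f (f (f (f x))) + ((ε : ℚ_[p]) * p) • f (f x) + ((p : ℚ_[p]) ^ 2) • x = 0 := by
    intro x
    have h1 := LinearMap.congr_fun (LinearMap.aeval_self_charpoly f) x
    rw [hf] at h1
    generalize (ε : ℚ_[p]) * p = e at h1 ⊢
    generalize (p : ℚ_[p]) ^ 2 = q at h1 ⊢
    simpa [pow_succ, Module.algebraMap_end_apply] using h1
  obtain ⟨v, hv0, hv⟩ : ∃ v : M, v ≠ 0 ∧ ∀ a : ℚ_[p], IsQuadRoot ε a → f (f v) ≠ a • v := by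
    by_cases hr : ∃ a : ℚ_[p], IsQuadRoot ε a
    · obtain ⟨a, ha⟩ := hr
      obtain ⟨v, h1, h2⟩ := exists_notMem_union (sq_ne_smul_of_charpoly hε f h4 hf ha)
        (sq_ne_smul_of_charpoly hε f h4 hf ha.conj)
      refine ⟨v, fun h => h1 (h ▸ Submodule.zero_mem _), fun b hb h => ?_⟩
      rcases ha.eq_or_eq hb with rfl | rfl
      · exact h1 (by simp [h])
      · exact h2 (by rw [LinearMap.mem_ker, LinearMap.sub_apply, LinearMap.comp_apply, h]; simp)
    · push Not at hr
      have : Nontrivial M := nontrivial_of_finrank_pos (R := ℚ_[p]) (by omega)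
      obtain ⟨v, hv⟩ := exists_ne (0 : M)
      exact ⟨v, hv, fun a ha => absurd ha (hr a)⟩
  have hl := linearIndependent_krylov hp hε f hχ hv0 hv
  let b := basisOfLinearIndependentOfCardEqFinrank hl (by simp [h4])
  have hb : ⇑b = ![v, f v, f (f v), f (f (f v))] :=
    coe_basisOfLinearIndependentOfCardEqFinrank hl _
  refine ⟨b.equivFun.symm, fun x => ?_⟩
  have h5 : f (f (f (f v))) = -((((ε : ℚ_[p]) * p) • f (f v) + ((p : ℚ_[p]) ^ 2) • v)) := by
    rw [eq_neg_iff_add_eq_zero, ← add_assoc]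
    exact hχ v
  rw [Basis.equivFun_symm_apply, Basis.equivFun_symm_apply, hb]
  simp only [Fin.sum_univ_four, phi_apply, map_add, map_smul, Matrix.cons_val_zero,
    Matrix.cons_val_one, Matrix.cons_val, h5]
  module

end Cyclic

theorem exists_iso_DP (hp : 7 ≤ p) {ε : ℤ} (hε : ε = 0 ∨ ε = 1 ∨ ε = -1)
    {D : FilteredPhiModule p} (hD : D.IsSupersingular ε) : ∃ P : Gr ℚ_[p], (DP ε P).Iso D := by
  obtain ⟨-, hH, -, -, hχ⟩ := hD
  obtain ⟨h0, h2, h1⟩ := hH.fil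
  obtain ⟨e, he⟩ := exists_cyclic hp hε D.frob hH.1 hχ
  let P : Gr ℚ_[p] := ⟨(D.Fil 1).comap (e : (Fin 4 → ℚ_[p]) →ₗ[ℚ_[p]] D.carrier), by
    rw [← LinearEquiv.finrank_map_eq e, Submodule.map_comap_eq_of_surjective e.surjective, h1]⟩
  refine ⟨P, iso_of_map_fil_one (fun _ => twoStep_of_nonpos P.1) (fun _ => twoStep_of_two_le P.1)
    h0 h2 e he ?_⟩
  rw [DP_fil_one]
  exact Submodule.map_comap_eq_of_surjective e.surjective _

end Isomorphisms

/-! ### When equal values of `c` imply isomorphism -/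

section Orbits

theorem mulBy_mulBy_comm {K : Type*} [Field K] (p : ℕ) (ε : ℤ) (x y z : Fin 4 → K) :
    mulBy p ε x (mulBy p ε y z) = mulBy p ε y (mulBy p ε x z) := by
  simp only [mulBy_apply p ε y, map_add, map_smul, mulBy_phi]

theorem mulBy_assoc {K : Type*} [Field K] (p : ℕ) (ε : ℤ) (x y z : Fin 4 → K) :
    mulBy p ε (mulBy p ε x y) z = mulBy p ε x (mulBy p ε y z) := by
  rw [mulBy_comm p ε y z, mulBy_mulBy_comm, mulBy_comm]

/-- The planes `⟨1, y⟩` and `⟨1, z⟩` have the same image under `c` if and only if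
`1, y, z, y z` are linearly dependent. -/
theorem wedge_mul_eq {K : Type*} [Field K] (p : ℕ) (ε : ℤ) {y z : Fin 4 → K} (hy : y 0 = 0)
    (hz : z 0 = 0) : wedge unitVec y z (mulBy p ε y z) =
      num p ε unitVec z * den p ε unitVec y - num p ε unitVec y * den p ε unitVec z := by
  rw [num_unitVec, num_unitVec, den_unitVec, den_unitVec, wedge_eq]
  simp only [unitVec, mulBy_apply, phi_apply, Pi.add_apply, Pi.smul_apply, smul_eq_mul,
    Matrix.cons_val_zero, Matrix.cons_val_one, Matrix.cons_val, hy, hz]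
  ring

variable {p : ℕ} [Fact p.Prime]

theorem exists_isCyclicVec_mem (hp : 7 ≤ p) {ε : ℤ} (hε : ε = 0 ∨ ε = 1 ∨ ε = -1) {P : Gr ℚ_[p]}
    (hP : ¬ ∃ a, IsQuadRoot ε a ∧ P.1 = eigenplane ε a) : ∃ x ∈ P.1, IsCyclicVec p ε x := by
  by_contra! hc
  obtain ⟨v, w, h⟩ := exists_spans P
  obtain ⟨a, ha, hle⟩ := exists_le_eigenplane hp hε
    (fun h0 => LinearIndependent.ne_zero 0 h.linearIndependent
      ((Submodule.mem_bot _).1 (h0 ▸ h.left_mem))) hc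
  exact hP ⟨a, ha, Submodule.eq_of_le_of_finrank_eq hle
    (P.2.trans (finrank_eigenplane hp hε ha).symm)⟩

theorem map_eq_of_mem {P Q : Gr ℚ_[p]} (g : (Fin 4 → ℚ_[p]) ≃ₗ[ℚ_[p]] (Fin 4 → ℚ_[p]))
    {v w : Fin 4 → ℚ_[p]} (h : Spans P v w) (hv : g v ∈ Q.1) (hw : g w ∈ Q.1) :
    P.1.map (g : (Fin 4 → ℚ_[p]) →ₗ[ℚ_[p]] (Fin 4 → ℚ_[p])) = Q.1 := by
  have hQ : FiniteDimensional ℚ_[p] Q.1 := inferInstance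
  refine Submodule.eq_of_le_of_finrank_eq ?_ ?_
  · rw [← h, Submodule.map_span, Set.image_pair, Submodule.span_le]
    simp [Set.insert_subset_iff, hv, hw]
  · rw [LinearEquiv.finrank_map_eq]
    exact P.2.trans Q.2.symm

theorem Spans.map {P Q : Gr ℚ_[p]} {g : (Fin 4 → ℚ_[p]) →ₗ[ℚ_[p]] (Fin 4 → ℚ_[p])}
    {v w : Fin 4 → ℚ_[p]} (h : Spans P v w) (hg : P.1.map g = Q.1) : Spans Q (g v) (g w) := by
  rw [Spans, ← hg, ← h, Submodule.map_span, Set.image_pair]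

/-- Normal form of the value of `c` on a plane with a cyclic vector. -/
theorem exists_unit_form {ε : ℤ} {P : Gr ℚ_[p]} {v w x : Fin 4 → ℚ_[p]} (h : Spans P v w)
    (hx : x ∈ P.1) (hxc : IsCyclicVec p ε x) :
    ∃ (y : Fin 4 → ℚ_[p]) (t : ℚ_[p]), LinearIndependent ℚ_[p] ![unitVec, y] ∧ y 0 = 0 ∧ t ≠ 0 ∧
      Spans P x (mulBy p ε x y) ∧ num p ε unitVec y = t * num p ε v w ∧
      den p ε unitVec y = t * den p ε v w := by
  obtain ⟨y, hy, hy0, hs⟩ := exists_mulBy_of_isCyclicVec hx hxc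
  obtain ⟨t, ht, hm⟩ := h.exists_smul hs
  have hn := num_eq_of_minors (p := p) (ε := ε) hm
  have hd := den_eq_of_minors (p := p) (ε := ε) hm
  nth_rewrite 1 [← mulBy_unitVec p ε x] at hn hd
  rw [num_map p ε (mulBy_phi p ε x)] at hn
  rw [den_map p ε (mulBy_phi p ε x)] at hd
  have hdet := det_mulBy_ne_zero hxc
  refine ⟨y, t ^ 2 / LinearMap.det (mulBy p ε x), hy, hy0,
    div_ne_zero (pow_ne_zero 2 ht) hdet, hs, ?_, ?_⟩
  · field_simp
    linear_combination hn
  · field_simp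
    linear_combination hd

/-- After translation the planes are `⟨1, y⟩` and `⟨1, y'⟩`, and equal values of `c` give a relation
`g₀ + g₁ y + g₂ y' + g₃ y y' = 0`. With `u = g₂ + g₃ y` this reads `u y' = -(g₀ + g₁ y)`, so `u ⟨1,
y'⟩` lies in `⟨1, y⟩`. The hypothesis on `P` makes `u` a unit. -/
theorem iso_of_ratio_eq (hp : 7 ≤ p) {ε : ℤ} (hε : ε = 0 ∨ ε = 1 ∨ ε = -1) {P Q : Gr ℚ_[p]}
    {v w v' w' : Fin 4 → ℚ_[p]} (h : Spans P v w) (h' : Spans Q v' w')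
    (hP : ∀ x ∈ P.1, x ≠ 0 → IsCyclicVec p ε x)
    (hQ : ¬ ∃ a, IsQuadRoot ε a ∧ Q.1 = eigenplane ε a)
    (hr : num p ε v w * den p ε v' w' = num p ε v' w' * den p ε v w) :
    (DP ε P).Iso (DP ε Q) := by
  have hv0 : v ≠ 0 := LinearIndependent.ne_zero 0 h.linearIndependent
  obtain ⟨y, t, hy, hy0, ht, hs, hn, hd⟩ := exists_unit_form h h.left_mem (hP v h.left_mem hv0)
  obtain ⟨x', hx', hxc'⟩ := exists_isCyclicVec_mem hp hε hQ
  obtain ⟨y', t', hy', hy0', ht', hs', hn', hd'⟩ := exists_unit_form h' hx' hxc'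
  have hw : wedge unitVec y y' (mulBy p ε y y') = 0 := by
    rw [wedge_mul_eq p ε hy0 hy0', hn, hd, hn', hd']
    linear_combination (-t * t') * hr
  have hdep : ¬ LinearIndependent ℚ_[p] ![unitVec, y, y', mulBy p ε y y'] :=
    fun hl => (wedge_ne_zero_iff _ _ _ _).2 hl hw
  rw [Fintype.not_linearIndependent_iff] at hdep
  obtain ⟨g, hg, i, hi⟩ := hdep
  simp only [Fin.sum_univ_four, Matrix.cons_val_zero, Matrix.cons_val_one, Matrix.cons_val] at hg
  rw [LinearIndependent.pair_iff] at hy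
  -- If `u` vanished, the relation would reduce to one between `1` and `y`, which are independent.
  have ht0 : g 2 • (unitVec : Fin 4 → ℚ_[p]) + g 3 • y ≠ 0 := by
    intro h0
    obtain ⟨h2, h3⟩ := hy _ _ h0
    rw [h2, h3, zero_smul, zero_smul, add_zero, add_zero] at hg
    obtain ⟨h0, h1⟩ := hy _ _ hg
    apply hi
    fin_cases i <;> assumption
  set u := g 2 • (unitVec : Fin 4 → ℚ_[p]) + g 3 • y with hu
  have huy : mulBy p ε u y' = -(g 0 • unitVec + g 1 • y) := by
    have : mulBy p ε u y' = g 2 • y' + g 3 • mulBy p ε y y' := by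
      rw [mulBy_comm, hu, map_add, map_smul, map_smul, mulBy_unitVec, mulBy_comm p ε y']
    rw [this, eq_neg_iff_add_eq_zero, ← hg]
    abel
  have hmem : ∀ c d : ℚ_[p], mulBy p ε v (c • unitVec + d • y) ∈ P.1 := by
    intro c d
    rw [map_add, map_smul, map_smul, mulBy_unitVec]
    exact Submodule.add_mem _ (Submodule.smul_mem _ _ hs.left_mem)
      (Submodule.smul_mem _ _ hs.right_mem)
  have hvc := hP v h.left_mem hv0
  -- The product `v u` lies in `P` and is nonzero, so it is cyclic; the isomorphism from `Q` to `P`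
  -- is multiplication by `v u / x'`.
  have hc : IsCyclicVec p ε (mulBy p ε v u) := by
    refine hP _ (hmem _ _) fun h0 => ht0 (hvc.injective ?_)
    rw [h0, map_zero]
  refine FilteredPhiModule.Iso.symm (iso_DP_iff.2 ⟨hxc'.mulEquiv.symm.trans hc.mulEquiv, ?_, ?_⟩)
  · intro x
    simp only [LinearEquiv.trans_apply, hxc'.mulEquiv_symm_phi, hc.mulEquiv_phi]
  · refine map_eq_of_mem _ hs' ?_ ?_
    · have : hxc'.mulEquiv.symm x' = unitVec := by
        rw [LinearEquiv.symm_apply_eq, hxc'.mulEquiv_apply, mulBy_unitVec]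
      rw [LinearEquiv.trans_apply, this, hc.mulEquiv_apply, mulBy_unitVec]
      exact hmem _ _
    · have : hxc'.mulEquiv.symm (mulBy p ε x' y') = y' := by
        rw [LinearEquiv.symm_apply_eq, hxc'.mulEquiv_apply]
      rw [LinearEquiv.trans_apply, this, hc.mulEquiv_apply, mulBy_assoc, huy, map_neg]
      exact Submodule.neg_mem _ (hmem _ _)

/-- `φ² - b` maps into the eigenplane of `a` when `a` and `b` are the two roots. -/
theorem sub_smul_mem_eigenplane {ε : ℤ} {a b : ℚ_[p]} (ha : IsQuadRoot ε a)
    (hab : a + b = -((ε : ℚ_[p]) * p)) (y : Fin 4 → ℚ_[p]) :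
    phi ℚ_[p] p ε (phi ℚ_[p] p ε y) - b • y ∈ eigenplane ε a := by
  rw [mem_eigenplane]
  have h := phi_charpoly_apply (K := ℚ_[p]) p ε y
  rw [add_assoc, ← eq_neg_iff_add_eq_zero] at h
  rw [map_sub, map_sub, map_smul, map_smul, h]
  have hq : (p : ℚ_[p]) ^ 2 = a * b := by
    unfold IsQuadRoot at ha
    linear_combination ha - a * hab
  rw [hq, show (ε : ℚ_[p]) * p = -(a + b) by rw [hab, neg_neg]]
  module

/-- Complete `x` to a basis `x, y` of `P`. As `φ² y - b y` lies in the eigenplane of `a`, spanned by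
`x` and `φ x`, the map `φ²` on `P` modulo `φ(P)` is triangular with diagonal `a, b`, of trace `a + b
= -εp`. Read as an identity of determinants, this holds even when `den` is zero. -/
theorem num_add_den_eq_zero (hp : 7 ≤ p) {ε : ℤ} (hε : ε = 0 ∨ ε = 1 ∨ ε = -1) {P : Gr ℚ_[p]}
    {v w x : Fin 4 → ℚ_[p]} (h : Spans P v w) (hx : x ∈ P.1) (hx0 : x ≠ 0) {a : ℚ_[p]}
    (ha : IsQuadRoot ε a) (hxa : x ∈ eigenplane ε a) :
    num p ε v w = -((ε : ℚ_[p]) * p) * den p ε v w := by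
  obtain ⟨y, hy⟩ := exists_spans_left hx hx0
  obtain ⟨c, d, hcd⟩ := mem_span_pair_of_mem_eigenplane hp hε ha hxa hx0
    (sub_smul_mem_eigenplane (b := -((ε : ℚ_[p]) * (p : ℚ_[p])) - a) ha (by ring) y)
  rw [eq_sub_iff_add_eq] at hcd
  have key : num p ε x y = -((ε : ℚ_[p]) * p) * den p ε x y := by
    rw [num, ← hcd, mem_eigenplane.1 hxa, den]
    simp only [wedge_eq, Pi.add_apply, Pi.smul_apply, smul_eq_mul]
    ring
  obtain ⟨t, -, hm⟩ := hy.exists_smul h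
  rw [num_eq_of_minors hm, den_eq_of_minors hm, key]
  ring

theorem isCyclicVec_of_num_ne (hp : 7 ≤ p) {ε : ℤ} (hε : ε = 0 ∨ ε = 1 ∨ ε = -1) {P : Gr ℚ_[p]}
    {v w : Fin 4 → ℚ_[p]} (h : Spans P v w)
    (hne : num p ε v w ≠ -((ε : ℚ_[p]) * p) * den p ε v w) :
    ∀ x ∈ P.1, x ≠ 0 → IsCyclicVec p ε x := by
  intro x hx hx0
  refine isCyclicVec_of hp hε hx0 fun a ha hxa => hne ?_
  exact num_add_den_eq_zero hp hε h hx hx0 ha hxa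

theorem mulBy_mem_eigenplane {ε : ℤ} {a : ℚ_[p]} {x y : Fin 4 → ℚ_[p]} (hy : y ∈ eigenplane ε a) :
    mulBy p ε x y ∈ eigenplane ε a := by
  rw [mem_eigenplane] at *
  rw [← mulBy_phi, ← mulBy_phi, hy, map_smul]

/-- For `P = x ⟨1, y⟩` the fiber condition is `(y 1 + a y 3)(y 1 + b y 3) = 0`. If the first factor
vanishes, then `y - a y 2 = (φ² - a)(y 2 + y 3 φ) 1`, which `φ² - b` kills, and multiplication by
`x` preserves this. -/
theorem exists_mem_eigenplane (hp : 7 ≤ p) {ε : ℤ} (hε : ε = 0 ∨ ε = 1 ∨ ε = -1) {P : Gr ℚ_[p]}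
    {v w : Fin 4 → ℚ_[p]} (h : Spans P v w)
    (hP : ¬ ∃ a, IsQuadRoot ε a ∧ P.1 = eigenplane ε a)
    (hfib : num p ε v w = -((ε : ℚ_[p]) * p) * den p ε v w) {a b : ℚ_[p]} (ha : IsQuadRoot ε a)
    (hab : a + b = -((ε : ℚ_[p]) * p)) :
    ∃ x ∈ P.1, x ≠ 0 ∧ (x ∈ eigenplane ε a ∨ x ∈ eigenplane ε b) := by
  obtain ⟨x, hx, hxc⟩ := exists_isCyclicVec_mem hp hε hP
  obtain ⟨y, t, hy, hy0, ht, hs, hn, hd⟩ := exists_unit_form h hx hxc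
  have he : (ε : ℚ_[p]) * p = -(a + b) := by rw [hab, neg_neg]
  have hq : (p : ℚ_[p]) ^ 2 = a * b := by
    unfold IsQuadRoot at ha
    linear_combination ha - a * hab
  have hfac : (y 1 + a * y 3) * (y 1 + b * y 3) = 0 := by
    have h1 := num_unitVec p ε y
    rw [hn, hd, hfib, he, hq] at h1
    linear_combination -h1
  have key : ∀ a b : ℚ_[p], (ε : ℚ_[p]) * p = -(a + b) → (p : ℚ_[p]) ^ 2 = a * b →
      y 1 + a * y 3 = 0 → ∃ z ∈ P.1, z ≠ 0 ∧ z ∈ eigenplane ε b := by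
    intro a b he hq h0
    refine ⟨mulBy p ε x (y - (a * y 2) • unitVec), ?_, ?_, mulBy_mem_eigenplane ?_⟩
    · rw [map_sub, map_smul, mulBy_unitVec]
      exact Submodule.sub_mem _ hs.right_mem (Submodule.smul_mem _ _ hs.left_mem)
    · intro hz
      have h1 := hxc.injective (hz.trans (map_zero _).symm)
      rw [LinearIndependent.pair_iff] at hy
      exact one_ne_zero (hy (-(a * y 2)) 1 (by rw [← h1]; module)).2
    · rw [mem_eigenplane]
      have h1 : y 1 = -(a * y 3) := eq_neg_of_add_eq_zero_left h0
      have h2 : y - (a * y 2) • unitVec = ![-(a * y 2), -(a * y 3), y 2, y 3] := by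
        funext i
        fin_cases i <;> simp [unitVec, hy0, h1]
      rw [h2]
      funext i
      fin_cases i <;> simp [phi_apply, he, hq] <;> ring
  rcases mul_eq_zero.1 hfac with h0 | h0
  · obtain ⟨z, h1, h2, h3⟩ := key a b he hq h0
    exact ⟨z, h1, h2, Or.inr h3⟩
  · obtain ⟨z, h1, h2, h3⟩ := key b a (by rw [he, add_comm]) (by rw [hq, mul_comm]) h0
    exact ⟨z, h1, h2, Or.inl h3⟩

theorem eq_zero_of_mem_eigenplanes {ε : ℤ} {a b : ℚ_[p]} (hab : a ≠ b) {x : Fin 4 → ℚ_[p]}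
    (ha : x ∈ eigenplane ε a) (hb : x ∈ eigenplane ε b) : x = 0 := by
  rw [mem_eigenplane] at ha hb
  have : (a - b) • x = 0 := by rw [sub_smul, ← ha, ← hb, sub_self]
  exact (smul_eq_zero.1 this).resolve_left (sub_ne_zero.2 hab)

theorem eq_zero_of_add_eq_zero {ε : ℤ} {a b : ℚ_[p]} (hab : a ≠ b) {x y : Fin 4 → ℚ_[p]}
    (hx : x ∈ eigenplane ε a) (hy : y ∈ eigenplane ε b) (h : x + y = 0) : x = 0 ∧ y = 0 := by
  have h1 : x = -y := eq_neg_of_add_eq_zero_left h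
  have h2 : x = 0 := eq_zero_of_mem_eigenplanes hab hx (h1 ▸ Submodule.neg_mem _ hy)
  exact ⟨h2, by simpa [h2] using h⟩

/-- The automorphisms of `(ℚ_[p]⁴, φ)` act transitively on pairs of nonzero vectors in the two
eigenplanes. -/
theorem exists_equiv_of_mem_eigenplanes (hp : 7 ≤ p) {ε : ℤ} (hε : ε = 0 ∨ ε = 1 ∨ ε = -1)
    {a b : ℚ_[p]} (ha : IsQuadRoot ε a) (hab : a + b = -((ε : ℚ_[p]) * p)) (hne : a ≠ b)
    {x x' z z' : Fin 4 → ℚ_[p]} (hx : x ∈ eigenplane ε a) (hx' : x' ∈ eigenplane ε a)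
    (hz : z ∈ eigenplane ε b) (hz' : z' ∈ eigenplane ε b) (hx0 : x ≠ 0) (hx0' : x' ≠ 0)
    (hz0 : z ≠ 0) (hz0' : z' ≠ 0) :
    ∃ g : (Fin 4 → ℚ_[p]) ≃ₗ[ℚ_[p]] (Fin 4 → ℚ_[p]),
      (∀ y, g (phi ℚ_[p] p ε y) = phi ℚ_[p] p ε (g y)) ∧ g x = x' ∧ g z = z' := by
  -- A sum of nonzero vectors of the two eigenplanes is a unit. Multiplication by `(x' + z') / (x +
  -- z)` sends one sum to the other and preserves the eigenplanes, so it matches the components.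
  have hcyc : ∀ x z : Fin 4 → ℚ_[p], x ∈ eigenplane ε a → z ∈ eigenplane ε b → x ≠ 0 → z ≠ 0 →
      IsCyclicVec p ε (x + z) := by
    intro x z hx hz hx0 hz0
    refine isCyclicVec_of hp hε (fun h => hx0 (eq_zero_of_add_eq_zero hne hx hz h).1) ?_
    intro c hc h
    have hc' : c = a ∨ c = b := by
      rcases ha.eq_or_eq hc with h | h
      · exact Or.inl h
      · exact Or.inr (by rw [h, ← hab]; ring)
    rcases hc' with rfl | rfl
    · have := ((eigenplane ε c).add_mem_iff_right hx).1 h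
      exact hz0 (eq_zero_of_mem_eigenplanes hne this hz)
    · have := ((eigenplane ε c).add_mem_iff_left hz).1 h
      exact hx0 (eq_zero_of_mem_eigenplanes hne hx this)
  have h1 := hcyc x z hx hz hx0 hz0
  have h2 := hcyc x' z' hx' hz' hx0' hz0'
  set g := h1.mulEquiv.symm.trans h2.mulEquiv with hg
  have hgφ : ∀ y, g (phi ℚ_[p] p ε y) = phi ℚ_[p] p ε (g y) := by
    intro y
    simp only [hg, LinearEquiv.trans_apply, h1.mulEquiv_symm_phi, h2.mulEquiv_phi]
  have hgu : g x + g z = x' + z' := by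
    rw [← map_add]
    have : h1.mulEquiv.symm (x + z) = unitVec := by
      rw [LinearEquiv.symm_apply_eq, h1.mulEquiv_apply, mulBy_unitVec]
    rw [hg, LinearEquiv.trans_apply, this, h2.mulEquiv_apply, mulBy_unitVec]
  have hgx : g x ∈ eigenplane ε a := by
    rw [mem_eigenplane] at *
    rw [← hgφ, ← hgφ, hx, map_smul]
  have hgz : g z ∈ eigenplane ε b := by
    rw [mem_eigenplane] at *
    rw [← hgφ, ← hgφ, hz, map_smul]
  have h3 := eq_zero_of_add_eq_zero hne (Submodule.sub_mem _ hgx hx') (Submodule.sub_mem _ hgz hz')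
    (by rw [← sub_eq_zero.2 hgu]; abel)
  exact ⟨g, hgφ, sub_eq_zero.1 h3.1, sub_eq_zero.1 h3.2⟩

/-- A plane that meets an eigenplane in a line is of one of two types. -/
theorem exists_spans_of_mem_eigenplane (hp : 7 ≤ p) {ε : ℤ} (hε : ε = 0 ∨ ε = 1 ∨ ε = -1)
    {a b : ℚ_[p]} (ha : IsQuadRoot ε a) (hb : IsQuadRoot ε b)
    (hab : a + b = -((ε : ℚ_[p]) * p)) (hne : a ≠ b) {P : Gr ℚ_[p]} (hP : P.1 ≠ eigenplane ε a)
    {x : Fin 4 → ℚ_[p]} (hx : x ∈ P.1) (hx0 : x ≠ 0) (hxa : x ∈ eigenplane ε a) :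
    ∃ z ∈ eigenplane ε b, z ≠ 0 ∧ (Spans P x z ∨ Spans P x (phi ℚ_[p] p ε x + z)) := by
  obtain ⟨w, hw⟩ := exists_spans_left hx hx0
  have hδ : b - a ≠ 0 := sub_ne_zero.2 (Ne.symm hne)
  set T := phi ℚ_[p] p ε (phi ℚ_[p] p ε w) with hT
  have hwa : T - b • w ∈ eigenplane ε a := sub_smul_mem_eigenplane ha hab w
  have hwb : T - a • w ∈ eigenplane ε b := sub_smul_mem_eigenplane hb (by rw [add_comm, hab]) w
  obtain ⟨c, d, hcd⟩ := mem_span_pair_of_mem_eigenplane hp hε ha hxa hx0 hwa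
  -- The decomposition of `w` along the two eigenplanes. The type of `P` depends on whether the
  -- coefficient `d` of `φ x` vanishes; otherwise `w` is rescaled so that this coefficient becomes
  -- 1.
  have hdec : (b - a) • w = (T - a • w) - (c • x + d • phi ℚ_[p] p ε x) := by
    rw [hcd]
    module
  have hz0 : T - a • w ≠ 0 := by
    intro h0
    have hwa' : w ∈ eigenplane ε a := mem_eigenplane.2 (sub_eq_zero.1 h0)
    refine hP (Submodule.eq_of_le_of_finrank_eq ?_
      (P.2.trans (finrank_eigenplane hp hε ha).symm))
    rw [← hw, Submodule.span_le]
    simp [Set.insert_subset_iff, hxa, hwa']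
  by_cases hd : d = 0
  · refine ⟨T - a • w, hwb, hz0, Or.inl (spans_of_mem hx ?_ ?_)⟩
    · have : T - a • w = (b - a) • w + c • x := by rw [hdec, hd]; module
      rw [this]
      exact Submodule.add_mem _ (Submodule.smul_mem _ _ hw.right_mem) (Submodule.smul_mem _ _ hx)
    · rw [LinearIndependent.pair_iff]
      intro s t hst
      have := eq_zero_of_add_eq_zero hne (Submodule.smul_mem _ s hxa) (Submodule.smul_mem _ t hwb) hst
      exact ⟨(smul_eq_zero.1 this.1).resolve_right hx0, (smul_eq_zero.1 this.2).resolve_right hz0⟩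
  · refine ⟨(-d⁻¹) • (T - a • w), Submodule.smul_mem _ _ hwb,
      smul_ne_zero (neg_ne_zero.2 (inv_ne_zero hd)) hz0, Or.inr (spans_of_mem hx ?_ ?_)⟩
    · have : phi ℚ_[p] p ε x + (-d⁻¹) • (T - a • w) = (-d⁻¹) • ((b - a) • w + c • x) := by
        rw [hdec]
        have : phi ℚ_[p] p ε x = (-d⁻¹) • ((-d) • phi ℚ_[p] p ε x) := by
          rw [smul_smul, neg_mul_neg, inv_mul_cancel₀ hd, one_smul]
        nth_rewrite 1 [this]
        module
      rw [this]
      exact Submodule.smul_mem _ _ (Submodule.add_mem _ (Submodule.smul_mem _ _ hw.right_mem)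
        (Submodule.smul_mem _ _ hx))
    · rw [LinearIndependent.pair_iff]
      intro s t hst
      have := eq_zero_of_add_eq_zero hne
        (x := s • x + t • phi ℚ_[p] p ε x) (y := t • (-d⁻¹) • (T - a • w))
        (Submodule.add_mem _ (Submodule.smul_mem _ s hxa)
          (Submodule.smul_mem _ t (phi_mem_eigenplane hxa)))
        (Submodule.smul_mem _ t (Submodule.smul_mem _ _ hwb)) (by rw [← hst]; module)
      exact LinearIndependent.pair_iff.1 (linearIndependent_pair_phi hp hε hx0) s t this.1

end Orbits

/-! ### The exceptional fiber over `[-εp : 1]` -/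

section Fibers

variable {p : ℕ} [Fact p.Prime]

/-- The plane `P` meets the eigenplane of `a` nontrivially. -/
def MeetsEigenplane (ε : ℤ) (P : Gr ℚ_[p]) (a : ℚ_[p]) : Prop :=
  ∃ x ∈ P.1, x ≠ 0 ∧ x ∈ eigenplane ε a

theorem MeetsEigenplane.of_iso {ε : ℤ} {P Q : Gr ℚ_[p]} {a : ℚ_[p]} (h : MeetsEigenplane ε P a)
    (hi : (DP ε P).Iso (DP ε Q)) : MeetsEigenplane ε Q a := by
  obtain ⟨g, hg, hm⟩ := iso_DP_iff.1 hi
  obtain ⟨x, hx, hx0, hxa⟩ := h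
  refine ⟨g x, hm ▸ Submodule.mem_map_of_mem hx, fun h0 => hx0 ?_, ?_⟩
  · exact (LinearEquiv.map_eq_zero_iff g).1 h0
  · rw [mem_eigenplane] at *
    rw [← hg, ← hg, hxa, map_smul]

theorem linearIndependent_of_mem_eigenplanes {ε : ℤ} {a b : ℚ_[p]} (hne : a ≠ b)
    {x z : Fin 4 → ℚ_[p]} (hx : x ∈ eigenplane ε a) (hz : z ∈ eigenplane ε b) (hx0 : x ≠ 0)
    (hz0 : z ≠ 0) : LinearIndependent ℚ_[p] ![x, z] := by
  rw [LinearIndependent.pair_iff]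
  intro s t hst
  have := eq_zero_of_add_eq_zero hne (Submodule.smul_mem _ s hx) (Submodule.smul_mem _ t hz) hst
  exact ⟨(smul_eq_zero.1 this.1).resolve_right hx0, (smul_eq_zero.1 this.2).resolve_right hz0⟩

theorem linearIndependent_phi_add {ε : ℤ} {a b : ℚ_[p]} (hne : a ≠ b)
    {x z : Fin 4 → ℚ_[p]} (hx : x ∈ eigenplane ε a) (hz : z ∈ eigenplane ε b) (hx0 : x ≠ 0)
    (hz0 : z ≠ 0) : LinearIndependent ℚ_[p] ![x, phi ℚ_[p] p ε x + z] := by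
  rw [LinearIndependent.pair_iff]
  intro s t hst
  have h := eq_zero_of_add_eq_zero hne (x := s • x + t • phi ℚ_[p] p ε x)
    (Submodule.add_mem _ (Submodule.smul_mem _ s hx)
      (Submodule.smul_mem _ t (phi_mem_eigenplane hx))) (Submodule.smul_mem _ t hz)
    (by rw [← hst]; module)
  have ht := (smul_eq_zero.1 h.2).resolve_right hz0
  have h1 := h.1
  rw [ht, zero_smul, add_zero] at h1
  exact ⟨(smul_eq_zero.1 h1).resolve_right hx0, ht⟩

/-- The component of `s x + t (φ x + z)` in the eigenplane of `a` is `s x + t φ x`, and `x, φ x` are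
independent. -/
theorem not_meetsEigenplane_of_spans (hp : 7 ≤ p) {ε : ℤ} (hε : ε = 0 ∨ ε = 1 ∨ ε = -1)
    {a b : ℚ_[p]} (hne : a ≠ b)
    {x z : Fin 4 → ℚ_[p]} (hx : x ∈ eigenplane ε a) (hz : z ∈ eigenplane ε b) (hx0 : x ≠ 0)
    {P : Gr ℚ_[p]} (h : Spans P x (phi ℚ_[p] p ε x + z)) : ¬ MeetsEigenplane ε P b := by
  rintro ⟨y, hy, hy0, hyb⟩
  obtain ⟨s, t, rfl⟩ := (mem_span_pair_iff_of_spans h).1 hy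
  have h1 := eq_zero_of_add_eq_zero hne (x := s • x + t • phi ℚ_[p] p ε x)
    (y := t • z - (s • x + t • (phi ℚ_[p] p ε x + z)))
    (Submodule.add_mem _ (Submodule.smul_mem _ s hx)
      (Submodule.smul_mem _ t (phi_mem_eigenplane hx)))
    (Submodule.sub_mem _ (Submodule.smul_mem _ t hz) hyb) (by module)
  obtain ⟨rfl, rfl⟩ := LinearIndependent.pair_iff.1 (linearIndependent_pair_phi hp hε hx0) s t h1.1
  simp at hy0

/-- A plane that meets an eigenplane without being contained in it is not an eigenplane. -/
theorem ne_eigenplane_of_notMem {ε : ℤ} {a b : ℚ_[p]} (ha : IsQuadRoot ε a)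
    (hab : a + b = -((ε : ℚ_[p]) * p)) (hne : a ≠ b) {P : Gr ℚ_[p]} {x y : Fin 4 → ℚ_[p]}
    (hx : x ∈ P.1) (hx0 : x ≠ 0) (hxa : x ∈ eigenplane ε a) (hy : y ∈ P.1)
    (hya : y ∉ eigenplane ε a) : ¬ ∃ c, IsQuadRoot ε c ∧ P.1 = eigenplane ε c := by
  rintro ⟨c, hc, hPc⟩
  rcases ha.eq_or_eq hc with rfl | h
  · exact hya (hPc ▸ hy)
  · obtain rfl : c = b := by rw [h, ← hab]; ring
    exact hx0 (eq_zero_of_mem_eigenplanes hne hxa (hPc ▸ hx))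

/-- With `x, z` in the two eigenplanes, the representatives are `⟨x, z⟩`, `⟨x, φ x + z⟩` and `⟨z, φ
z + x⟩`. They are told apart by which eigenplanes they meet, and every plane of the fiber is moved
to one of them by transitivity on the pairs `(x, z)`. -/
theorem exists_fiber_representatives (hp : 7 ≤ p) {ε : ℤ} (hε : ε = 0 ∨ ε = 1 ∨ ε = -1)
    {a : ℚ_[p]} (ha : IsQuadRoot ε a) :
    ∃ P : Fin 3 → Gr ℚ_[p],
      (∀ i, (¬ ∃ c, IsQuadRoot ε c ∧ (P i).1 = eigenplane ε c) ∧
        ∀ v w, Spans (P i) v w → num p ε v w = -((ε : ℚ_[p]) * p) * den p ε v w) ∧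
      (∀ i j, (DP ε (P i)).Iso (DP ε (P j)) → i = j) ∧
      ∀ Q : Gr ℚ_[p], (¬ ∃ c, IsQuadRoot ε c ∧ Q.1 = eigenplane ε c) →
        ∀ v w, Spans Q v w → num p ε v w = -((ε : ℚ_[p]) * p) * den p ε v w →
        ∃ i, (DP ε Q).Iso (DP ε (P i)) := by
  obtain ⟨b, hab⟩ : ∃ b : ℚ_[p], a + b = -((ε : ℚ_[p]) * p) :=
    ⟨-((ε : ℚ_[p]) * (p : ℚ_[p])) - a, by ring⟩
  have hb' : b = -((ε : ℚ_[p]) * (p : ℚ_[p])) - a := by rw [← hab]; ring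
  have hb : IsQuadRoot ε b := hb' ▸ ha.conj
  have hne : a ≠ b := hb' ▸ ha.ne_conj hε
  have hba : b + a = -((ε : ℚ_[p]) * p) := by rw [add_comm, hab]
  set x := eigenvec ε a
  set z := eigenvec ε b
  have hx : x ∈ eigenplane ε a := eigenvec_mem ha
  have hz : z ∈ eigenplane ε b := eigenvec_mem hb
  have hx0 : x ≠ 0 := eigenvec_ne_zero ε a
  have hz0 : z ≠ 0 := eigenvec_ne_zero ε b
  set P0 := planeOf (linearIndependent_of_mem_eigenplanes hne hx hz hx0 hz0)
  set P1 := planeOf (linearIndependent_phi_add hne hx hz hx0 hz0)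
  set P2 := planeOf (linearIndependent_phi_add hne.symm hz hx hz0 hx0)
  have s0 : Spans P0 x z := spans_planeOf _
  have s1 : Spans P1 x (phi ℚ_[p] p ε x + z) := spans_planeOf _
  have s2 : Spans P2 z (phi ℚ_[p] p ε z + x) := spans_planeOf _
  have m0a : MeetsEigenplane ε P0 a := ⟨x, s0.left_mem, hx0, hx⟩
  have m0b : MeetsEigenplane ε P0 b := ⟨z, s0.right_mem, hz0, hz⟩
  have m1a : MeetsEigenplane ε P1 a := ⟨x, s1.left_mem, hx0, hx⟩
  have m2b : MeetsEigenplane ε P2 b := ⟨z, s2.left_mem, hz0, hz⟩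
  have n1b : ¬ MeetsEigenplane ε P1 b := not_meetsEigenplane_of_spans hp hε hne hx hz hx0 s1
  have n2a : ¬ MeetsEigenplane ε P2 a := not_meetsEigenplane_of_spans hp hε hne.symm hz hx hz0 s2
  refine ⟨![P0, P1, P2], ?_, ?_, ?_⟩
  · intro i
    fin_cases i
    · exact ⟨ne_eigenplane_of_notMem ha hab hne s0.left_mem hx0 hx s0.right_mem
        fun h => hz0 (eq_zero_of_mem_eigenplanes hne h hz),
        fun v w h => num_add_den_eq_zero hp hε h s0.left_mem hx0 ha hx⟩
    · exact ⟨ne_eigenplane_of_notMem ha hab hne s1.left_mem hx0 hx s1.right_mem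
        fun h => hz0 (eq_zero_of_mem_eigenplanes hne
          (((eigenplane ε a).add_mem_iff_right (phi_mem_eigenplane hx)).1 h) hz),
        fun v w h => num_add_den_eq_zero hp hε h s1.left_mem hx0 ha hx⟩
    · exact ⟨ne_eigenplane_of_notMem hb hba hne.symm s2.left_mem hz0 hz s2.right_mem
        fun h => hx0 (eq_zero_of_mem_eigenplanes hne hx
          (((eigenplane ε b).add_mem_iff_right (phi_mem_eigenplane hz)).1 h)),
        fun v w h => num_add_den_eq_zero hp hε h s2.left_mem hz0 hb hz⟩
  · intro i j hij
    fin_cases i <;> fin_cases j <;> first | rfl | exfalso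
    · exact n1b (m0b.of_iso hij)
    · exact n2a (m0a.of_iso hij)
    · exact n1b (m0b.of_iso hij.symm)
    · exact n2a (m1a.of_iso hij)
    · exact n2a (m0a.of_iso hij.symm)
    · exact n1b (m2b.of_iso hij)
  · intro Q hQ v w hvw hfib
    obtain ⟨y, hy, hy0, hyab⟩ := exists_mem_eigenplane hp hε hvw hQ hfib ha hab
    rcases hyab with hya | hyb
    · obtain ⟨u, hu, hu0, hs⟩ := exists_spans_of_mem_eigenplane hp hε ha hb hab hne
        (fun h => hQ ⟨a, ha, h⟩) hy hy0 hya
      obtain ⟨g, hg, hgy, hgu⟩ := exists_equiv_of_mem_eigenplanes hp hε ha hab hne hya hx hu hz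
        hy0 hx0 hu0 hz0
      rcases hs with hs | hs
      · refine ⟨0, iso_DP_iff.2 ⟨g, hg, map_eq_of_mem g hs ?_ ?_⟩⟩
        · rw [hgy]; exact s0.left_mem
        · rw [hgu]; exact s0.right_mem
      · refine ⟨1, iso_DP_iff.2 ⟨g, hg, map_eq_of_mem g hs ?_ ?_⟩⟩
        · rw [hgy]; exact s1.left_mem
        · rw [map_add, hg, hgy, hgu]; exact s1.right_mem
    · obtain ⟨u, hu, hu0, hs⟩ := exists_spans_of_mem_eigenplane hp hε hb ha hba hne.symm
        (fun h => hQ ⟨b, hb, h⟩) hy hy0 hyb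
      obtain ⟨g, hg, hgy, hgu⟩ := exists_equiv_of_mem_eigenplanes hp hε hb hba hne.symm hyb hz hu hx
        hy0 hz0 hu0 hx0
      rcases hs with hs | hs
      · refine ⟨0, iso_DP_iff.2 ⟨g, hg, map_eq_of_mem g hs ?_ ?_⟩⟩
        · rw [hgy]; exact s0.right_mem
        · rw [hgu]; exact s0.left_mem
      · refine ⟨2, iso_DP_iff.2 ⟨g, hg, map_eq_of_mem g hs ?_ ?_⟩⟩
        · rw [hgy]; exact s2.left_mem
        · rw [map_add, hg, hgy, hgu]; exact s2.right_mem

/-- The plane spanned by `1` and `φ²` lies in the fiber over `-ε p`. -/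
theorem exists_mem_fiber (p : ℕ) [Fact p.Prime] (ε : ℤ) :
    ∃ (P : Gr ℚ_[p]) (v w : Fin 4 → ℚ_[p]), Spans P v w ∧ den p ε v w ≠ 0 ∧
      num p ε v w = -((ε : ℚ_[p]) * p) * den p ε v w := by
  have hl : LinearIndependent ℚ_[p] ![(unitVec : Fin 4 → ℚ_[p]), ![0, 0, 1, 0]] := by
    rw [LinearIndependent.pair_iff]
    intro s t h
    have h0 := congrFun h 0
    have h2 := congrFun h 2
    simp [unitVec] at h0 h2
    exact ⟨h0, h2⟩
  refine ⟨planeOf hl, _, _, spans_planeOf hl, ?_, ?_⟩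
  · rw [den_unitVec]
    simp
  · rw [num_unitVec, den_unitVec]
    simp

end Fibers

/-! ### Plücker coordinates in an eigenbasis of `φ` -/

section Minors

variable {R : Type*} [CommRing R]

/-- The `2 × 2` minors of a pair of vectors. -/
def minor (v w : Fin 4 → R) (i j : Fin 4) : R := v i * w j - v j * w i

theorem minor_self (v w : Fin 4 → R) (i : Fin 4) : minor v w i i = 0 := by
  rw [minor, mul_comm, sub_self]

theorem minor_swap (v w : Fin 4 → R) (i j : Fin 4) : minor v w i j = -minor v w j i := by
  simp only [minor]
  ring

theorem minor_relation (v w : Fin 4 → R) :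
    minor v w 0 1 * minor v w 2 3 - minor v w 0 2 * minor v w 1 3
      + minor v w 0 3 * minor v w 1 2 = 0 := by
  simp only [minor]
  ring

theorem minor_mulVec (M : Matrix (Fin 4) (Fin 4) R) (v w : Fin 4 → R) (i j : Fin 4) :
    minor (M.mulVec v) (M.mulVec w) i j = ∑ a, ∑ b, M i a * M j b * minor v w a b := by
  simp only [minor, Matrix.mulVec, dotProduct, Finset.sum_mul_sum, mul_sub, Finset.sum_sub_distrib]
  congr 1
  · exact Finset.sum_congr rfl fun a _ => Finset.sum_congr rfl fun b _ => by ring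
  · rw [Finset.sum_comm]
    exact Finset.sum_congr rfl fun a _ => Finset.sum_congr rfl fun b _ => by ring

theorem minor_map {S : Type*} [CommRing S] (f : R →+* S) (v w : Fin 4 → R) (i j : Fin 4) :
    minor (fun i => f (v i)) (fun i => f (w i)) i j = f (minor v w i j) := by
  simp [minor]

theorem plucker_eq_minor {K : Type*} [Field K] (v w : Fin 4 → K) (ij : PIdx) :
    plucker v w ij = minor v w ij.1.1 ij.1.2 := rfl

/-- `den` over a ring. -/
def denMinor (e q : R) (v w : Fin 4 → R) : R :=
  denForm e q (minor v w 0 1) (minor v w 0 2) (minor v w 0 3) (minor v w 1 2) (minor v w 1 3)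
    (minor v w 2 3)

/-- `num` over a ring. -/
def numMinor (e q : R) (v w : Fin 4 → R) : R :=
  numForm e q (minor v w 0 1) (minor v w 0 2) (minor v w 0 3) (minor v w 1 2) (minor v w 1 3)
    (minor v w 2 3)

theorem den_eq_denMinor {K : Type*} [Field K] (p : ℕ) (ε : ℤ) (v w : Fin 4 → K) :
    den p ε v w = denMinor ((ε : K) * p) ((p : K) ^ 2) v w := den_eq p ε v w

theorem num_eq_numMinor {K : Type*} [Field K] (p : ℕ) (ε : ℤ) (v w : Fin 4 → K) :
    num p ε v w = numMinor ((ε : K) * p) ((p : K) ^ 2) v w := num_eq p ε v w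

theorem denMinor_map {S : Type*} [CommRing S] (f : R →+* S) (e q : R) (v w : Fin 4 → R) :
    denMinor (f e) (f q) (fun i => f (v i)) (fun i => f (w i)) = f (denMinor e q v w) := by
  simp [denMinor, minor_map, denForm]

theorem numMinor_map {S : Type*} [CommRing S] (f : R →+* S) (e q : R) (v w : Fin 4 → R) :
    numMinor (f e) (f q) (fun i => f (v i)) (fun i => f (w i)) = f (numMinor e q v w) := by
  simp [numMinor, minor_map, numForm, map_ofNat f 2]

/-- The change to coordinates in which `φ` is diagonal, with eigenvalues `a, -a, b, -b`. -/
def eigMat (a b : R) : Matrix (Fin 4) (Fin 4) R := Matrix.vandermonde ![a, -a, b, -b]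

theorem det_eigMat (a b : R) : (eigMat a b).det = 4 * (a * b) * (a ^ 2 - b ^ 2) ^ 2 := by
  rw [eigMat, Matrix.det_vandermonde]
  rw [Fin.prod_univ_four, show Finset.Ioi (0 : Fin 4) = {1, 2, 3} by decide,
    show Finset.Ioi (1 : Fin 4) = {2, 3} by decide, show Finset.Ioi (2 : Fin 4) = {3} by decide,
    show Finset.Ioi (3 : Fin 4) = ∅ by decide]
  simp
  ring

theorem minor_eigMat (a b : R) (v w : Fin 4 → R) (i j : Fin 4) :
    minor ((eigMat a b).mulVec v) ((eigMat a b).mulVec w) i j =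
      (![a, -a, b, -b] j - ![a, -a, b, -b] i) * minor v w 0 1 +
      (![a, -a, b, -b] j ^ 2 - ![a, -a, b, -b] i ^ 2) * minor v w 0 2 +
      (![a, -a, b, -b] j ^ 3 - ![a, -a, b, -b] i ^ 3) * minor v w 0 3 +
      (![a, -a, b, -b] i * ![a, -a, b, -b] j ^ 2 - ![a, -a, b, -b] i ^ 2 * ![a, -a, b, -b] j)
        * minor v w 1 2 +
      (![a, -a, b, -b] i * ![a, -a, b, -b] j ^ 3 - ![a, -a, b, -b] i ^ 3 * ![a, -a, b, -b] j)
        * minor v w 1 3 +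
      (![a, -a, b, -b] i ^ 2 * ![a, -a, b, -b] j ^ 3 -
        ![a, -a, b, -b] i ^ 3 * ![a, -a, b, -b] j ^ 2) * minor v w 2 3 := by
  simp only [minor, Matrix.mulVec, dotProduct, eigMat, Matrix.vandermonde_apply, Fin.sum_univ_four,
    Fin.val_zero, Fin.val_one, Fin.val_two, show ((3 : Fin 4) : ℕ) = 3 from rfl]
  ring

/-- The product of the minors `01` and `23`. -/
def prodA (v w : Fin 4 → R) : R := minor v w 0 1 * minor v w 2 3

/-- The product of the minors `02` and `13`. -/
def prodB (v w : Fin 4 → R) : R := minor v w 0 2 * minor v w 1 3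

/-- In eigencoordinates the Plücker relation makes `2 prodB - prodA` the sum of `prodB` and the
third product of complementary minors. This identity and the next form a linear system in `prodA`
and `2 prodB - prodA` of determinant `2ab (a² - b²)²`, so `num, den` and `prodA, prodB` determine
each other. -/
theorem det_mul_denMinor (a b : R) (v w : Fin 4 → R) :
    (eigMat a b).det * denMinor (-(a ^ 2 + b ^ 2)) ((a * b) ^ 2) v w =
      -(a ^ 2 + b ^ 2) * prodA ((eigMat a b).mulVec v) ((eigMat a b).mulVec w) -
      2 * (a * b) * (2 * prodB ((eigMat a b).mulVec v) ((eigMat a b).mulVec w) -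
        prodA ((eigMat a b).mulVec v) ((eigMat a b).mulVec w)) := by
  have h := minor_relation v w
  simp only [prodA, prodB, minor_eigMat, det_eigMat, denMinor, denForm, Matrix.cons_val_zero,
    Matrix.cons_val_one, Matrix.cons_val]
  linear_combination (-8 * (a * b) ^ 2 * (a ^ 2 - b ^ 2) ^ 2) * h

theorem det_mul_numMinor (a b : R) (v w : Fin 4 → R) :
    (eigMat a b).det * numMinor (-(a ^ 2 + b ^ 2)) ((a * b) ^ 2) v w =
      -4 * (a * b) ^ 2 * prodA ((eigMat a b).mulVec v) ((eigMat a b).mulVec w) -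
      2 * (a * b) * (a ^ 2 + b ^ 2) *
        (2 * prodB ((eigMat a b).mulVec v) ((eigMat a b).mulVec w) -
        prodA ((eigMat a b).mulVec v) ((eigMat a b).mulVec w)) := by
  have h := minor_relation v w
  simp only [prodA, prodB, minor_eigMat, det_eigMat, numMinor, numForm, Matrix.cons_val_zero,
    Matrix.cons_val_one, Matrix.cons_val]
  linear_combination (-8 * (a * b) ^ 2 * (a ^ 2 - b ^ 2) ^ 2 * (a ^ 2 + b ^ 2)) * h

end Minors

/-! ### Curves through the common zeros -/

section Curves

variable {L : Type*} [Field L]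

open Polynomial in
-- A nonzero factor is kept constant and the other one carries `X²`; if both factors vanish, each
-- takes one power of `X`.
theorem exists_curve_mul {b c : L} (h : b * c = 0) (κ : L) :
    ∃ f g : L[X], f.eval 0 = b ∧ g.eval 0 = c ∧ f * g = C κ * X ^ 2 := by
  by_cases hc : c = 0
  · by_cases hb : b = 0
    · exact ⟨C κ * X, X, by simp [hb], by simp [hc], by ring⟩
    · refine ⟨C b, C (b⁻¹ * κ) * X ^ 2, by simp, by simp [hc], ?_⟩
      rw [← mul_assoc, ← C_mul, mul_inv_cancel_left₀ hb]
  · have hb : b = 0 := (mul_eq_zero.1 h).resolve_right hc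
    refine ⟨C (c⁻¹ * κ) * X ^ 2, C c, by simp [hb], by simp, ?_⟩
    rw [mul_comm, ← mul_assoc, ← C_mul, mul_inv_cancel_left₀ hc]

open Polynomial in
-- On the chart where the minor `01` is a nonzero constant, the minors `02, 13, 03, 12` are free and
-- `23` follows from the Plücker relation. It suffices to deform the products `02 · 13` and `03 ·
-- 12` independently.
theorem exists_curve_of_minor_zero_one {v w : Fin 4 → L} (h01 : minor v w 0 1 ≠ 0)
    (hA : prodA v w = 0) (hB : prodB v w = 0) (κ μ : L) :
    ∃ V W : Fin 4 → L[X], (∀ i j, (minor V W i j).eval 0 = minor v w i j) ∧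
      prodA V W = C κ * X ^ 2 ∧ prodB V W = C μ * X ^ 2 := by
  have hpl := minor_relation v w
  rw [prodA] at hA
  rw [prodB] at hB
  have hC : minor v w 1 2 * minor v w 0 3 = 0 := by
    linear_combination hpl - hA + hB
  have hB' : minor v w 1 3 * minor v w 0 2 = 0 := by rw [mul_comm, hB]
  have h23 : minor v w 2 3 = 0 := (mul_eq_zero.1 hA).resolve_left h01
  obtain ⟨f, g, hf, hg, hfg⟩ := exists_curve_mul hB' μ
  obtain ⟨r, s, hr, hs, hrs⟩ := exists_curve_mul hC (μ - κ)
  set δ := minor v w 0 1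
  -- The minors `01, 02, 03, 12, 13` of these rows are `δ, g, s, r, f`, and the minor `23` is `δ⁻¹
  -- (f g - r s) = δ⁻¹ κ X²`.
  refine ⟨![C δ, 0, -r, -f], ![0, 1, C δ⁻¹ * g, C δ⁻¹ * s], ?_, ?_, ?_⟩
  · have key : ∀ i j : Fin 4, i < j → (minor ![C δ, 0, -r, -f] ![0, 1, C δ⁻¹ * g, C δ⁻¹ * s]
        i j).eval 0 = minor v w i j := by
      intro i j hij
      fin_cases i <;> fin_cases j <;> first | (exact absurd hij (by decide)) | skip
      · simp [minor, δ]
      · simp [minor, hg]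
        rw [mul_inv_cancel_left₀ h01]
      · simp [minor, hs]
        rw [mul_inv_cancel_left₀ h01]
      · simp [minor, hr]
      · simp [minor, hf]
      · simp [hr, hg, hf, hs, h23, minor.eq_1 ![C δ, 0, -r, -f]]
        linear_combination δ⁻¹ * (hB' - hC)
    intro i j
    rcases lt_trichotomy i j with hij | rfl | hij
    · exact key i j hij
    · simp [minor_self]
    · rw [minor_swap, eval_neg, key j i hij, ← minor_swap]
  · have h1 : C δ * C δ⁻¹ = (1 : L[X]) := by rw [← C_mul, mul_inv_cancel₀ h01, C_1]
    rw [C_sub] at hrs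
    simp [prodA, minor]
    linear_combination (f * g - r * s) * h1 + hfg - hrs
  · have h1 : C δ * C δ⁻¹ = (1 : L[X]) := by rw [← C_mul, mul_inv_cancel₀ h01, C_1]
    simp [prodB, minor]
    linear_combination (f * g) * h1 + hfg

open Polynomial in
theorem exists_curve_of_comp {v w : Fin 4 → L} (σ : Fin 4 → Fin 4) (hσ : ∀ i, σ (σ i) = i)
    (h01 : minor v w (σ 0) (σ 1) ≠ 0) (hA : minor v w (σ 0) (σ 1) * minor v w (σ 2) (σ 3) = 0)
    (hB : minor v w (σ 0) (σ 2) * minor v w (σ 1) (σ 3) = 0) (κ μ : L) :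
    ∃ V W : Fin 4 → L[X], (∀ i j, (minor V W i j).eval 0 = minor v w i j) ∧
      minor V W (σ 0) (σ 1) * minor V W (σ 2) (σ 3) = C κ * X ^ 2 ∧
      minor V W (σ 0) (σ 2) * minor V W (σ 1) (σ 3) = C μ * X ^ 2 := by
  obtain ⟨V, W, h1, h2, h3⟩ := exists_curve_of_minor_zero_one (v := v ∘ σ) (w := w ∘ σ) h01 hA hB κ μ
  have hm : ∀ i j, minor (V ∘ σ) (W ∘ σ) (σ i) (σ j) = minor V W i j := by
    intro i j
    simp [minor, hσ]
  refine ⟨V ∘ σ, W ∘ σ, fun i j => ?_, ?_, ?_⟩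
  · have h := h1 (σ i) (σ j)
    simpa [minor, hσ] using h
  · rw [hm, hm]; exact h2
  · rw [hm, hm]; exact h3

open Polynomial in
/-- Through every point of the cone where both products of complementary minors vanish, there are
curves along which these products vanish to second order with arbitrary leading coefficients. -/
theorem exists_curve {v w : Fin 4 → L} (h : ∃ i j, minor v w i j ≠ 0)
    (hA : prodA v w = 0) (hB : prodB v w = 0) (κ μ : L) :
    ∃ V W : Fin 4 → L[X], (∀ i j, (minor V W i j).eval 0 = minor v w i j) ∧
      prodA V W = C κ * X ^ 2 ∧ prodB V W = C μ * X ^ 2 := by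
  have hpl := minor_relation v w
  rw [prodA] at hA
  rw [prodB] at hB
  have hC : minor v w 0 3 * minor v w 1 2 = 0 := by
    linear_combination hpl - hA + hB
  have hlt : ∃ i j, i < j ∧ minor v w i j ≠ 0 := by
    obtain ⟨i, j, hij⟩ := h
    rcases lt_trichotomy i j with h | rfl | h
    · exact ⟨i, j, h, hij⟩
    · exact absurd (minor_self v w i) hij
    · exact ⟨j, i, h, fun h0 => hij (by rw [minor_swap, h0, neg_zero])⟩
  obtain ⟨i, j, hij, h0⟩ := hlt
  have sw := minor_swap v w
  -- An involution of the indices moves a nonvanishing minor to position `01`. It permutes the three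
  -- complementary products up to sign, which accounts for the changed parameters.
  fin_cases i <;> fin_cases j <;> first | (exact absurd hij (by decide)) | skip
  · exact exists_curve_of_minor_zero_one h0 hA hB κ μ
  · obtain ⟨V, W, h1, h2, h3⟩ := exists_curve_of_comp (v := v) (w := w) ![0, 2, 1, 3] (by decide)
      h0 hB hA μ κ
    exact ⟨V, W, h1, h3, h2⟩
  · obtain ⟨V, W, h1, h2, h3⟩ := exists_curve_of_comp (v := v) (w := w) ![0, 3, 2, 1] (by decide)
      h0 (by simp; rw [sw 2 1]; simpa using hC) (by simp; rw [sw 3 1]; simpa using hB) (κ - μ) (-μ)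
    have hp2 := minor_relation V W
    simp at h2 h3
    rw [minor_swap V W 2 1] at h2
    rw [minor_swap V W 3 1] at h3
    refine ⟨V, W, h1, ?_, ?_⟩ <;> simp only [prodA, prodB]
    · linear_combination hp2 + h2 - h3
    · linear_combination - h3
  · obtain ⟨V, W, h1, h2, h3⟩ := exists_curve_of_comp (v := v) (w := w) ![2, 1, 0, 3] (by decide)
      (by simp; rw [sw 2 1]; simpa using h0) (by simp; rw [sw 2 1, or_comm]; simpa using hC)
      (by simp; rw [sw 2 0]; simpa using hB) (κ - μ) (-μ)
    have hp2 := minor_relation V W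
    simp at h2 h3
    rw [minor_swap V W 2 1] at h2
    rw [minor_swap V W 2 0] at h3
    refine ⟨V, W, h1, ?_, ?_⟩ <;> simp only [prodA, prodB]
    · linear_combination hp2 + h2 - h3
    · linear_combination - h3
  · obtain ⟨V, W, h1, h2, h3⟩ := exists_curve_of_comp (v := v) (w := w) ![3, 1, 2, 0] (by decide)
      (by simp; rw [sw 3 1]; simpa using h0)
      (by simp; rw [sw 3 1, sw 2 0, or_comm]; simpa using hB)
      (by simp; rw [sw 3 2, sw 1 0, or_comm]; simpa using hA) μ κ
    simp at h2 h3
    rw [minor_swap V W 3 1, minor_swap V W 2 0] at h2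
    rw [minor_swap V W 3 2, minor_swap V W 1 0] at h3
    refine ⟨V, W, h1, ?_, ?_⟩ <;> simp only [prodA, prodB]
    · linear_combination h3
    · linear_combination h2
  · obtain ⟨V, W, h1, h2, h3⟩ := exists_curve_of_comp (v := v) (w := w) ![2, 3, 0, 1] (by decide)
      h0 (by simp; rw [or_comm]; simpa using hA)
      (by simp; rw [sw 2 0, sw 3 1]; simpa using hB) κ μ
    simp at h2 h3
    rw [minor_swap V W 2 0, minor_swap V W 3 1] at h3
    refine ⟨V, W, h1, ?_, ?_⟩ <;> simp only [prodA, prodB]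
    · linear_combination h2
    · linear_combination h3

end Curves

/-! ### The domain of definition of `c` -/

section Expressions

variable {k K : Type*} [Field k] [Field K] [Algebra k K]

theorem linearIndependent_of_den_ne_zero {p : ℕ} {ε : ℤ} {v w : Fin 4 → K} (h : den p ε v w ≠ 0) :
    LinearIndependent K ![v, w] := by
  rw [LinearIndependent.pair_iff]
  have hl := (wedge_ne_zero_iff _ _ _ _).1 h
  rw [Fintype.linearIndependent_iff] at hl
  intro s t hst
  have := hl ![s, t, 0, 0] (by simp [Fin.sum_univ_four, hst])
  exact ⟨this 0, this 1⟩

/-- The extra factor `den` makes the relation true for all pairs of vectors, also outside `U`, so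
that it can be read as an identity of polynomials and the factor cancelled there. -/
theorem aeval_mul_den_mul_den {p : ℕ} {ε : ℤ} {F G : MvPolynomial PIdx k}
    (h : IsExpression k K p ε F G) (v w : Fin 4 → K) :
    den p ε v w * (MvPolynomial.aeval (plucker v w) F * den p ε v w -
      num p ε v w * MvPolynomial.aeval (plucker v w) G) = 0 := by
  by_cases hd : den p ε v w = 0
  · rw [hd, zero_mul]
  · have hs := spans_planeOf (linearIndependent_of_den_ne_zero hd)
    have hU := (inU_iff hs).2 hd
    rw [h.2 _ hU v w hs, ← cU_mul_den hU hs]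
    ring

section Generic

variable (K)

/-- The first of two generic vectors. -/
def genV (i : Fin 4) : MvPolynomial (Fin 4 ⊕ Fin 4) K := MvPolynomial.X (Sum.inl i)

/-- The second of two generic vectors. -/
def genW (i : Fin 4) : MvPolynomial (Fin 4 ⊕ Fin 4) K := MvPolynomial.X (Sum.inr i)

variable {K} {S : Type*} [CommRing S] [Algebra K S] (V W : Fin 4 → S)

theorem aeval_genV : (fun i => MvPolynomial.aeval (Sum.elim V W) (genV K i)) = V := by
  funext i
  simp [genV]

theorem aeval_genW : (fun i => MvPolynomial.aeval (Sum.elim V W) (genW K i)) = W := by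
  funext i
  simp [genW]

theorem aeval_minor_gen (H : MvPolynomial PIdx K) :
    MvPolynomial.aeval (Sum.elim V W)
      (MvPolynomial.aeval (fun ij : PIdx => minor (genV K) (genW K) ij.1.1 ij.1.2) H) =
      MvPolynomial.aeval (fun ij : PIdx => minor V W ij.1.1 ij.1.2) H := by
  rw [MvPolynomial.comp_aeval_apply]
  congr 2
  funext ij
  simp [minor, genV, genW]

theorem aeval_denMinor_gen (e q : K) :
    MvPolynomial.aeval (Sum.elim V W)
      (denMinor (algebraMap K _ e) (algebraMap K _ q) (genV K) (genW K)) =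
      denMinor (algebraMap K S e) (algebraMap K S q) V W := by
  have h := denMinor_map (MvPolynomial.aeval (R := K) (Sum.elim V W)).toRingHom
    (algebraMap K _ e) (algebraMap K _ q) (genV K) (genW K)
  rwa [AlgHom.toRingHom_eq_coe, RingHom.coe_coe, AlgHom.commutes, AlgHom.commutes, aeval_genV,
    aeval_genW, eq_comm] at h

theorem aeval_numMinor_gen (e q : K) :
    MvPolynomial.aeval (Sum.elim V W)
      (numMinor (algebraMap K _ e) (algebraMap K _ q) (genV K) (genW K)) =
      numMinor (algebraMap K S e) (algebraMap K S q) V W := by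
  have h := numMinor_map (MvPolynomial.aeval (R := K) (Sum.elim V W)).toRingHom
    (algebraMap K _ e) (algebraMap K _ q) (genV K) (genW K)
  rwa [AlgHom.toRingHom_eq_coe, RingHom.coe_coe, AlgHom.commutes, AlgHom.commutes, aeval_genV,
    aeval_genW, eq_comm] at h

end Generic

/-- The relation between any two expressions of `c`, as a polynomial identity. -/
theorem IsExpression.aeval_mul_eq [Infinite K] {p : ℕ} {ε : ℤ}
    {F G : MvPolynomial PIdx k} (h : IsExpression k K p ε F G) {S : Type*} [CommRing S]
    [Algebra K S] (V W : Fin 4 → S) :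
    MvPolynomial.aeval (fun ij : PIdx => minor V W ij.1.1 ij.1.2)
        (MvPolynomial.map (algebraMap k K) F) *
      denMinor (algebraMap K S ((ε : K) * p)) (algebraMap K S ((p : K) ^ 2)) V W =
    numMinor (algebraMap K S ((ε : K) * p)) (algebraMap K S ((p : K) ^ 2)) V W *
      MvPolynomial.aeval (fun ij : PIdx => minor V W ij.1.1 ij.1.2)
        (MvPolynomial.map (algebraMap k K) G) := by
  set T : MvPolynomial PIdx k → MvPolynomial (Fin 4 ⊕ Fin 4) K := fun H =>
    MvPolynomial.aeval (fun ij : PIdx => minor (genV K) (genW K) ij.1.1 ij.1.2)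
      (MvPolynomial.map (algebraMap k K) H) with hT
  set D := denMinor (algebraMap K (MvPolynomial (Fin 4 ⊕ Fin 4) K) ((ε : K) * p))
    (algebraMap K _ ((p : K) ^ 2)) (genV K) (genW K) with hD
  set N := numMinor (algebraMap K (MvPolynomial (Fin 4 ⊕ Fin 4) K) ((ε : K) * p))
    (algebraMap K _ ((p : K) ^ 2)) (genV K) (genW K) with hN
  have h0 : D * (T F * D - N * T G) = 0 := by
    refine MvPolynomial.funext fun x => ?_
    have hx : x = Sum.elim (x ∘ Sum.inl) (x ∘ Sum.inr) := (Sum.elim_comp_inl_inr x).symm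
    rw [hx, ← MvPolynomial.coe_aeval_eq_eval]
    rw [RingHom.coe_coe, map_mul, map_sub, map_mul, map_mul, hD, hN, aeval_denMinor_gen,
      aeval_numMinor_gen, hT, aeval_minor_gen, aeval_minor_gen, map_zero, Algebra.algebraMap_self,
      RingHom.id_apply, RingHom.id_apply, ← den_eq_denMinor, ← num_eq_numMinor,
      MvPolynomial.aeval_map_algebraMap, MvPolynomial.aeval_map_algebraMap]
    exact aeval_mul_den_mul_den h _ _
  -- At the plane `⟨1, φ² 1⟩` the denominator is `-1`.
  have hD0 : D ≠ 0 := by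
    intro hz
    have h1 := aeval_denMinor_gen (S := K) unitVec ![0, 0, 1, 0] ((ε : K) * p) ((p : K) ^ 2)
    rw [← hD, hz, map_zero, Algebra.algebraMap_self, RingHom.id_apply, RingHom.id_apply,
      ← den_eq_denMinor, den_unitVec] at h1
    simp at h1
  have h1 := sub_eq_zero.1 ((mul_eq_zero.1 h0).resolve_left hD0)
  have h2 := congrArg (MvPolynomial.aeval (Sum.elim V W)) h1
  rwa [map_mul, map_mul, hT, aeval_minor_gen, aeval_minor_gen, hD, hN, aeval_denMinor_gen,
    aeval_numMinor_gen] at h2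

/-- If `a²` is a root of `X² + εpX + p²` and `b = p / a`, then `b²` is the other root, and the sign
of `b` is fixed by `a b = p`. The discriminant `(ε² - 4) p²` is nonzero. -/
theorem exists_eigenvalues (L : Type*) [Field L] [IsAlgClosed L] [CharZero L] {p : ℕ} (hp : p ≠ 0)
    {ε : ℤ} (hε : ε = 0 ∨ ε = 1 ∨ ε = -1) :
    ∃ a b : L, a * b = p ∧ -(a ^ 2 + b ^ 2) = (ε : L) * p ∧ (eigMat a b).det ≠ 0 := by
  have hp' : (p : L) ≠ 0 := Nat.cast_ne_zero.2 hp
  obtain ⟨r, hr⟩ := IsAlgClosed.exists_pow_nat_eq (((ε : L) * p) ^ 2 - 4 * (p : L) ^ 2)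
    (n := 2) (by norm_num)
  obtain ⟨a, ha⟩ := IsAlgClosed.exists_pow_nat_eq ((-((ε : L) * p) + r) / 2) (n := 2) (by norm_num)
  have hq : (a ^ 2) ^ 2 + (ε : L) * p * a ^ 2 + (p : L) ^ 2 = 0 := by
    rw [ha]
    field_simp
    linear_combination hr
  have ha0 : a ≠ 0 := by
    rintro rfl
    apply hp'
    simpa using hq
  have hab : a * (p / a) = p := mul_div_cancel₀ _ ha0
  have hs : -(a ^ 2 + (p / a) ^ 2) = (ε : L) * p := by
    field_simp
    linear_combination -hq
  refine ⟨a, p / a, hab, hs, ?_⟩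
  rw [det_eigMat, hab]
  refine mul_ne_zero (mul_ne_zero (by norm_num) hp') ?_
  have h4 : (a ^ 2 - (p / a) ^ 2) ^ 2 = ((ε : L) ^ 2 - 4) * (p : L) ^ 2 := by
    have : (a ^ 2 - (p / a) ^ 2) ^ 2 = (-(a ^ 2 + (p / a) ^ 2)) ^ 2 - 4 * (a * (p / a)) ^ 2 := by
      ring
    rw [this, hs, hab]
    ring
  rw [h4]
  refine mul_ne_zero ?_ (pow_ne_zero 2 hp')
  rcases hε with rfl | rfl | rfl <;> norm_num

theorem eigMat_map {R S : Type*} [CommRing R] [CommRing S] (f : R →+* S) (a b : R) :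
    eigMat (f a) (f b) = (eigMat a b).map f := by
  ext i j
  simp only [eigMat, Matrix.vandermonde_apply, Matrix.map_apply, map_pow]
  congr 1
  fin_cases i <;> simp

theorem sub_sq_ne_zero_of_det {L : Type*} [Field L] {a b : L} (h : (eigMat a b).det ≠ 0) :
    2 * (a * b) ≠ 0 ∧ 4 * (a * b) ^ 2 - (a ^ 2 + b ^ 2) ^ 2 ≠ 0 := by
  rw [det_eigMat] at h
  constructor
  · intro h0
    exact h (by linear_combination 2 * (a ^ 2 - b ^ 2) ^ 2 * h0)
  · intro h0
    exact h (by linear_combination -4 * (a * b) * h0)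

theorem prod_eq_zero_of_num_den {L : Type*} [Field L] {a b : L} (h : (eigMat a b).det ≠ 0)
    {v w : Fin 4 → L} (hd : denMinor (-(a ^ 2 + b ^ 2)) ((a * b) ^ 2) v w = 0)
    (hn : numMinor (-(a ^ 2 + b ^ 2)) ((a * b) ^ 2) v w = 0) :
    prodA ((eigMat a b).mulVec v) ((eigMat a b).mulVec w) = 0 ∧
      prodB ((eigMat a b).mulVec v) ((eigMat a b).mulVec w) = 0 := by
  have h1 := det_mul_denMinor a b v w
  have h2 := det_mul_numMinor a b v w
  rw [hd, mul_zero] at h1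
  rw [hn, mul_zero] at h2
  obtain ⟨h3, h4⟩ := sub_sq_ne_zero_of_det h
  have hA : prodA ((eigMat a b).mulVec v) ((eigMat a b).mulVec w) = 0 := by
    refine (mul_eq_zero.1 ?_).resolve_left h4
    linear_combination h2 - (a ^ 2 + b ^ 2) * h1
  refine ⟨hA, (mul_eq_zero.1 ?_).resolve_left (mul_ne_zero h3 (left_ne_zero_of_mul h3))⟩
  rw [hA] at h1
  linear_combination h1

/-- At a common zero of `num` and `den`, the values of the numerator and denominator of `c` along
suitable curves can be prescribed to second order. -/
theorem exists_curve_num_den {L : Type*} [Field L] {a b : L} (h : (eigMat a b).det ≠ 0)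
    {v w : Fin 4 → L} (hm : ∃ i j, minor v w i j ≠ 0)
    (hd : denMinor (-(a ^ 2 + b ^ 2)) ((a * b) ^ 2) v w = 0)
    (hn : numMinor (-(a ^ 2 + b ^ 2)) ((a * b) ^ 2) v w = 0) (n d : L) :
    ∃ V W : Fin 4 → L[X], (∀ i j, (minor V W i j).eval 0 = minor v w i j) ∧
      numMinor (Polynomial.C (-(a ^ 2 + b ^ 2))) (Polynomial.C ((a * b) ^ 2)) V W =
        Polynomial.C n * Polynomial.X ^ 2 ∧
      denMinor (Polynomial.C (-(a ^ 2 + b ^ 2))) (Polynomial.C ((a * b) ^ 2)) V W =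
        Polynomial.C d * Polynomial.X ^ 2 := by
  set E := eigMat a b with hE
  obtain ⟨hA, hB⟩ := prod_eq_zero_of_num_den h hd hn
  obtain ⟨h3, h4⟩ := sub_sq_ne_zero_of_det h
  have hu : IsUnit E.det := h.isUnit
  have hinv : ∀ x : Fin 4 → L, E⁻¹.mulVec (E.mulVec x) = x := fun x => by
    rw [Matrix.mulVec_mulVec, Matrix.nonsing_inv_mul _ hu, Matrix.one_mulVec]
  have hm' : ∃ i j, minor (E.mulVec v) (E.mulVec w) i j ≠ 0 := by
    by_contra! h0
    obtain ⟨i, j, hij⟩ := hm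
    apply hij
    rw [← hinv v, ← hinv w, minor_mulVec]
    simp [h0]
  -- The leading coefficients of `prodA` and `prodB` that correspond to `n` and `d` under the linear
  -- system relating them to `num` and `den`.
  obtain ⟨κ, hκ⟩ : ∃ κ, (4 * (a * b) ^ 2 - (a ^ 2 + b ^ 2) ^ 2) * κ =
      (a ^ 2 + b ^ 2) * (E.det * d) - E.det * n := ⟨_, mul_div_cancel₀ _ h4⟩
  obtain ⟨μ, hμ⟩ : ∃ μ, 2 * (a * b) * 2 * μ =
      2 * (a * b) * κ - (a ^ 2 + b ^ 2) * κ - E.det * d :=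
    ⟨_, mul_div_cancel₀ _ (mul_ne_zero h3 (left_ne_zero_of_mul h3))⟩
  obtain ⟨V, W, h0, hVA, hVB⟩ := exists_curve hm' hA hB κ μ
  have hC : eigMat (Polynomial.C a) (Polynomial.C b) = E.map Polynomial.C :=
    eigMat_map Polynomial.C a b
  have hEi : ∀ x : Fin 4 → L[X], (eigMat (Polynomial.C a) (Polynomial.C b)).mulVec
      ((E⁻¹.map Polynomial.C).mulVec x) = x := fun x => by
    rw [Matrix.mulVec_mulVec, hC, ← Matrix.map_mul, Matrix.mul_nonsing_inv _ hu,
      Matrix.map_one _ (map_zero _) (map_one _), Matrix.one_mulVec]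
  have hdet : (eigMat (Polynomial.C a) (Polynomial.C b)).det = Polynomial.C E.det := by
    rw [hC]
    exact (RingHom.map_det Polynomial.C E).symm
  have hdet0 : Polynomial.C E.det ≠ 0 := Polynomial.C_ne_zero.2 h
  refine ⟨(E⁻¹.map Polynomial.C).mulVec V, (E⁻¹.map Polynomial.C).mulVec W, fun i j => ?_, ?_, ?_⟩
  · have h5 : minor v w i j = ∑ a, ∑ b, E⁻¹ i a * E⁻¹ j b *
        minor (E.mulVec v) (E.mulVec w) a b := by
      rw [← minor_mulVec, hinv, hinv]
    rw [minor_mulVec, h5]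
    simp only [Polynomial.eval_finsetSum, Polynomial.eval_mul, Matrix.map_apply, Polynomial.eval_C,
      h0]
  · have h1 := det_mul_numMinor (Polynomial.C a) (Polynomial.C b)
      ((E⁻¹.map Polynomial.C).mulVec V) ((E⁻¹.map Polynomial.C).mulVec W)
    rw [hEi, hEi, hVA, hVB, hdet] at h1
    apply mul_left_cancel₀ hdet0
    simp only [map_neg, map_add, map_pow, map_mul]
    rw [h1]
    have h2 := congrArg Polynomial.C hκ
    have h5 := congrArg Polynomial.C hμ
    simp only [map_sub, map_add, map_pow, map_mul, map_ofNat] at h2 h5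
    linear_combination (-Polynomial.X ^ 2) * h2 -
      (Polynomial.C a ^ 2 + Polynomial.C b ^ 2) * Polynomial.X ^ 2 * h5
  · have h1 := det_mul_denMinor (Polynomial.C a) (Polynomial.C b)
      ((E⁻¹.map Polynomial.C).mulVec V) ((E⁻¹.map Polynomial.C).mulVec W)
    rw [hEi, hEi, hVA, hVB, hdet] at h1
    apply mul_left_cancel₀ hdet0
    simp only [map_neg, map_add, map_pow, map_mul]
    rw [h1]
    have h5 := congrArg Polynomial.C hμ
    simp only [map_sub, map_add, map_pow, map_mul, map_ofNat] at h5
    linear_combination (-Polynomial.X ^ 2) * h5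

theorem exists_minor_ne_zero {v w : Fin 4 → K} (h : LinearIndependent K ![v, w]) :
    ∃ i j, minor v w i j ≠ 0 := by
  by_contra! h0
  rw [LinearIndependent.pair_iff] at h
  have hw : ∀ i, w i = 0 := fun i =>
    (h (w i) (-v i) (by
      funext j
      have := h0 i j
      simp only [minor, Pi.add_apply, Pi.smul_apply, smul_eq_mul, Pi.zero_apply] at this ⊢
      linear_combination -this)).1
  exact one_ne_zero (h 0 1 (by funext j; simp [hw])).2

/-- Along a curve through the point with `num = 0` and `den = X²`, the relation `F · den = num · G`
becomes `F X² = 0`, so `F` vanishes along the curve and at the point. The roles are exchanged for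
`G`. The curves live over the algebraic closure, where the eigenvalues of `φ` exist. -/
theorem IsExpression.aeval_eq_zero [CharZero K] {p : ℕ} (hp : p ≠ 0) {ε : ℤ}
    (hε : ε = 0 ∨ ε = 1 ∨ ε = -1) {F G : MvPolynomial PIdx k} (h : IsExpression k K p ε F G)
    {v w : Fin 4 → K} (hvw : LinearIndependent K ![v, w]) (hn : num p ε v w = 0)
    (hd : den p ε v w = 0) :
    MvPolynomial.aeval (plucker v w) F = 0 ∧ MvPolynomial.aeval (plucker v w) G = 0 := by
  have hchar : CharZero (AlgebraicClosure K) :=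
    charZero_of_injective_algebraMap (algebraMap K (AlgebraicClosure K)).injective
  obtain ⟨a, b, hab, hs, hdet⟩ := exists_eigenvalues (AlgebraicClosure K) hp hε
  set f := algebraMap K (AlgebraicClosure K) with hf
  have he : f ((ε : K) * p) = -(a ^ 2 + b ^ 2) := by rw [hs]; simp
  have hq : f ((p : K) ^ 2) = (a * b) ^ 2 := by rw [hab]; simp
  rw [num_eq_numMinor] at hn
  rw [den_eq_denMinor] at hd
  have hn' : numMinor (-(a ^ 2 + b ^ 2)) ((a * b) ^ 2) (fun i => f (v i)) (fun i => f (w i)) = 0 := by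
    rw [← he, ← hq, numMinor_map, hn, map_zero]
  have hd' : denMinor (-(a ^ 2 + b ^ 2)) ((a * b) ^ 2) (fun i => f (v i)) (fun i => f (w i)) = 0 := by
    rw [← he, ← hq, denMinor_map, hd, map_zero]
  have hm : ∃ i j, minor (fun i => f (v i)) (fun i => f (w i)) i j ≠ 0 := by
    obtain ⟨i, j, hij⟩ := exists_minor_ne_zero hvw
    exact ⟨i, j, by rw [minor_map]; exact (map_ne_zero f).2 hij⟩
  have hev : ∀ (V W : Fin 4 → (AlgebraicClosure K)[X]),
      (∀ i j, (minor V W i j).eval 0 = minor (fun i => f (v i)) (fun i => f (w i)) i j) →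
      ∀ H : MvPolynomial PIdx k, MvPolynomial.aeval (fun ij : PIdx => minor V W ij.1.1 ij.1.2)
        (MvPolynomial.map (algebraMap k K) H) = 0 → MvPolynomial.aeval (plucker v w) H = 0 := by
    intro V W hVW H hH
    have h1 := congrArg ((Polynomial.aeval (0 : AlgebraicClosure K)).restrictScalars K) hH
    rw [map_zero, MvPolynomial.comp_aeval_apply] at h1
    have h2 : (fun ij : PIdx => ((Polynomial.aeval (0 : AlgebraicClosure K)).restrictScalars K)
        (minor V W ij.1.1 ij.1.2)) = f ∘ plucker v w := by
      funext ij
      rw [AlgHom.restrictScalars_apply, Polynomial.coe_aeval_eq_eval, hVW, minor_map]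
      rfl
    rw [h2, MvPolynomial.aeval_algebraMap_apply, MvPolynomial.aeval_map_algebraMap] at h1
    exact (map_eq_zero f).1 h1
  have halg : ∀ x : K, algebraMap K (AlgebraicClosure K)[X] x = Polynomial.C (f x) := fun x => rfl
  constructor
  · obtain ⟨V, W, h0, h1, h2⟩ := exists_curve_num_den hdet hm hd' hn' 0 1
    have h3 := h.aeval_mul_eq V W
    rw [halg, halg, he, hq, h1, h2, map_zero, zero_mul, zero_mul, map_one, one_mul] at h3
    exact hev V W h0 F ((mul_eq_zero.1 h3).resolve_right (pow_ne_zero 2 Polynomial.X_ne_zero))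
  · obtain ⟨V, W, h0, h1, h2⟩ := exists_curve_num_den hdet hm hd' hn' 1 0
    have h3 := h.aeval_mul_eq V W
    rw [halg, halg, he, hq, h1, h2, map_zero, zero_mul, mul_zero, map_one, one_mul] at h3
    exact hev V W h0 G ((mul_eq_zero.1 h3.symm).resolve_left (pow_ne_zero 2 Polynomial.X_ne_zero))

/-- The domain of definition of `c` is the complement of the common zeros of `num` and `den`. -/
theorem mem_Ydf_iff (k : Type*) [Field k] [Algebra k K] [CharZero K] {p : ℕ} (hp : p ≠ 0) {ε : ℤ}
    (hε : ε = 0 ∨ ε = 1 ∨ ε = -1) {P : Gr K} {v w : Fin 4 → K} (h : Spans P v w) :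
    P ∈ Ydf k K p ε ↔ ¬ (num p ε v w = 0 ∧ den p ε v w = 0) := by
  constructor
  · rintro ⟨F, G, hFG, v', w', h', hne⟩ ⟨hn, hd⟩
    obtain ⟨t, ht, hm⟩ := h.exists_smul h'
    obtain ⟨h1, h2⟩ := hFG.aeval_eq_zero hp hε h'.linearIndependent
      (by rw [num_eq_of_minors hm, hn, mul_zero]) (by rw [den_eq_of_minors hm, hd, mul_zero])
    exact hne (by simp [evalPair, h1, h2])
  · intro hne
    refine ⟨_, _, isExpression_num_den k p ε, v, w, h, fun h0 => hne ?_⟩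
    rw [evalPair, aeval_numPoly, aeval_denPoly] at h0
    exact ⟨congrFun h0 0, congrFun h0 1⟩

/-- The pair `(num, den)`. -/
def numDen (p : ℕ) (ε : ℤ) (v w : Fin 4 → K) : Fin 2 → K := ![num p ε v w, den p ε v w]

theorem numDen_ne_zero_iff {p : ℕ} {ε : ℤ} {v w : Fin 4 → K} :
    numDen p ε v w ≠ 0 ↔ ¬ (num p ε v w = 0 ∧ den p ε v w = 0) := by
  rw [not_iff_not]
  exact ⟨fun h => ⟨congrFun h 0, congrFun h 1⟩, fun h => by simp [numDen, h.1, h.2]⟩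

theorem numDen_ne_zero [CharZero K] {p : ℕ} (hp : p ≠ 0) {ε : ℤ} (hε : ε = 0 ∨ ε = 1 ∨ ε = -1)
    {P : Gr K} (hP : P ∈ Ydf k K p ε) {v w : Fin 4 → K} (h : Spans P v w) :
    numDen p ε v w ≠ 0 :=
  numDen_ne_zero_iff.2 ((mem_Ydf_iff k hp hε h).1 hP)

theorem mk_eq_mk_of_mul_eq {x y : Fin 2 → K} (hx : x ≠ 0) (hy : y ≠ 0)
    (h : x 0 * y 1 = y 0 * x 1) : Projectivization.mk K x hx = Projectivization.mk K y hy := by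
  rw [Projectivization.mk_eq_mk_iff']
  by_cases h1 : y 1 = 0
  · have hy0 : y 0 ≠ 0 := fun h0 => hy (by funext i; fin_cases i <;> assumption)
    have hx1 : x 1 = 0 := by
      rw [h1, mul_zero, eq_comm] at h
      exact (mul_eq_zero.1 h).resolve_left hy0
    refine ⟨x 0 / y 0, ?_⟩
    funext i
    fin_cases i
    · exact div_mul_cancel₀ _ hy0
    · simp [h1, hx1]
  · refine ⟨x 1 / y 1, ?_⟩
    funext i
    fin_cases i
    · simp only [Fin.zero_eta, Pi.smul_apply, smul_eq_mul]
      field_simp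
      linear_combination -h
    · exact div_mul_cancel₀ _ h1

theorem mul_eq_of_mk_eq_mk {x y : Fin 2 → K} (hx : x ≠ 0) (hy : y ≠ 0)
    (h : Projectivization.mk K x hx = Projectivization.mk K y hy) : x 0 * y 1 = y 0 * x 1 := by
  obtain ⟨a, rfl⟩ := (Projectivization.mk_eq_mk_iff' _ _ _ _ _).1 h
  simp only [Pi.smul_apply, smul_eq_mul]
  ring

/-- The morphism `c` on `K`-points. -/
theorem exists_isExtension (k : Type*) [Field k] [Algebra k K] [CharZero K] {p : ℕ} (hp : p ≠ 0)
    {ε : ℤ} (hε : ε = 0 ∨ ε = 1 ∨ ε = -1) :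
    ∃ c : Ydf k K p ε → ℙ K (Fin 2 → K), IsExtension k p ε c ∧
      ∀ (P : Ydf k K p ε) (v w : Fin 4 → K) (h : Spans P.1 v w),
        c P = Projectivization.mk K (numDen p ε v w) (numDen_ne_zero hp hε P.2 h) := by
  choose v w hvw using fun P : Ydf k K p ε => exists_spans P.1
  have key : ∀ (P : Ydf k K p ε) (v' w' : Fin 4 → K) (h : Spans P.1 v' w'),
      Projectivization.mk K (numDen p ε (v P) (w P)) (numDen_ne_zero hp hε P.2 (hvw P)) =
        Projectivization.mk K (numDen p ε v' w') (numDen_ne_zero hp hε P.2 h) := by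
    intro P v' w' h
    obtain ⟨t, -, hm⟩ := (hvw P).exists_smul h
    refine mk_eq_mk_of_mul_eq _ _ ?_
    simp only [numDen, Matrix.cons_val_zero, Matrix.cons_val_one, num_eq_of_minors hm,
      den_eq_of_minors hm]
    ring
  refine ⟨fun P => Projectivization.mk K (numDen p ε (v P) (w P))
    (numDen_ne_zero hp hε P.2 (hvw P)), ⟨?_, ?_⟩, key⟩
  · intro P hU
    obtain ⟨v', w', h⟩ := exists_spans P
    have hP : P ∈ Ydf k K p ε := (mem_Ydf_iff k hp hε h).2 fun h0 => (inU_iff h).1 hU h0.2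
    refine ⟨hP, (key ⟨P, hP⟩ v' w' h).trans (mk_eq_mk_of_mul_eq _ _ ?_)⟩
    simp [numDen, cU_mul_den hU h]
  · intro F G hFG P v' w' h hne
    refine (key P v' w' h).trans (mk_eq_mk_of_mul_eq _ _ ?_)
    have h1 := hFG.aeval_mul_eq v' w'
    rw [Algebra.algebraMap_self, RingHom.id_apply, RingHom.id_apply, ← den_eq_denMinor,
      ← num_eq_numMinor, MvPolynomial.aeval_map_algebraMap, MvPolynomial.aeval_map_algebraMap] at h1
    exact h1.symm

end Expressions

/-! ### Gluing morphisms between `Proj` schemes -/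

section ProjGlue

open AlgebraicGeometry CategoryTheory HomogeneousLocalization

universe u

variable {A B σ τ : Type u} [CommRing A] [SetLike σ A] [AddSubgroupClass σ A]
  [CommRing B] [SetLike τ B] [AddSubgroupClass τ B]
  (𝒜 : ℕ → σ) (ℬ : ℕ → τ) [GradedRing 𝒜] [GradedRing ℬ]

/-- A family of ring homomorphisms between the rings of standard open sets, compatible with the
restriction to intersections, glues to a morphism of `Proj`. -/
theorem exists_projHom {ι : Type u} (f : ι → A) {m : ι → ℕ} (hf : ∀ i, f i ∈ 𝒜 (m i))
    (hm : ∀ i, 0 < m i)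
    (hspan : (HomogeneousIdeal.irrelevant 𝒜).toIdeal ≤ Ideal.span (Set.range f))
    (g : ι → B) {n : ι → ℕ} (hg : ∀ i, g i ∈ ℬ (n i)) (hn : ∀ i, 0 < n i)
    (θ : ∀ i, Away ℬ (g i) →+* Away 𝒜 (f i))
    (θ₂ : ∀ i j, Away ℬ (g i * g j) →+* Away 𝒜 (f i * f j))
    (h1 : ∀ i j, (θ₂ i j).comp (awayMap ℬ (hg j) rfl) = (awayMap 𝒜 (hf j) rfl).comp (θ i))
    (h2 : ∀ i j, (θ₂ i j).comp (awayMap ℬ (hg i) (mul_comm _ _)) =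
      (awayMap 𝒜 (hf i) (mul_comm _ _)).comp (θ j)) :
    ∃ e : Proj 𝒜 ⟶ Proj ℬ, ∀ i, Proj.awayι 𝒜 (f i) (hf i) (hm i) ≫ e =
      Spec.map (CommRingCat.ofHom (θ i)) ≫ Proj.awayι ℬ (g i) (hg i) (hn i) := by
  let 𝒰 := (Proj.affineOpenCoverOfIrrelevantLESpan 𝒜 f hf hm hspan).openCover
  have key : ∀ i j : ι,
      Limits.pullback.fst (Proj.awayι 𝒜 (f i) (hf i) (hm i)) (Proj.awayι 𝒜 (f j) (hf j) (hm j)) ≫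
        Spec.map (CommRingCat.ofHom (θ i)) ≫ Proj.awayι ℬ (g i) (hg i) (hn i) =
      Limits.pullback.snd (Proj.awayι 𝒜 (f i) (hf i) (hm i)) (Proj.awayι 𝒜 (f j) (hf j) (hm j)) ≫
        Spec.map (CommRingCat.ofHom (θ j)) ≫ Proj.awayι ℬ (g j) (hg j) (hn j) := by
    intro i j
    refine (cancel_epi (Proj.pullbackAwayιIso 𝒜 (hf i) (hm i) (hf j) (hm j) rfl).inv).1 ?_
    rw [Proj.pullbackAwayιIso_inv_fst_assoc, Proj.pullbackAwayιIso_inv_snd_assoc,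
      ← Spec.map_comp_assoc, ← Spec.map_comp_assoc, ← CommRingCat.ofHom_comp,
      ← CommRingCat.ofHom_comp, ← h1, ← h2, CommRingCat.ofHom_comp, CommRingCat.ofHom_comp,
      Spec.map_comp_assoc, Spec.map_comp_assoc, Proj.SpecMap_awayMap_awayι,
      Proj.SpecMap_awayMap_awayι]
    rfl
  exact ⟨𝒰.glueMorphisms (fun i => Spec.map (CommRingCat.ofHom (θ i)) ≫
    Proj.awayι ℬ (g i) (hg i) (hn i)) key, fun i => 𝒰.ι_glueMorphisms _ _ i⟩

theorem projHom_ext {ι : Type u} (f : ι → A) {m : ι → ℕ} (hf : ∀ i, f i ∈ 𝒜 (m i))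
    (hm : ∀ i, 0 < m i)
    (hspan : (HomogeneousIdeal.irrelevant 𝒜).toIdeal ≤ Ideal.span (Set.range f))
    {X : Scheme.{u}} {e e' : Proj 𝒜 ⟶ X}
    (h : ∀ i, Proj.awayι 𝒜 (f i) (hf i) (hm i) ≫ e = Proj.awayι 𝒜 (f i) (hf i) (hm i) ≫ e') :
    e = e' :=
  (Proj.affineOpenCoverOfIrrelevantLESpan 𝒜 f hf hm hspan).openCover.hom_ext _ _ h

end ProjGlue

/-! ### `Proj` under a ring isomorphism that multiplies degrees -/

section Dilation

open AlgebraicGeometry CategoryTheory HomogeneousLocalization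

universe u

/-- Two rings that embed with the same range are isomorphic. -/
def ringEquivOfRangeEq {R R' L : Type*} [CommRing R] [CommRing R'] [CommRing L] (i : R →+* L)
    (j : R' →+* L) (hi : Function.Injective i) (hj : Function.Injective j)
    (h : i.range = j.range) : R ≃+* R' :=
  (RingEquiv.ofBijective i.rangeRestrict
    ⟨fun _ _ hxy => hi (congrArg Subtype.val hxy), i.rangeRestrict_surjective⟩).trans
  ((RingEquiv.subringCongr h).trans (RingEquiv.ofBijective j.rangeRestrict
    ⟨fun _ _ hxy => hj (congrArg Subtype.val hxy), j.rangeRestrict_surjective⟩).symm)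

theorem ringEquivOfRangeEq_apply {R R' L : Type*} [CommRing R] [CommRing R'] [CommRing L]
    (i : R →+* L) (j : R' →+* L) (hi : Function.Injective i) (hj : Function.Injective j)
    (h : i.range = j.range) (x : R) : j (ringEquivOfRangeEq i j hi hj h x) = i x := by
  have := (RingEquiv.ofBijective j.rangeRestrict
    ⟨fun _ _ hxy => hj (congrArg Subtype.val hxy), j.rangeRestrict_surjective⟩).apply_symm_apply
    (RingEquiv.subringCongr h (i.rangeRestrict x))
  exact congrArg Subtype.val this

theorem mem_nsmul_iff {A B σ τ : Type*} [CommRing A] [SetLike σ A] [CommRing B] [SetLike τ B]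
    {𝒜 : ℕ → σ} {ℬ : ℕ → τ} (ψ : B ≃+* A) {d : ℕ} (hψ : ∀ m b, b ∈ ℬ m ↔ ψ b ∈ 𝒜 (d * m))
    {a : B} {n m : ℕ} : a ∈ ℬ (n • m) ↔ ψ a ∈ 𝒜 (n • (d * m)) := by
  rw [hψ, smul_eq_mul, smul_eq_mul, mul_left_comm]

variable {A B σ τ : Type u} [CommRing A] [SetLike σ A] [AddSubgroupClass σ A]
  [CommRing B] [SetLike τ B] [AddSubgroupClass τ B]
  {𝒜 : ℕ → σ} {ℬ : ℕ → τ} [GradedRing 𝒜] [GradedRing ℬ] (ψ : B ≃+* A) {d : ℕ}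

/-- The isomorphism of localizations induced by a ring isomorphism. -/
def locEquiv {f : B} {y : A} (hy : y = ψ f) : Localization.Away f ≃+* Localization.Away y :=
  IsLocalization.ringEquivOfRingEquiv (M := Submonoid.powers f) (T := Submonoid.powers y)
    (Localization.Away f) (Localization.Away y) ψ (by simp [hy])

theorem locEquiv_mk {f : B} {y : A} (hy : y = ψ f) (a : B) (n : ℕ) :
    locEquiv ψ hy (Localization.mk a (⟨f ^ n, n, rfl⟩ : Submonoid.powers f)) =
      Localization.mk (ψ a) (⟨y ^ n, n, rfl⟩ : Submonoid.powers y) := by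
  subst hy
  rw [locEquiv, Localization.mk_eq_mk', Localization.mk_eq_mk',
    IsLocalization.ringEquivOfRingEquiv_mk']
  congr 1
  exact Subtype.ext (map_pow ψ f n)

/-- A fraction `a / f ^ n` has degree zero exactly when `ψ a / y ^ n` does, since `ψ` multiplies the
degrees of numerator and denominator by the same `d`. -/
theorem range_locEquiv (hψ : ∀ m b, b ∈ ℬ m ↔ ψ b ∈ 𝒜 (d * m)) {f : B} {y : A} (hy : y = ψ f)
    {m : ℕ} (hf : f ∈ ℬ m) :
    ((locEquiv ψ hy).toRingHom.comp (algebraMap (Away ℬ f) (Localization.Away f))).range =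
      (algebraMap (Away 𝒜 y) (Localization.Away y)).range := by
  have hf' : y ∈ 𝒜 (d * m) := hy ▸ (hψ _ _).1 hf
  ext z
  constructor
  · rintro ⟨x, rfl⟩
    obtain ⟨n, a, ha, rfl⟩ := Away.mk_surjective ℬ hf x
    exact ⟨Away.mk 𝒜 hf' n (ψ a) ((mem_nsmul_iff ψ hψ).1 ha), (locEquiv_mk ψ hy a n).symm⟩
  · rintro ⟨x, rfl⟩
    obtain ⟨n, a, ha, rfl⟩ := Away.mk_surjective 𝒜 hf' x
    obtain ⟨b, rfl⟩ := ψ.surjective a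
    exact ⟨Away.mk ℬ hf n b ((mem_nsmul_iff ψ hψ).2 ha), locEquiv_mk ψ hy b n⟩

/-- A ring isomorphism that multiplies degrees by `d` induces isomorphisms of the degree zero
parts of localizations. -/
def awayEquiv (hψ : ∀ m b, b ∈ ℬ m ↔ ψ b ∈ 𝒜 (d * m)) {f : B} {y : A} (hy : y = ψ f) {m : ℕ}
    (hf : f ∈ ℬ m) : Away ℬ f ≃+* Away 𝒜 y :=
  ringEquivOfRangeEq _ _ ((locEquiv ψ hy).injective.comp (val_injective _)) (val_injective _)
    (range_locEquiv ψ hψ hy hf)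

theorem val_awayEquiv (hψ : ∀ m b, b ∈ ℬ m ↔ ψ b ∈ 𝒜 (d * m)) {f : B} {y : A} (hy : y = ψ f)
    {m : ℕ} (hf : f ∈ ℬ m) (x : Away ℬ f) :
    (awayEquiv ψ hψ hy hf x).val = locEquiv ψ hy x.val :=
  ringEquivOfRangeEq_apply _ _ _ _ (range_locEquiv ψ hψ hy hf) x

theorem awayEquiv_mk (hψ : ∀ m b, b ∈ ℬ m ↔ ψ b ∈ 𝒜 (d * m)) {f : B} {y : A} (hy : y = ψ f)
    {m m' : ℕ} (hf : f ∈ ℬ m) (hy' : y ∈ 𝒜 m') (n : ℕ) (a : B) (ha : a ∈ ℬ (n • m))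
    (ha' : ψ a ∈ 𝒜 (n • m')) :
    awayEquiv ψ hψ hy hf (Away.mk ℬ hf n a ha) = Away.mk 𝒜 hy' n (ψ a) ha' := by
  refine val_injective _ ?_
  rw [val_awayEquiv, Away.val_mk, Away.val_mk, locEquiv_mk]

/-- Compatibility with restriction to overlaps. The denominators `y, z` are separate variables with
equations, because gluing produces `ψ f * ψ g`, which equals `ψ (f * g)` only propositionally. -/
theorem awayEquiv_awayMap (hψ : ∀ m b, b ∈ ℬ m ↔ ψ b ∈ 𝒜 (d * m)) {f g x : B} {y z : A}
    (hy : y = ψ f) (hz : z = ψ x) {m n l : ℕ} (hf : f ∈ ℬ m) (hg : g ∈ ℬ n) (hx : x ∈ ℬ l)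
    (hxfg : x = f * g) (hg' : ψ g ∈ 𝒜 (d * n)) (hzy : z = y * ψ g) (t : Away ℬ f) :
    awayEquiv ψ hψ hz hx (awayMap ℬ hg hxfg t) =
      awayMap 𝒜 hg' hzy (awayEquiv ψ hψ hy hf t) := by
  have hy' : y ∈ 𝒜 (d * m) := hy ▸ (hψ _ _).1 hf
  obtain ⟨k, a, ha, rfl⟩ := Away.mk_surjective ℬ hf t
  refine val_injective _ ?_
  rw [awayEquiv_mk ψ hψ hy hf hy' k a ha ((mem_nsmul_iff ψ hψ).1 ha), awayMap_mk, awayMap_mk,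
    val_awayEquiv, Away.val_mk, Away.val_mk, locEquiv_mk, map_mul, map_pow]

theorem awayEquiv_fromZeroRingHom (hψ : ∀ m b, b ∈ ℬ m ↔ ψ b ∈ 𝒜 (d * m)) {f : B} {y : A}
    (hy : y = ψ f) {m : ℕ} (hf : f ∈ ℬ m) (a : ℬ 0) (a' : 𝒜 0) (ha : ψ a = a') :
    awayEquiv ψ hψ hy hf (fromZeroRingHom ℬ _ a) = fromZeroRingHom 𝒜 _ a' := by
  refine val_injective _ ?_
  rw [val_awayEquiv]
  have h1 : (fromZeroRingHom ℬ (Submonoid.powers f) a).val =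
      Localization.mk (a : B) (⟨f ^ 0, 0, rfl⟩ : Submonoid.powers f) := by
    rw [show (⟨f ^ 0, 0, rfl⟩ : Submonoid.powers f) = 1 from Subtype.ext (pow_zero f)]
    rfl
  have h2 : (fromZeroRingHom 𝒜 (Submonoid.powers y) a').val =
      Localization.mk (a' : A) (⟨y ^ 0, 0, rfl⟩ : Submonoid.powers y) := by
    rw [show (⟨y ^ 0, 0, rfl⟩ : Submonoid.powers y) = 1 from Subtype.ext (pow_zero y)]
    rfl
  rw [h1, h2, locEquiv_mk, ha]

theorem exists_projIso (hd : 0 < d) (hψ : ∀ m b, b ∈ ℬ m ↔ ψ b ∈ 𝒜 (d * m)) {ι : Type u}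
    (g : ι → B) {n : ι → ℕ} (hg : ∀ i, g i ∈ ℬ (n i)) (hn : ∀ i, 0 < n i)
    (hspan : (HomogeneousIdeal.irrelevant ℬ).toIdeal ≤ Ideal.span (Set.range g))
    (hspan' : (HomogeneousIdeal.irrelevant 𝒜).toIdeal ≤ Ideal.span (Set.range (ψ ∘ g))) :
    ∃ e : Proj 𝒜 ≅ Proj ℬ, ∀ i,
      Proj.awayι 𝒜 (ψ (g i)) ((hψ _ _).1 (hg i)) (Nat.mul_pos hd (hn i)) ≫ e.hom =
        Spec.map (CommRingCat.ofHom (awayEquiv ψ hψ rfl (hg i)).toRingHom) ≫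
          Proj.awayι ℬ (g i) (hg i) (hn i) := by
  have hg' : ∀ i, ψ (g i) ∈ 𝒜 (d * n i) := fun i => (hψ _ _).1 (hg i)
  have hn' : ∀ i, 0 < d * n i := fun i => Nat.mul_pos hd (hn i)
  have hgg : ∀ i j, g i * g j ∈ ℬ (n i + n j) := fun i j => SetLike.mul_mem_graded (hg i) (hg j)
  have hmul : ∀ i j, ψ (g i) * ψ (g j) = ψ (g i * g j) := fun i j => (map_mul ψ _ _).symm
  have c1 : ∀ i j t, awayEquiv ψ hψ (hmul i j) (hgg i j) (awayMap ℬ (hg j) rfl t) =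
      awayMap 𝒜 (hg' j) rfl (awayEquiv ψ hψ rfl (hg i) t) := fun i j t =>
    awayEquiv_awayMap ψ hψ rfl (hmul i j) (hg i) (hg j) (hgg i j) rfl (hg' j) rfl t
  have c2 : ∀ i j t, awayEquiv ψ hψ (hmul i j) (hgg i j) (awayMap ℬ (hg i) (mul_comm _ _) t) =
      awayMap 𝒜 (hg' i) (mul_comm _ _) (awayEquiv ψ hψ rfl (hg j) t) := fun i j t =>
    awayEquiv_awayMap ψ hψ rfl (hmul i j) (hg j) (hg i) (hgg i j) (mul_comm _ _) (hg' i)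
      (mul_comm _ _) t
  obtain ⟨u, hu⟩ := exists_projHom 𝒜 ℬ (fun i => ψ (g i)) hg' hn' hspan' g hg hn
    (fun i => (awayEquiv ψ hψ rfl (hg i)).toRingHom)
    (fun i j => (awayEquiv ψ hψ (hmul i j) (hgg i j)).toRingHom)
    (fun i j => RingHom.ext (c1 i j)) (fun i j => RingHom.ext (c2 i j))
  obtain ⟨w, hw⟩ := exists_projHom ℬ 𝒜 g hg hn hspan (fun i => ψ (g i)) hg' hn'
    (fun i => (awayEquiv ψ hψ rfl (hg i)).symm.toRingHom)
    (fun i j => (awayEquiv ψ hψ (hmul i j) (hgg i j)).symm.toRingHom)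
    (fun i j => RingHom.ext fun t => by
      refine (RingEquiv.symm_apply_eq (awayEquiv ψ hψ (hmul i j) (hgg i j))).2 ?_
      refine Eq.trans ?_ (c1 i j _).symm
      exact congrArg _ (RingEquiv.apply_symm_apply _ t).symm)
    (fun i j => RingHom.ext fun t => by
      refine (RingEquiv.symm_apply_eq (awayEquiv ψ hψ (hmul i j) (hgg i j))).2 ?_
      refine Eq.trans ?_ (c2 i j _).symm
      exact congrArg _ (RingEquiv.apply_symm_apply _ t).symm)
  refine ⟨⟨u, w, ?_, ?_⟩, hu⟩
  · refine projHom_ext 𝒜 _ hg' hn' hspan' fun i => ?_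
    rw [← Category.assoc, hu, Category.assoc, hw, ← Spec.map_comp_assoc, ← CommRingCat.ofHom_comp,
      RingEquiv.toRingHom_comp_symm_toRingHom, Category.comp_id]
    erw [CommRingCat.ofHom_id, Spec.map_id, Category.id_comp]
  · refine projHom_ext ℬ _ hg hn hspan fun i => ?_
    rw [← Category.assoc, hw, Category.assoc, hu, ← Spec.map_comp_assoc, ← CommRingCat.ofHom_comp,
      RingEquiv.symm_toRingHom_comp_toRingHom, Category.comp_id]
    erw [CommRingCat.ofHom_id, Spec.map_id, Category.id_comp]

/-- This determines which homogeneous elements of positive degree lie in the ideal of an image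
point; it is checked on the charts that define the morphism. -/
theorem projIso_preimage_basicOpen (hd : 0 < d) (hψ : ∀ m b, b ∈ ℬ m ↔ ψ b ∈ 𝒜 (d * m))
    {ι : Type u} (g : ι → B) {n : ι → ℕ} (hg : ∀ i, g i ∈ ℬ (n i)) (hn : ∀ i, 0 < n i)
    (hspan' : (HomogeneousIdeal.irrelevant 𝒜).toIdeal ≤ Ideal.span (Set.range (ψ ∘ g)))
    (e : Proj 𝒜 ⟶ Proj ℬ) (he : ∀ i,
      Proj.awayι 𝒜 (ψ (g i)) ((hψ _ _).1 (hg i)) (Nat.mul_pos hd (hn i)) ≫ e =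
        Spec.map (CommRingCat.ofHom (awayEquiv ψ hψ rfl (hg i)).toRingHom) ≫
          Proj.awayι ℬ (g i) (hg i) (hn i)) {r : B} {m : ℕ} (hm : 0 < m) (hr : r ∈ ℬ m)
    (x : Proj 𝒜) : e x ∈ Proj.basicOpen ℬ r ↔ x ∈ Proj.basicOpen 𝒜 (ψ r) := by
  have hx := (Proj.iSup_basicOpen_eq_top 𝒜 (ψ ∘ g) hspan').ge (Set.mem_univ x)
  obtain ⟨i, hi⟩ := TopologicalSpace.Opens.mem_iSup.1 hx
  have hgi := (hψ _ _).1 (hg i)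
  have hni := Nat.mul_pos hd (hn i)
  rw [Function.comp_apply, ← Proj.opensRange_awayι 𝒜 (ψ (g i)) hgi hni] at hi
  obtain ⟨y, rfl⟩ := hi
  have h1 : (Proj.awayι 𝒜 (ψ (g i)) hgi hni ≫ e) y ∈ Proj.basicOpen ℬ r ↔
      Proj.awayι 𝒜 (ψ (g i)) hgi hni y ∈ Proj.basicOpen 𝒜 (ψ r) := by
    rw [he i]
    have h2 := Proj.awayι_preimage_basicOpen ℬ (hg i) (hn i) hr hm
    have h3 := Proj.awayι_preimage_basicOpen 𝒜 hgi hni ((hψ _ _).1 hr) (Nat.mul_pos hd hm)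
    have h4 : ∀ z, Proj.awayι ℬ (g i) (hg i) (hn i) z ∈ Proj.basicOpen ℬ r ↔
        z ∈ PrimeSpectrum.basicOpen (Away.isLocalizationElem (hg i) hr) := fun z => by
      rw [← h2]; rfl
    have h5 : ∀ z, Proj.awayι 𝒜 (ψ (g i)) hgi hni z ∈ Proj.basicOpen 𝒜 (ψ r) ↔
        z ∈ PrimeSpectrum.basicOpen (Away.isLocalizationElem hgi ((hψ _ _).1 hr)) := fun z => by
      rw [← h3]; rfl
    -- The element `r ^ deg g / g ^ deg r` is formed with exponents `d` times larger on the other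
    -- side, hence the `d`-th power; basic opens do not see it, as `d > 0`.
    have h6 : Away.isLocalizationElem hgi ((hψ _ _).1 hr) =
        (awayEquiv ψ hψ rfl (hg i) (Away.isLocalizationElem (hg i) hr)) ^ d := by
      refine val_injective _ ?_
      rw [val_pow, val_awayEquiv, Away.val_mk, Away.val_mk, locEquiv_mk, Localization.mk_pow]
      congr 1
      · rw [map_pow, ← pow_mul, mul_comm]
      · refine Subtype.ext ?_
        simp only [SubmonoidClass.coe_pow]
        rw [← pow_mul, mul_comm]
    rw [h5, h6, PrimeSpectrum.basicOpen_pow _ _ hd, Scheme.Hom.comp_apply, h4]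
    rfl
  rwa [Scheme.Hom.comp_apply] at h1

end Dilation

/-! ### The torus centralizing `φ` and a slice for its action -/

section Torus

variable {K : Type*} [Field K]

theorem eigMat_mul_phiMat {a b : K} {p : ℕ} {ε : ℤ} (hab : a * b = p)
    (hs : -(a ^ 2 + b ^ 2) = (ε : K) * p) :
    eigMat a b * phiMat K p ε = Matrix.diagonal ![a, -a, b, -b] * eigMat a b := by
  have h4 : ∀ i, ![a, -a, b, -b] i ^ 4 =
      -(p : K) ^ 2 + -((ε : K) * p) * ![a, -a, b, -b] i ^ 2 := by
    intro i
    rw [← hs, ← hab]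
    fin_cases i <;> simp <;> ring
  ext i j
  rw [Matrix.diagonal_mul, Matrix.mul_apply, Fin.sum_univ_four]
  have h := h4 i
  simp only [eigMat, Matrix.vandermonde_apply]
  generalize ![a, -a, b, -b] i = l at h
  fin_cases j <;> simp [phiMat]
  · ring
  · ring
  · linear_combination -h

/-- The element of the centralizer of `φ` that acts on the eigencoordinates by `t`. -/
theorem exists_torus_element {a b : K} {p : ℕ} {ε : ℤ} (hab : a * b = p)
    (hs : -(a ^ 2 + b ^ 2) = (ε : K) * p) (hdet : (eigMat a b).det ≠ 0) {t : Fin 4 → K}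
    (ht : ∏ i, t i = 1) :
    ∃ g ∈ centralizer K p ε, ∀ v : Fin 4 → K,
      (eigMat a b).mulVec (g.1.mulVec v) = fun i => t i * (eigMat a b).mulVec v i := by
  set E := eigMat a b with hE
  have hu : IsUnit E.det := hdet.isUnit
  have h1 : E * E⁻¹ = 1 := Matrix.mul_nonsing_inv _ hu
  have h2 : E⁻¹ * E = 1 := Matrix.nonsing_inv_mul _ hu
  have hφ : E * phiMat K p ε = Matrix.diagonal ![a, -a, b, -b] * E := eigMat_mul_phiMat hab hs
  have hφ' : phiMat K p ε = E⁻¹ * (Matrix.diagonal ![a, -a, b, -b] * E) := by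
    rw [← hφ, ← Matrix.mul_assoc, h2, Matrix.one_mul]
  refine ⟨⟨E⁻¹ * (Matrix.diagonal t * E), ?_⟩, ?_, fun v => ?_⟩
  · rw [Matrix.det_mul, Matrix.det_mul, Matrix.det_diagonal, ht, one_mul, ← Matrix.det_mul, h2,
      Matrix.det_one]
  · change E⁻¹ * (Matrix.diagonal t * E) * phiMat K p ε =
      phiMat K p ε * (E⁻¹ * (Matrix.diagonal t * E))
    rw [hφ']
    have hc : Matrix.diagonal t * Matrix.diagonal ![a, -a, b, -b] =
        Matrix.diagonal ![a, -a, b, -b] * Matrix.diagonal t := by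
      rw [Matrix.diagonal_mul_diagonal, Matrix.diagonal_mul_diagonal]
      congr 1
      funext i
      exact mul_comm _ _
    calc E⁻¹ * (Matrix.diagonal t * E) * (E⁻¹ * (Matrix.diagonal ![a, -a, b, -b] * E))
        = E⁻¹ * (Matrix.diagonal t * (E * E⁻¹) * Matrix.diagonal ![a, -a, b, -b]) * E := by
          simp only [Matrix.mul_assoc]
      _ = E⁻¹ * (Matrix.diagonal ![a, -a, b, -b] * (E * E⁻¹) * Matrix.diagonal t) * E := by
          rw [h1, Matrix.mul_one, Matrix.mul_one, hc]
      _ = _ := by simp only [Matrix.mul_assoc]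
  · rw [Matrix.mulVec_mulVec, ← Matrix.mul_assoc, h1, Matrix.one_mul, ← Matrix.mulVec_mulVec]
    funext i
    rw [Matrix.mulVec_diagonal]

/-- The first vector of a slice for the action of the torus. -/
def sliceV {R : Type*} [CommRing R] : Fin 4 → R := ![1, 0, 1, 1]

/-- The second vector of a slice for the action of the torus. -/
def sliceW {R : Type*} [CommRing R] (A B : R) : Fin 4 → R := ![0, 1, -B, A - B]

theorem minor_slice {R : Type*} [CommRing R] (A B : R) :
    minor sliceV (sliceW A B) 0 1 = 1 ∧ minor sliceV (sliceW A B) 0 2 = -B ∧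
    minor sliceV (sliceW A B) 0 3 = A - B ∧ minor sliceV (sliceW A B) 1 2 = -1 ∧
    minor sliceV (sliceW A B) 1 3 = -1 ∧ minor sliceV (sliceW A B) 2 3 = A := by
  simp [minor, sliceV, sliceW]

/-- The torus acts transitively on the pairs with given products of complementary minors, away from
the zeros of three of the minors. -/
theorem exists_torus_normalize [IsAlgClosed K] {v w : Fin 4 → K} (h01 : minor v w 0 1 ≠ 0)
    (h12 : minor v w 1 2 ≠ 0) (h13 : minor v w 1 3 ≠ 0) :
    ∃ t : Fin 4 → K, ∏ i, t i = 1 ∧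
      ∀ i j, minor (fun i => t i * v i) (fun i => t i * w i) i j =
        minor sliceV (sliceW (prodA v w) (prodB v w)) i j := by
  have hpl := minor_relation v w
  obtain ⟨τ, hτ⟩ := IsAlgClosed.exists_pow_nat_eq
    (minor v w 0 1 * minor v w 1 2 * minor v w 1 3)⁻¹ (n := 2) (by norm_num)
  have hτ0 : τ ≠ 0 := by
    rintro rfl
    rw [zero_pow two_ne_zero, eq_comm, inv_eq_zero] at hτ
    exact mul_ne_zero (mul_ne_zero h01 h12) h13 hτ
  have hτ' : τ ^ 2 * (minor v w 0 1 * minor v w 1 2 * minor v w 1 3) = 1 := by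
    rw [hτ, inv_mul_cancel₀ (mul_ne_zero (mul_ne_zero h01 h12) h13)]
  -- With `t 1 = τ`, the other entries are forced by moving the minors `01, 12, 13` to `1, -1, -1`;
  -- the condition `∏ t i = 1` then fixes `τ²`.
  set t : Fin 4 → K := ![(τ * minor v w 0 1)⁻¹, τ, -(τ * minor v w 1 2)⁻¹,
    -(τ * minor v w 1 3)⁻¹] with ht
  have hm : ∀ i j, minor (fun i => t i * v i) (fun i => t i * w i) i j =
      t i * t j * minor v w i j := by
    intro i j
    simp only [minor]
    ring
  refine ⟨t, ?_, ?_⟩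
  · rw [Fin.prod_univ_four]
    simp only [ht, Matrix.cons_val_zero, Matrix.cons_val_one, Matrix.cons_val]
    field_simp
    linear_combination -hτ'
  · have key : ∀ i j : Fin 4, i < j → minor (fun i => t i * v i) (fun i => t i * w i) i j =
        minor sliceV (sliceW (prodA v w) (prodB v w)) i j := by
      intro i j hij
      obtain ⟨m1, m2, m3, m4, m5, m6⟩ := minor_slice (prodA v w) (prodB v w)
      rw [hm]
      fin_cases i <;> fin_cases j <;> first | (exact absurd hij (by decide)) | skip
      · simp [ht, m1]
        field_simp
      · simp [ht, m2]
        simp only [prodB]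
        field_simp
        linear_combination (-minor v w 0 2) * hτ'
      · simp [ht, m3]
        simp only [prodA, prodB]
        field_simp
        linear_combination (-τ ^ 2 * minor v w 0 1 * minor v w 1 3) * hpl + minor v w 0 3 * hτ'
      · simp [ht, m4]
        field_simp
      · simp [ht, m5]
        field_simp
      · simp [ht, m6]
        simp only [prodA]
        field_simp
        linear_combination (- minor v w 2 3) * hτ'
    intro i j
    rcases lt_trichotomy i j with hij | rfl | hij
    · exact key i j hij
    · rw [minor_self, minor_self]
    · rw [minor_swap, key j i hij, ← minor_swap]

end Torus

/-! ### `num` and `den` as invariants and as coordinates on a slice -/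

section Invariants

variable {K : Type*} [Field K]

theorem centralizer_comm {p : ℕ} {ε : ℤ} {g : Matrix.SpecialLinearGroup (Fin 4) K}
    (hg : g ∈ centralizer K p ε) (x : Fin 4 → K) :
    Matrix.toLin' g.1 (phi K p ε x) = phi K p ε (Matrix.toLin' g.1 x) := by
  have hg' : g.1 * phiMat K p ε = phiMat K p ε * g.1 := hg
  rw [phi, ← Matrix.toLin'_mul_apply, hg', Matrix.toLin'_mul_apply]

theorem num_centralizer {p : ℕ} {ε : ℤ} {g : Matrix.SpecialLinearGroup (Fin 4) K}
    (hg : g ∈ centralizer K p ε) (v w : Fin 4 → K) :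
    num p ε (g.1.mulVec v) (g.1.mulVec w) = num p ε v w := by
  have h := num_map p ε (centralizer_comm hg) v w
  rwa [LinearMap.det_toLin', g.2, one_mul] at h

theorem den_centralizer {p : ℕ} {ε : ℤ} {g : Matrix.SpecialLinearGroup (Fin 4) K}
    (hg : g ∈ centralizer K p ε) (v w : Fin 4 → K) :
    den p ε (g.1.mulVec v) (g.1.mulVec w) = den p ε v w := by
  have h := den_map p ε (centralizer_comm hg) v w
  rwa [LinearMap.det_toLin', g.2, one_mul] at h

variable (K) in
/-- `num` as an invariant. -/
def invNum (p : ℕ) (ε : ℤ) : invRing K p ε :=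
  ⟨fun x => num p ε x.1 x.2,
    ⟨numPoly K p ε, fun v w => by
      rw [← MvPolynomial.aeval_eq_eval]
      exact (aeval_numPoly K p ε v w).symm⟩,
    fun _ hg v w => num_centralizer hg v w⟩

variable (K) in
/-- `den` as an invariant. -/
def invDen (p : ℕ) (ε : ℤ) : invRing K p ε :=
  ⟨fun x => den p ε x.1 x.2,
    ⟨denPoly K p ε, fun v w => by
      rw [← MvPolynomial.aeval_eq_eval]
      exact (aeval_denPoly K p ε v w).symm⟩,
    fun _ hg v w => den_centralizer hg v w⟩

variable (K) in
/-- The homomorphism from `K[X₀, X₁]` to the invariants given by `num` and `den`. -/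
def invHom (p : ℕ) (ε : ℤ) : MvPolynomial (Fin 2) K →ₐ[K] invRing K p ε :=
  MvPolynomial.aeval ![invNum K p ε, invDen K p ε]

theorem invHom_apply (p : ℕ) (ε : ℤ) (h : MvPolynomial (Fin 2) K) (v w : Fin 4 → K) :
    (invHom K p ε h).1 (v, w) = MvPolynomial.eval (numDen p ε v w) h := by
  let ev : invRing K p ε →ₐ[K] K :=
    (Pi.evalAlgHom K (fun _ : (Fin 4 → K) × (Fin 4 → K) => K) (v, w)).comp (invRing K p ε).val
  have h1 : ev (invHom K p ε h) = MvPolynomial.aeval (fun i => ev (![invNum K p ε, invDen K p ε] i)) h :=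
    MvPolynomial.comp_aeval_apply _ _ _
  have h2 : (fun i => ev (![invNum K p ε, invDen K p ε] i)) = numDen p ε v w := by
    funext i
    fin_cases i <;> rfl
  rw [h2, MvPolynomial.aeval_eq_eval] at h1
  exact h1

/-- There is a slice on which `num` and `den` are the coordinates. -/
theorem exists_slice [CharZero K] [IsAlgClosed K] {p : ℕ} (hp : p ≠ 0) {ε : ℤ}
    (hε : ε = 0 ∨ ε = 1 ∨ ε = -1) :
    ∃ (E : Matrix (Fin 4) (Fin 4) K) (V W : Fin 4 → MvPolynomial (Fin 2) K), E.det ≠ 0 ∧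
      numMinor (MvPolynomial.C ((ε : K) * p)) (MvPolynomial.C ((p : K) ^ 2)) V W =
        MvPolynomial.X 0 ∧
      denMinor (MvPolynomial.C ((ε : K) * p)) (MvPolynomial.C ((p : K) ^ 2)) V W =
        MvPolynomial.X 1 ∧
      ∀ v w : Fin 4 → K, minor (E.mulVec v) (E.mulVec w) 0 1 ≠ 0 →
        minor (E.mulVec v) (E.mulVec w) 1 2 ≠ 0 → minor (E.mulVec v) (E.mulVec w) 1 3 ≠ 0 →
        ∃ g ∈ centralizer K p ε, ∀ i j, minor (g.1.mulVec v) (g.1.mulVec w) i j =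
          MvPolynomial.eval (numDen p ε v w) (minor V W i j) := by
  obtain ⟨a, b, hab, hs, hdet⟩ := exists_eigenvalues K hp hε
  obtain ⟨h3, h4⟩ := sub_sq_ne_zero_of_det hdet
  have h3' := mul_ne_zero h3 (left_ne_zero_of_mul h3)
  set E := eigMat a b with hE
  have hu : IsUnit E.det := hdet.isUnit
  set c : K →+* MvPolynomial (Fin 2) K := MvPolynomial.C with hc
  -- `A` and `B` are `prodA` and `prodB` solved for in terms of `num = X 0` and `den = X 1`.
  set A : MvPolynomial (Fin 2) K := c (4 * (a * b) ^ 2 - (a ^ 2 + b ^ 2) ^ 2)⁻¹ *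
    (c ((a ^ 2 + b ^ 2) * E.det) * MvPolynomial.X 1 - c E.det * MvPolynomial.X 0) with hA
  set B : MvPolynomial (Fin 2) K := c (2 * (a * b) * 2)⁻¹ *
    (c (2 * (a * b)) * A - c (a ^ 2 + b ^ 2) * A - c E.det * MvPolynomial.X 1) with hB
  have hA' : c (4 * (a * b) ^ 2 - (a ^ 2 + b ^ 2) ^ 2) * A =
      c ((a ^ 2 + b ^ 2) * E.det) * MvPolynomial.X 1 - c E.det * MvPolynomial.X 0 := by
    rw [hA, ← mul_assoc, ← map_mul, mul_inv_cancel₀ h4, map_one, one_mul]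
  have hB' : c (2 * (a * b) * 2) * B =
      c (2 * (a * b)) * A - c (a ^ 2 + b ^ 2) * A - c E.det * MvPolynomial.X 1 := by
    rw [hB, ← mul_assoc, ← map_mul, mul_inv_cancel₀ h3', map_one, one_mul]
  have hC : eigMat (c a) (c b) = E.map c := eigMat_map c a b
  have hEi : ∀ x : Fin 4 → MvPolynomial (Fin 2) K,
      (eigMat (c a) (c b)).mulVec ((E⁻¹.map c).mulVec x) = x := fun x => by
    rw [Matrix.mulVec_mulVec, hC, ← Matrix.map_mul, Matrix.mul_nonsing_inv _ hu,
      Matrix.map_one _ (map_zero _) (map_one _), Matrix.one_mulVec]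
  have hdetc : (eigMat (c a) (c b)).det = c E.det := by
    rw [hC]
    exact (RingHom.map_det c E).symm
  have hdet0 : c E.det ≠ 0 := (map_ne_zero_iff _ (MvPolynomial.C_injective _ _)).2 hdet
  obtain ⟨m1, m2, m3, m4, m5, m6⟩ := minor_slice A B
  have hprodA : prodA sliceV (sliceW A B) = A := by rw [prodA, m1, m6, one_mul]
  have hprodB : prodB sliceV (sliceW A B) = B := by rw [prodB, m2, m5, neg_mul_neg, mul_one]
  have he : c ((ε : K) * p) = -((c a) ^ 2 + (c b) ^ 2) := by
    rw [← hs, map_neg, map_add, map_pow, map_pow]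
  have hq : c ((p : K) ^ 2) = (c a * c b) ^ 2 := by rw [← hab, map_pow, map_mul]
  simp only [map_sub, map_add, map_pow, map_mul, map_ofNat] at hA' hB'
  refine ⟨E, (E⁻¹.map c).mulVec sliceV, (E⁻¹.map c).mulVec (sliceW A B), hdet, ?_, ?_, ?_⟩
  · have h1 := det_mul_numMinor (c a) (c b)
      ((E⁻¹.map c).mulVec sliceV) ((E⁻¹.map c).mulVec (sliceW A B))
    rw [hEi, hEi, hprodA, hprodB, hdetc] at h1
    apply mul_left_cancel₀ hdet0
    rw [he, hq, h1]
    linear_combination (-1 : MvPolynomial (Fin 2) K) * hA' - ((c a) ^ 2 + (c b) ^ 2) * hB'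
  · have h1 := det_mul_denMinor (c a) (c b)
      ((E⁻¹.map c).mulVec sliceV) ((E⁻¹.map c).mulVec (sliceW A B))
    rw [hEi, hEi, hprodA, hprodB, hdetc] at h1
    apply mul_left_cancel₀ hdet0
    rw [he, hq, h1]
    linear_combination (-1 : MvPolynomial (Fin 2) K) * hB'
  · intro v w h01 h12 h13
    obtain ⟨t, ht, htm⟩ := exists_torus_normalize h01 h12 h13
    obtain ⟨g, hg, hgt⟩ := exists_torus_element hab hs hdet ht
    refine ⟨g, hg, fun i j => ?_⟩
    have hinv : ∀ x : Fin 4 → K, E⁻¹.mulVec (E.mulVec x) = x := fun x => by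
      rw [Matrix.mulVec_mulVec, Matrix.nonsing_inv_mul _ hu, Matrix.one_mulVec]
    set A₀ := prodA (E.mulVec v) (E.mulVec w)
    set B₀ := prodB (E.mulVec v) (E.mulVec w)
    have hn := det_mul_numMinor a b v w
    have hd := det_mul_denMinor a b v w
    have hnm : numMinor (-(a ^ 2 + b ^ 2)) ((a * b) ^ 2) v w = num p ε v w := by
      rw [num_eq_numMinor, ← hs, ← hab]
    have hdm : denMinor (-(a ^ 2 + b ^ 2)) ((a * b) ^ 2) v w = den p ε v w := by
      rw [den_eq_denMinor, ← hs, ← hab]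
    rw [hnm] at hn
    rw [hdm] at hd
    have h0 : numDen p ε v w 0 = num p ε v w := rfl
    have h1 : numDen p ε v w 1 = den p ε v w := rfl
    have eA : MvPolynomial.eval (numDen p ε v w) A = A₀ := by
      have := congrArg (MvPolynomial.eval (numDen p ε v w)) hA'
      simp only [hc, map_sub, map_add, map_mul, map_pow, map_ofNat, MvPolynomial.eval_C,
        MvPolynomial.eval_X, h0, h1] at this
      apply mul_left_cancel₀ h4
      rw [this]
      linear_combination (a ^ 2 + b ^ 2) * hd - hn
    have eB : MvPolynomial.eval (numDen p ε v w) B = B₀ := by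
      have := congrArg (MvPolynomial.eval (numDen p ε v w)) hB'
      simp only [hc, map_sub, map_add, map_mul, map_pow, map_ofNat, MvPolynomial.eval_C,
        MvPolynomial.eval_X, h1, eA] at this
      apply mul_left_cancel₀ h3'
      rw [this]
      linear_combination - hd
    have hsl : ∀ i j, MvPolynomial.eval (numDen p ε v w) (minor sliceV (sliceW A B) i j) =
        minor sliceV (sliceW A₀ B₀) i j := by
      intro i j
      rw [← minor_map, ← eA, ← eB]
      congr 1
      · funext k
        fin_cases k <;> simp [sliceV]
      · funext k
        fin_cases k <;> simp [sliceW]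
    have h5 : minor (g.1.mulVec v) (g.1.mulVec w) i j = ∑ k, ∑ l, E⁻¹ i k * E⁻¹ j l *
        minor (E.mulVec (g.1.mulVec v)) (E.mulVec (g.1.mulVec w)) k l := by
      rw [← minor_mulVec, hinv, hinv]
    rw [h5, minor_mulVec, map_sum]
    refine Finset.sum_congr rfl fun k _ => ?_
    rw [map_sum]
    refine Finset.sum_congr rfl fun l _ => ?_
    rw [hgt, hgt, htm, map_mul, map_mul, hsl, Matrix.map_apply, Matrix.map_apply, hc,
      MvPolynomial.eval_C, MvPolynomial.eval_C]

end Invariants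

/-! ### The invariant ring is generated freely by `num` and `den` -/

section InvariantRing

variable {K : Type*} [Field K] {p : ℕ} {ε : ℤ}

theorem eval_numMinor_gen (v w : Fin 4 → K) :
    MvPolynomial.eval (Sum.elim v w) (numMinor (algebraMap K _ ((ε : K) * p))
      (algebraMap K _ ((p : K) ^ 2)) (genV K) (genW K)) = num p ε v w := by
  rw [num_eq_numMinor, ← MvPolynomial.aeval_eq_eval]
  exact aeval_numMinor_gen v w _ _

theorem eval_denMinor_gen (v w : Fin 4 → K) :
    MvPolynomial.eval (Sum.elim v w) (denMinor (algebraMap K _ ((ε : K) * p))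
      (algebraMap K _ ((p : K) ^ 2)) (genV K) (genW K)) = den p ε v w := by
  rw [den_eq_denMinor, ← MvPolynomial.aeval_eq_eval]
  exact aeval_denMinor_gen v w _ _

theorem eval_minor_mulVec_gen (E : Matrix (Fin 4) (Fin 4) K) (v w : Fin 4 → K) (i j : Fin 4) :
    MvPolynomial.eval (Sum.elim v w) (minor ((E.map MvPolynomial.C).mulVec (genV K))
      ((E.map MvPolynomial.C).mulVec (genW K)) i j) = minor (E.mulVec v) (E.mulVec w) i j := by
  rw [← minor_map]
  congr 1
  · funext k
    simp [Matrix.mulVec, dotProduct, genV]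
  · funext k
    simp [Matrix.mulVec, dotProduct, genW]

variable [CharZero K] [IsAlgClosed K]

theorem exists_numDen_eq (hp : p ≠ 0) (hε : ε = 0 ∨ ε = 1 ∨ ε = -1) (y : Fin 2 → K) :
    ∃ v w : Fin 4 → K, numDen p ε v w = y := by
  obtain ⟨E, V, W, -, hn, hd, -⟩ := exists_slice (K := K) hp hε
  refine ⟨fun i => MvPolynomial.eval y (V i), fun i => MvPolynomial.eval y (W i), ?_⟩
  have h1 := numMinor_map (MvPolynomial.eval y) (MvPolynomial.C ((ε : K) * p))
    (MvPolynomial.C ((p : K) ^ 2)) V W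
  have h2 := denMinor_map (MvPolynomial.eval y) (MvPolynomial.C ((ε : K) * p))
    (MvPolynomial.C ((p : K) ^ 2)) V W
  rw [hn, MvPolynomial.eval_C, MvPolynomial.eval_C, MvPolynomial.eval_X, ← num_eq_numMinor] at h1
  rw [hd, MvPolynomial.eval_C, MvPolynomial.eval_C, MvPolynomial.eval_X, ← den_eq_denMinor] at h2
  funext i
  fin_cases i
  · exact h1
  · exact h2

theorem invHom_injective (hp : p ≠ 0) (hε : ε = 0 ∨ ε = 1 ∨ ε = -1) :
    Function.Injective (invHom K p ε) := by
  intro f g hfg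
  refine MvPolynomial.funext fun y => ?_
  obtain ⟨v, w, rfl⟩ := exists_numDen_eq hp hε y
  rw [← invHom_apply, ← invHom_apply, hfg]

/-- Restricting an invariant to the slice gives a polynomial `h` in `num` and `den`. The invariant
agrees with `h (num, den)` wherever the torus reaches the slice, namely where the nonzero polynomial
`M` does not vanish, hence everywhere. -/
theorem invHom_surjective (hp : p ≠ 0) (hε : ε = 0 ∨ ε = 1 ∨ ε = -1) :
    Function.Surjective (invHom K p ε) := by
  rintro ⟨f, ⟨F, hF⟩, hinv⟩
  obtain ⟨E, V, W, hE, -, -, hs⟩ := exists_slice (K := K) hp hε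
  set h : MvPolynomial (Fin 2) K :=
    MvPolynomial.aeval (fun ij : PIdx => minor V W ij.1.1 ij.1.2) F with hh
  refine ⟨h, Subtype.ext (funext fun x => ?_)⟩
  obtain ⟨v, w⟩ := x
  rw [invHom_apply]
  let m := minor ((E.map MvPolynomial.C).mulVec (genV K)) ((E.map MvPolynomial.C).mulVec (genW K))
  let M := m 0 1 * m 1 2 * m 1 3
  let Q : MvPolynomial (Fin 4 ⊕ Fin 4) K :=
    MvPolynomial.aeval ![numMinor (algebraMap K _ ((ε : K) * p))
      (algebraMap K _ ((p : K) ^ 2)) (genV K) (genW K), denMinor (algebraMap K _ ((ε : K) * p))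
      (algebraMap K _ ((p : K) ^ 2)) (genV K) (genW K)] h -
    MvPolynomial.aeval (fun ij : PIdx => minor (genV K) (genW K) ij.1.1 ij.1.2) F
  have hM : ∀ v w : Fin 4 → K, MvPolynomial.eval (Sum.elim v w) M =
      minor (E.mulVec v) (E.mulVec w) 0 1 * minor (E.mulVec v) (E.mulVec w) 1 2 *
        minor (E.mulVec v) (E.mulVec w) 1 3 := by
    intro v w
    simp only [M, m, map_mul, eval_minor_mulVec_gen]
  have hQ : ∀ v w : Fin 4 → K, MvPolynomial.eval (Sum.elim v w) Q =
      MvPolynomial.eval (numDen p ε v w) h - f (v, w) := by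
    intro v w
    rw [hF, map_sub]
    congr 1
    · rw [← MvPolynomial.aeval_eq_eval, MvPolynomial.comp_aeval_apply, ← MvPolynomial.aeval_eq_eval]
      congr 2
      funext i
      fin_cases i
      · exact eval_numMinor_gen v w
      · exact eval_denMinor_gen v w
    · rw [← MvPolynomial.aeval_eq_eval, ← MvPolynomial.aeval_eq_eval]
      exact aeval_minor_gen v w F
  have hMQ : M * Q = 0 := by
    refine MvPolynomial.funext fun z => ?_
    obtain ⟨v, w, rfl⟩ : ∃ v w : Fin 4 → K, z = Sum.elim v w :=
      ⟨_, _, (Sum.elim_comp_inl_inr z).symm⟩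
    rw [map_mul, map_zero, hM, hQ, mul_eq_zero]
    by_cases h01 : minor (E.mulVec v) (E.mulVec w) 0 1 = 0
    · left; rw [h01, zero_mul, zero_mul]
    by_cases h12 : minor (E.mulVec v) (E.mulVec w) 1 2 = 0
    · left; rw [h12, mul_zero, zero_mul]
    by_cases h13 : minor (E.mulVec v) (E.mulVec w) 1 3 = 0
    · left; rw [h13, mul_zero]
    right
    obtain ⟨g, hg, hgm⟩ := hs v w h01 h12 h13
    rw [← hinv g hg, hF, hh, ← MvPolynomial.aeval_eq_eval, MvPolynomial.comp_aeval_apply,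
      MvPolynomial.aeval_eq_eval, sub_eq_zero]
    congr 2
    funext ij
    rw [plucker_eq_minor, hgm, MvPolynomial.aeval_eq_eval]
  have hM0 : M ≠ 0 := by
    intro h0
    have h1 := hM (E⁻¹.mulVec sliceV) (E⁻¹.mulVec (sliceW 0 0))
    have hu : IsUnit E.det := hE.isUnit
    obtain ⟨m1, -, -, m4, m5, -⟩ := minor_slice (0 : K) 0
    rw [h0, Matrix.mulVec_mulVec, Matrix.mulVec_mulVec, Matrix.mul_nonsing_inv _ hu,
      Matrix.one_mulVec, Matrix.one_mulVec, m1, m4, m5] at h1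
    simp at h1
  have := hQ v w
  rw [(mul_eq_zero.1 hMQ).resolve_left hM0, map_zero] at this
  exact sub_eq_zero.1 this.symm

/-- The ring of invariants is the polynomial ring in `num` and `den`. -/
def invEquiv (hp : p ≠ 0) (hε : ε = 0 ∨ ε = 1 ∨ ε = -1) :
    MvPolynomial (Fin 2) K ≃ₐ[K] invRing K p ε :=
  AlgEquiv.ofBijective (invHom K p ε) ⟨invHom_injective hp hε, invHom_surjective hp hε⟩

theorem invEquiv_apply (hp : p ≠ 0) (hε : ε = 0 ∨ ε = 1 ∨ ε = -1) (h : MvPolynomial (Fin 2) K)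
    (v w : Fin 4 → K) :
    (invEquiv hp hε h).1 (v, w) = MvPolynomial.eval (numDen p ε v w) h :=
  invHom_apply p ε h v w

end InvariantRing

/-! ### Homogeneity through scaling -/

section Homogeneous

variable {K : Type*} [Field K] {p : ℕ} {ε : ℤ}

theorem eval_smul_eq_pow_mul {F : MvPolynomial (Fin 2) K} {n : ℕ}
    (hF : F.IsHomogeneous n) (t : K) (x : Fin 2 → K) :
    MvPolynomial.eval (t • x) F = t ^ n * MvPolynomial.eval x F := by
  rw [MvPolynomial.eval_eq', MvPolynomial.eval_eq', Finset.mul_sum]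
  refine Finset.sum_congr rfl fun d hd => ?_
  have hdeg : ∑ i, d i = n := by
    have h := hF (MvPolynomial.mem_support_iff.1 hd)
    rw [Finsupp.weight_apply, Finsupp.sum_fintype _ _ (by simp)] at h
    simpa using h
  simp only [Pi.smul_apply, smul_eq_mul, mul_pow, Finset.prod_mul_distrib,
    Finset.prod_pow_eq_pow_sum, hdeg]
  ring

theorem numDen_smul (t : K) (v w : Fin 4 → K) :
    numDen p ε (t • v) w = t ^ 2 • numDen p ε v w := by
  funext i
  fin_cases i
  · change num p ε (t • v) w = t ^ 2 * num p ε v w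
    rw [← aeval_numPoly K, ← aeval_numPoly K, MvPolynomial.aeval_eq_eval, plucker_smul]
    exact eval_smul_of_isHomogeneous (isHomogeneous_numPoly K p ε) _ _
  · change den p ε (t • v) w = t ^ 2 * den p ε v w
    rw [← aeval_denPoly K, ← aeval_denPoly K, MvPolynomial.aeval_eq_eval, plucker_smul]
    exact eval_smul_of_isHomogeneous (isHomogeneous_denPoly K p ε) _ _

theorem eval_smul_eq_sum (h : MvPolynomial (Fin 2) K) {N : ℕ} (hN : h.totalDegree < N) (t : K)
    (y : Fin 2 → K) : MvPolynomial.eval (t • y) h = ∑ k ∈ Finset.range N,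
      t ^ k * MvPolynomial.eval y (MvPolynomial.homogeneousComponent k h) := by
  conv_lhs => rw [← MvPolynomial.sum_homogeneousComponent h, map_sum]
  rw [Finset.sum_congr rfl fun k _ => eval_smul_eq_pow_mul
    (MvPolynomial.homogeneousComponent_isHomogeneous k h) t y]
  refine Finset.sum_subset (Finset.range_subset_range.2 hN) fun k _ hk => ?_
  rw [MvPolynomial.homogeneousComponent_eq_zero _ _ (by simpa using hk), map_zero, mul_zero]

/-- A polynomial that scales like a homogeneous one is homogeneous. -/
theorem isHomogeneous_of_eval_smul [Infinite K] {h : MvPolynomial (Fin 2) K} {m : ℕ}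
    (hs : ∀ (t : K) y, MvPolynomial.eval (t • y) h = t ^ m * MvPolynomial.eval y h) :
    h.IsHomogeneous m := by
  have key : MvPolynomial.homogeneousComponent m h = h := by
    refine MvPolynomial.funext fun y => ?_
    set N := h.totalDegree + m + 1 with hN
    have hm : m ∈ Finset.range N := Finset.mem_range.2 (by omega)
    have h0 := coeff_eq_zero_of_sum (Finset.range N)
      (fun k => MvPolynomial.eval y (MvPolynomial.homogeneousComponent k h) -
        if k = m then MvPolynomial.eval y h else 0) (fun t => by
          simp only [mul_sub, Finset.sum_sub_distrib]
          rw [← eval_smul_eq_sum h (by omega), hs]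
          simp [hm]) hm
    simpa [sub_eq_zero] using h0
  rw [← key]
  exact MvPolynomial.homogeneousComponent_isHomogeneous m h

theorem mem_span_range_X {h : MvPolynomial (Fin 2) K} (h0 : MvPolynomial.eval 0 h = 0) :
    h ∈ Ideal.span (Set.range (MvPolynomial.X : Fin 2 → MvPolynomial (Fin 2) K)) := by
  rw [← Set.image_univ, MvPolynomial.mem_ideal_span_X_image]
  intro m hm
  by_contra! hc
  have hm0 : m = 0 := Finsupp.ext fun i => hc i (Set.mem_univ i)
  rw [MvPolynomial.mem_support_iff, hm0] at hm
  apply hm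
  rw [← MvPolynomial.constantCoeff_eq, ← MvPolynomial.eval_zero]
  exact h0

end Homogeneous

/-! ### Degrees of invariants and the semistable locus -/

section InvariantRing

variable {K : Type*} [Field K] [CharZero K] [IsAlgClosed K] {p : ℕ} {ε : ℤ}

/-- The factor 2 is the degree of `num` and `den`. Conversely, degree `2m` on the cone gives scaling
by `t ^ m` in the `num`, `den` plane: take a square root of `t`, and use that every pair of values
of `num` and `den` is attained. -/
theorem isHomogeneous_iff_invEquiv_mem (hp : p ≠ 0) (hε : ε = 0 ∨ ε = 1 ∨ ε = -1) (m : ℕ)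
    (b : MvPolynomial (Fin 2) K) :
    b ∈ MvPolynomial.homogeneousSubmodule (Fin 2) K m ↔
      invEquiv hp hε b ∈ invGrading K p ε (2 * m) := by
  rw [MvPolynomial.mem_homogeneousSubmodule]
  constructor
  · intro hb
    refine ⟨MvPolynomial.aeval ![numPoly K p ε, denPoly K p ε] b, hb.aeval _ fun i => ?_,
      fun v w => ?_⟩
    · fin_cases i
      · exact isHomogeneous_numPoly K p ε
      · exact isHomogeneous_denPoly K p ε
    · rw [invEquiv_apply, ← MvPolynomial.aeval_eq_eval, ← MvPolynomial.aeval_eq_eval,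
        MvPolynomial.comp_aeval_apply]
      congr 2
      funext i
      fin_cases i
      · exact (aeval_numPoly K p ε v w).symm
      · exact (aeval_denPoly K p ε v w).symm
  · intro hb
    refine isHomogeneous_of_eval_smul fun t y => ?_
    obtain ⟨s, rfl⟩ := IsAlgClosed.exists_pow_nat_eq t (n := 2) (by norm_num)
    obtain ⟨v, w, rfl⟩ := exists_numDen_eq hp hε y
    rw [← numDen_smul, ← invEquiv_apply hp hε, ← invEquiv_apply hp hε, invGrading_smul hb, pow_mul]

theorem eval_zero_of_mem_invGrading (hp : p ≠ 0) (hε : ε = 0 ∨ ε = 1 ∨ ε = -1) {n : ℕ} (hn : 0 < n)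
    {b : MvPolynomial (Fin 2) K} (hb : invEquiv hp hε b ∈ invGrading K p ε n) :
    MvPolynomial.eval 0 b = 0 := by
  have h := invGrading_smul hb 0 0 0
  rwa [zero_pow hn.ne', zero_mul, invEquiv_apply, numDen_smul, zero_pow two_ne_zero,
    zero_smul] at h

/-- An invariant of positive degree is a polynomial in `num` and `den` without constant term, so it
vanishes where both do; conversely `num` and `den` themselves detect semistability. -/
theorem mem_Yss_iff (hp : p ≠ 0) (hε : ε = 0 ∨ ε = 1 ∨ ε = -1) {P : Gr K} :
    P ∈ Yss K p ε ↔ ∃ v w, Spans P v w ∧ numDen p ε v w ≠ 0 := by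
  constructor
  · rintro ⟨n, hn, f, hf, v, w, h, h0⟩
    refine ⟨v, w, h, fun hz => h0 ?_⟩
    obtain ⟨b, rfl⟩ := (invEquiv hp hε).surjective f
    rw [invEquiv_apply, hz, eval_zero_of_mem_invGrading hp hε hn hf]
  · rintro ⟨v, w, h, h0⟩
    obtain ⟨i, hi⟩ := Function.ne_iff.1 h0
    refine ⟨2 * 1, by norm_num, invEquiv hp hε (MvPolynomial.X i),
      (isHomogeneous_iff_invEquiv_mem hp hε _ _).1 (MvPolynomial.isHomogeneous_X _ _), v, w, h, ?_⟩
    rwa [invEquiv_apply, MvPolynomial.eval_X]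

end InvariantRing

/-! ### Points of `Proj R(Y)^G` attached to planes -/

section PointIdeal

variable {K : Type*} [Field K] [CharZero K] [IsAlgClosed K] {p : ℕ} {ε : ℤ} (hp : p ≠ 0)
  (hε : ε = 0 ∨ ε = 1 ∨ ε = -1)

/-- The restriction of the invariants to the line through `a` in the affine plane with coordinates
`num` and `den`. -/
def lineHom (a : Fin 2 → K) : invRing K p ε →ₐ[K] K[X] :=
  (MvPolynomial.aeval (fun i => Polynomial.C (a i) * Polynomial.X)).comp
    (invEquiv hp hε).symm.toAlgHom

theorem eval_lineHom (a : Fin 2 → K) (h : MvPolynomial (Fin 2) K) (s : K) :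
    (lineHom hp hε a (invEquiv hp hε h)).eval s = MvPolynomial.eval (s • a) h := by
  have h1 : lineHom hp hε a (invEquiv hp hε h) =
      MvPolynomial.aeval (fun i => Polynomial.C (a i) * Polynomial.X) h := by
    rw [lineHom, AlgHom.comp_apply]
    congr 1
    exact (invEquiv hp hε).symm_apply_apply h
  rw [h1, ← Polynomial.coe_aeval_eq_eval, MvPolynomial.comp_aeval_apply,
    ← MvPolynomial.aeval_eq_eval]
  congr 2
  funext i
  rw [map_mul, Polynomial.aeval_C, Polynomial.aeval_X, Pi.smul_apply, smul_eq_mul, mul_comm]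
  rfl

theorem eval_lineHom_sq (v w : Fin 4 → K) (f : invRing K p ε) (t : K) :
    (lineHom hp hε (numDen p ε v w) f).eval (t ^ 2) = f.1 (t • v, w) := by
  obtain ⟨h, rfl⟩ := (invEquiv hp hε).surjective f
  rw [eval_lineHom, ← numDen_smul, invEquiv_apply]

theorem mem_ker_lineHom_iff (v w : Fin 4 → K) (f : invRing K p ε) :
    f ∈ RingHom.ker (lineHom hp hε (numDen p ε v w)) ↔ ∀ t : K, f.1 (t • v, w) = 0 := by
  rw [RingHom.mem_ker]
  constructor
  · intro h t
    rw [← eval_lineHom_sq hp hε, h, Polynomial.eval_zero]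
  · intro h
    refine Polynomial.funext fun s => ?_
    obtain ⟨t, rfl⟩ := IsAlgClosed.exists_pow_nat_eq s (n := 2) (by norm_num)
    rw [eval_lineHom_sq, h, Polynomial.eval_zero]

theorem mem_ker_lineHom_iff_of_spans {P : Gr K} {v w : Fin 4 → K} (hs : Spans P v w)
    (f : invRing K p ε) : f ∈ RingHom.ker (lineHom hp hε (numDen p ε v w)) ↔
      ∀ v' w', Spans P v' w' → f.1 (v', w') = 0 := by
  constructor
  · intro h v' w' h'
    obtain ⟨t, -, ht⟩ := hs.exists_smul h'
    obtain ⟨F, hF⟩ := f.2.1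
    have h1 : plucker v' w' = plucker (t • v) w := by
      rw [plucker_smul]
      funext ij
      exact ht _ _
    rw [hF, h1, ← hF]
    exact (mem_ker_lineHom_iff hp hε v w f).1 h t
  · intro h
    rw [RingHom.mem_ker]
    -- At `t = 0` the pair `(t • v, w)` does not span `P`, so nothing is known there; the factor `X`
    -- covers this value and is cancelled afterwards.
    have h0 : Polynomial.X * lineHom hp hε (numDen p ε v w) f = 0 := by
      refine Polynomial.funext fun s => ?_
      obtain ⟨t, rfl⟩ := IsAlgClosed.exists_pow_nat_eq s (n := 2) (by norm_num)
      rw [Polynomial.eval_mul, eval_lineHom_sq, Polynomial.eval_X, Polynomial.eval_zero]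
      rcases eq_or_ne t 0 with rfl | ht
      · simp
      · rw [h (t • v) w ?_, mul_zero]
        have h2 : Submodule.span K {t • v, w} = Submodule.span K {v, w} := by
          rw [Submodule.span_insert, Submodule.span_insert,
            Submodule.span_singleton_smul_eq ht.isUnit]
        exact h2.trans hs
    exact (mul_eq_zero.1 h0).resolve_left Polynomial.X_ne_zero

/-- The kernel is the set of invariants vanishing on all `(t v, w)`; as a polynomial in `t`, such a
function has the values of the graded components as coefficients. -/
theorem isHomogeneous_ker_lineHom (v w : Fin 4 → K) :
    (RingHom.ker (lineHom hp hε (numDen p ε v w))).IsHomogeneous (invGrading K p ε) := by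
  classical
  intro n f hf
  rw [mem_ker_lineHom_iff] at hf ⊢
  intro t
  set d := DirectSum.decompose (invGrading K p ε) f with hd
  have hsum : ∀ t : K, f.1 (t • v, w) = ∑ i ∈ d.support, t ^ i * (d i).1.1 (v, w) := by
    intro t
    conv_lhs => rw [← DirectSum.sum_support_decompose (invGrading K p ε) f]
    rw [AddSubmonoidClass.coe_finsetSum, Finset.sum_apply]
    exact Finset.sum_congr rfl fun i _ => invGrading_smul (d i).2 t v w
  have h0 : (d n).1.1 (v, w) = 0 := by
    by_cases hn : n ∈ d.support
    · exact coeff_eq_zero_of_sum d.support (fun i => (d i).1.1 (v, w))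
        (fun t => by rw [← hsum, hf]) hn
    · rw [DFinsupp.notMem_support_iff.1 hn]
      rfl
  rw [invGrading_smul (d n).2, h0, mul_zero]

/-- The point of `Proj R(Y)^G` given by a pair of vectors at which `num` and `den` do not both
vanish. -/
def pointOf (v w : Fin 4 → K) (h0 : numDen p ε v w ≠ 0) :
    ProjectiveSpectrum (invGrading K p ε) where
  asHomogeneousIdeal := ⟨RingHom.ker (lineHom hp hε (numDen p ε v w)),
    isHomogeneous_ker_lineHom hp hε v w⟩
  isPrime := RingHom.ker_isPrime _
  not_irrelevant_le := fun hle => by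
    obtain ⟨i, hi⟩ := Function.ne_iff.1 h0
    have h1 := hle (HomogeneousIdeal.mem_irrelevant_of_mem (invGrading K p ε)
      (i := 2 * 1) (by norm_num)
      ((isHomogeneous_iff_invEquiv_mem hp hε _ _).1 (MvPolynomial.isHomogeneous_X K i)))
    have h2 := (mem_ker_lineHom_iff hp hε v w _).1 h1 1
    rw [one_smul, invEquiv_apply, MvPolynomial.eval_X] at h2
    exact hi h2

end PointIdeal

/-! ### The isomorphism of `Proj` over the base field -/

section DilationAlgebra

open AlgebraicGeometry CategoryTheory

/-- An isomorphism of graded algebras that multiplies degrees by `d` induces an isomorphism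
of `Proj` over the base field. -/
theorem exists_projIso_over {K A B : Type} [Field K] [CommRing A] [Algebra K A] [CommRing B]
    [Algebra K B] (𝒜 : ℕ → Submodule K A) (ℬ : ℕ → Submodule K B) [GradedAlgebra 𝒜]
    [GradedAlgebra ℬ] (ψ : B ≃ₐ[K] A) {d : ℕ} (hd : 0 < d)
    (hψ : ∀ m b, b ∈ ℬ m ↔ ψ b ∈ 𝒜 (d * m)) {ι : Type} (g : ι → B) (hg : ∀ i, g i ∈ ℬ 1)
    (hspan : (HomogeneousIdeal.irrelevant ℬ).toIdeal ≤ Ideal.span (Set.range g))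
    (hspan' : (HomogeneousIdeal.irrelevant 𝒜).toIdeal ≤ Ideal.span (Set.range (ψ ∘ g))) :
    ∃ e : Proj 𝒜 ≅ Proj ℬ, e.hom ≫ projToSpec ℬ = projToSpec 𝒜 ∧
      ∀ {n : ℕ} {r : B}, 0 < n → r ∈ ℬ n → ∀ x : Proj 𝒜,
        r ∈ (e.hom x).asHomogeneousIdeal ↔ ψ r ∈ x.asHomogeneousIdeal := by
  have hn : ∀ _ : ι, 0 < 1 := fun _ => one_pos
  obtain ⟨e, he⟩ := exists_projIso ψ.toRingEquiv hd hψ g hg hn hspan hspan'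
  refine ⟨e, ?_, fun hn' hr x => not_iff_not.1
    (projIso_preimage_basicOpen ψ.toRingEquiv hd hψ g hg hn hspan' e.hom he hn' hr x)⟩
  refine projHom_ext 𝒜 _ (fun i => (hψ _ _).1 (hg i)) (fun i => Nat.mul_pos hd (hn i)) hspan'
    fun i => ?_
  rw [← Category.assoc]
  erw [he i]
  rw [Category.assoc, projToSpec, projToSpec, Proj.awayι_toSpecZero_assoc,
    Proj.awayι_toSpecZero_assoc, ← Spec.map_comp, ← Spec.map_comp, ← Spec.map_comp,
    ← CommRingCat.ofHom_comp, ← CommRingCat.ofHom_comp, ← CommRingCat.ofHom_comp]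
  congr 2
  refine RingHom.ext fun r => ?_
  exact awayEquiv_fromZeroRingHom ψ.toRingEquiv hψ rfl (hg i) (algebraMap K (ℬ 0) r)
    (algebraMap K (𝒜 0) r) (ψ.commutes r)

end DilationAlgebra

/-! ### Identification of `c` with the GIT quotient -/

section GITQuotient

open AlgebraicGeometry CategoryTheory

attribute [local instance] MvPolynomial.gradedAlgebra

variable {K : Type} [Field K]

theorem irrelevant_le_span_X :
    (HomogeneousIdeal.irrelevant (MvPolynomial.homogeneousSubmodule (Fin 2) K)).toIdeal ≤
      Ideal.span (Set.range (MvPolynomial.X : Fin 2 → MvPolynomial (Fin 2) K)) := by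
  refine (HomogeneousIdeal.toIdeal_irrelevant_le _).2 fun n hn h hh => mem_span_range_X ?_
  have h1 := eval_smul_eq_pow_mul ((MvPolynomial.mem_homogeneousSubmodule _ _).1 hh) 0 0
  rwa [zero_pow hn.ne', zero_mul, zero_smul] at h1

/-- Basic opens give information only in positive degree. In degree 0 the elements are constants,
and a nonzero constant is not in a prime ideal. -/
theorem mem_ideal_iff_eval_of_isHomogeneous {a : Fin 2 → K}
    (y : ProjectiveSpectrum (MvPolynomial.homogeneousSubmodule (Fin 2) K))
    (hy : ∀ {n : ℕ} {r : MvPolynomial (Fin 2) K}, 0 < n → r.IsHomogeneous n →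
      (r ∈ y.asHomogeneousIdeal ↔ MvPolynomial.eval a r = 0))
    {n : ℕ} {r : MvPolynomial (Fin 2) K} (hr : r.IsHomogeneous n) :
    r ∈ y.asHomogeneousIdeal ↔ MvPolynomial.eval a r = 0 := by
  rcases Nat.eq_zero_or_pos n with rfl | hn
  · obtain ⟨z, rfl⟩ : ∃ z, r = MvPolynomial.C z :=
      ⟨_, MvPolynomial.totalDegree_eq_zero_iff_eq_C.1 (Nat.le_zero.1 hr.totalDegree_le)⟩
    rw [MvPolynomial.eval_C]
    constructor
    · intro hz
      by_contra hz0
      exact y.isPrime.ne_top (Ideal.eq_top_of_isUnit_mem _ hz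
        ((IsUnit.mk0 z hz0).map MvPolynomial.C))
    · rintro rfl
      rw [MvPolynomial.C_0]
      exact y.asHomogeneousIdeal.toIdeal.zero_mem
  · exact hy hn hr

/-- The homogeneous ideal of a point of `ℙ¹`. -/
theorem mem_ideal_iff_eval [Infinite K] {a : Fin 2 → K}
    (y : ProjectiveSpectrum (MvPolynomial.homogeneousSubmodule (Fin 2) K))
    (hy : ∀ {n : ℕ} {r : MvPolynomial (Fin 2) K}, 0 < n → r.IsHomogeneous n →
      (r ∈ y.asHomogeneousIdeal ↔ MvPolynomial.eval a r = 0)) (h : MvPolynomial (Fin 2) K) :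
    h ∈ y.asHomogeneousIdeal ↔ ∀ z ∈ Submodule.span K {a}, MvPolynomial.eval z h = 0 := by
  have hcomp : h ∈ y.asHomogeneousIdeal ↔
      ∀ n, MvPolynomial.eval a (MvPolynomial.homogeneousComponent n h) = 0 := by
    constructor
    · intro hh n
      refine (mem_ideal_iff_eval_of_isHomogeneous y hy
        (MvPolynomial.homogeneousComponent_isHomogeneous n h)).1 ?_
      rw [← MvPolynomial.decomposition.decompose'_apply]
      exact y.asHomogeneousIdeal.isHomogeneous n hh
    · intro hh
      rw [← MvPolynomial.sum_homogeneousComponent h]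
      exact y.asHomogeneousIdeal.toIdeal.sum_mem fun n _ =>
        (mem_ideal_iff_eval_of_isHomogeneous y hy
          (MvPolynomial.homogeneousComponent_isHomogeneous n h)).2 (hh n)
  rw [hcomp]
  constructor
  · intro hh y hy
    obtain ⟨t, rfl⟩ := Submodule.mem_span_singleton.1 hy
    rw [eval_smul_eq_sum h (Nat.lt_succ_self _)]
    exact Finset.sum_eq_zero fun k _ => by rw [hh, mul_zero]
  · intro hh n
    by_cases hn : n ∈ Finset.range (h.totalDegree + 1)
    · refine coeff_eq_zero_of_sum (Finset.range (h.totalDegree + 1)) (fun k =>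
        MvPolynomial.eval a (MvPolynomial.homogeneousComponent k h)) (fun t => ?_) hn
      rw [← eval_smul_eq_sum h (Nat.lt_succ_self _)]
      exact hh _ (Submodule.smul_mem _ t (Submodule.mem_span_singleton_self a))
    · rw [MvPolynomial.homogeneousComponent_eq_zero _ _ (by simpa using hn), map_zero]

variable [CharZero K] [IsAlgClosed K] {p : ℕ} {ε : ℤ}

theorem irrelevant_le_span_invEquiv (hp : p ≠ 0) (hε : ε = 0 ∨ ε = 1 ∨ ε = -1) :
    (HomogeneousIdeal.irrelevant (invGrading K p ε)).toIdeal ≤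
      Ideal.span (Set.range (invEquiv hp hε ∘
        (MvPolynomial.X : Fin 2 → MvPolynomial (Fin 2) K))) := by
  refine (HomogeneousIdeal.toIdeal_irrelevant_le _).2 fun n hn f hf => ?_
  obtain ⟨h, rfl⟩ := (invEquiv hp hε).surjective f
  have h1 := Ideal.mem_map_of_mem (invEquiv hp hε).toRingEquiv.toRingHom
    (mem_span_range_X (eval_zero_of_mem_invGrading hp hε hn hf))
  rw [Ideal.map_span, ← Set.range_comp] at h1
  exact h1

theorem invEquiv_mem_pointOf_iff (hp : p ≠ 0) (hε : ε = 0 ∨ ε = 1 ∨ ε = -1) {v w : Fin 4 → K}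
    (h0 : numDen p ε v w ≠ 0) {n : ℕ} {r : MvPolynomial (Fin 2) K} (hr : r.IsHomogeneous n) :
    invEquiv hp hε r ∈ (pointOf hp hε v w h0).asHomogeneousIdeal ↔
      MvPolynomial.eval (numDen p ε v w) r = 0 := by
  refine (mem_ker_lineHom_iff hp hε v w _).trans ?_
  have h2 : ∀ t : K, (invEquiv hp hε r).1 (t • v, w) =
      (t ^ 2) ^ n * MvPolynomial.eval (numDen p ε v w) r := fun t =>
    (invEquiv_apply hp hε r _ _).trans (by rw [numDen_smul, eval_smul_eq_pow_mul hr])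
  simp only [h2]
  exact ⟨fun h => by simpa using h 1, fun h t => by rw [h, mul_zero]⟩

/-- The isomorphism of `Proj` comes from `X 0 ↦ num`, `X 1 ↦ den`. A form `r` of positive degree
lies in the ideal of the image point exactly when `r (num, den)` vanishes at `P`, so that point is
`[num : den]`. -/
theorem isProjectiveGITQuotient (hp : p ≠ 0) (hε : ε = 0 ∨ ε = 1 ∨ ε = -1)
    {S : Set (Gr K)} (c : S → ℙ K (Fin 2 → K))
    (hS : S = Yss K p ε) (h0 : ∀ (P : S) v w, Spans P.1 v w → numDen p ε v w ≠ 0)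
    (hc : ∀ (P : S) v w (h : Spans P.1 v w), c P = Projectivization.mk K _ (h0 P v w h)) :
    IsProjectiveGITQuotient p ε c := by
  obtain ⟨e, he, hopen⟩ := exists_projIso_over (invGrading K p ε)
    (MvPolynomial.homogeneousSubmodule (Fin 2) K) (invEquiv hp hε) two_pos
    (isHomogeneous_iff_invEquiv_mem hp hε) MvPolynomial.X
    (fun i => (MvPolynomial.mem_homogeneousSubmodule _ _).2 (MvPolynomial.isHomogeneous_X K i))
    irrelevant_le_span_X (irrelevant_le_span_invEquiv hp hε)
  refine ⟨hS, e, he, fun P => ?_⟩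
  obtain ⟨v, w, hs⟩ := exists_spans P.1
  refine ⟨pointOf hp hε v w (h0 P v w hs), mem_ker_lineHom_iff_of_spans hp hε hs, fun h => ?_⟩
  rw [hc P v w hs, Projectivization.submodule_mk]
  exact mem_ideal_iff_eval _ (fun hn hr => (hopen hn hr _).trans
    (invEquiv_mem_pointOf_iff hp hε (h0 P v w hs) hr)) h

theorem becomesProjectiveGITQuotient (hp : p ≠ 0) (hε : ε = 0 ∨ ε = 1 ∨ ε = -1)
    (k : Type*) [Field k] [Algebra k K] :
    BecomesProjectiveGITQuotient k K p ε := by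
  obtain ⟨c, hc, hc'⟩ := exists_isExtension (K := K) k hp hε
  refine ⟨c, hc, isProjectiveGITQuotient hp hε c ?_ (fun P v w h => numDen_ne_zero hp hε P.2 h) hc'⟩
  ext P
  rw [mem_Yss_iff hp hε]
  constructor
  · intro hP
    obtain ⟨v, w, h⟩ := exists_spans P
    exact ⟨v, w, h, numDen_ne_zero hp hε hP h⟩
  · rintro ⟨v, w, h, h0⟩
    exact (mem_Ydf_iff k hp hε h).2 (numDen_ne_zero_iff.1 h0)

end GITQuotient

/-! ### Passage to isomorphism classes -/

section Classification

variable {p : ℕ} [Fact p.Prime] {ε : ℤ}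

theorem mem_Ydf_iff_not_eigenplane (hp : 7 ≤ p) (hε : ε = 0 ∨ ε = 1 ∨ ε = -1) {P : Gr ℚ_[p]} :
    P ∈ Ydf ℚ_[p] ℚ_[p] p ε ↔ ¬ ∃ a, IsQuadRoot ε a ∧ P.1 = eigenplane ε a := by
  obtain ⟨v, w, h⟩ := exists_spans P
  rw [mem_Ydf_iff ℚ_[p] (Fact.out : p.Prime).ne_zero hε h, num_den_eq_zero_iff hp hε h]

theorem Ywa_eq_Ydf (hp : 7 ≤ p) (hε : ε = 0 ∨ ε = 1 ∨ ε = -1) :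
    Ywa p ε = Ydf ℚ_[p] ℚ_[p] p ε :=
  Set.ext fun P => (admissible_DP_iff hp hε P).trans (mem_Ydf_iff_not_eigenplane hp hε).symm

theorem surjective_mk_DP (hp : 7 ≤ p) (hε : ε = 0 ∨ ε = 1 ∨ ε = -1)
    (hD : ∀ P : Ydf ℚ_[p] ℚ_[p] p ε, (DP ε P.1).IsSupersingular ε) :
    Function.Surjective (fun P : Ydf ℚ_[p] ℚ_[p] p ε => Mwa.mk (DP ε P.1) (hD P)) := by
  intro x
  obtain ⟨⟨D, hDs⟩, rfl⟩ := Quotient.exists_rep x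
  obtain ⟨P, hP⟩ := exists_iso_DP hp hε hDs
  have hPa : P ∈ Ywa p ε := hP.symm.admissible hDs.1
  rw [Ywa_eq_Ydf hp hε] at hPa
  exact ⟨⟨P, hPa⟩, Quotient.sound hP⟩

theorem mk_numDen_eq_affinePt_iff {v w : Fin 4 → ℚ_[p]} (h0 : numDen p ε v w ≠ 0) (a : ℚ_[p]) :
    Projectivization.mk ℚ_[p] (numDen p ε v w) h0 = affinePt a ↔
      num p ε v w = a * den p ε v w := by
  constructor
  · intro h
    have := mul_eq_of_mk_eq_mk h0 _ h
    simpa [numDen] using this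
  · intro h
    refine mk_eq_mk_of_mul_eq h0 _ ?_
    simpa [numDen] using h

/-- Isomorphic `D_P` have the same invariant. -/
theorem mul_eq_of_iso_DP {P Q : Gr ℚ_[p]} (h : (DP ε P).Iso (DP ε Q)) {v w : Fin 4 → ℚ_[p]}
    (hv : Spans P v w) : ∃ v' w', Spans Q v' w' ∧
      num p ε v w * den p ε v' w' = num p ε v' w' * den p ε v w := by
  obtain ⟨g, hg, hPQ⟩ := iso_DP_iff.1 h
  refine ⟨_, _, hv.map hPQ, ?_⟩
  rw [num_map p ε hg, den_map p ε hg]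
  ring

end Classification

end FilPhi

end

theorem theorem1p3 (p : ℕ) [Fact p.Prime] (hp : 7 ≤ p) (ε : ℤ)
    (hε : ε = 0 ∨ ε = 1 ∨ ε = -1) :
    -- `Y(ℚ_p)^wa = Y^df(ℚ_p)`
    Ywa p ε = Ydf ℚ_[p] ℚ_[p] p ε ∧
    -- `P ↦ [D_P]` is a surjection from `Y^df(ℚ_p)` onto `M^wa`
    ∃ hD : ∀ P : Ydf ℚ_[p] ℚ_[p] p ε, (DP ε P.1).IsSupersingular ε,
    Function.Surjective (fun P : Ydf ℚ_[p] ℚ_[p] p ε => Mwa.mk (DP ε P.1) (hD P)) ∧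
    -- the morphism `c` on `ℚ_p`-points
    ∃ c : Ydf ℚ_[p] ℚ_[p] p ε → ℙ ℚ_[p] (Fin 2 → ℚ_[p]),
    IsExtension ℚ_[p] p ε c ∧
    -- after base change to the algebraic closure, `c` is a projective GIT quotient
    BecomesProjectiveGITQuotient ℚ_[p] (AlgebraicClosure ℚ_[p]) p ε ∧
    -- `c` factors uniquely through `M^wa`
    ∃ cbar : Mwa p ε → ℙ ℚ_[p] (Fin 2 → ℚ_[p]),
    (∀ P : Ydf ℚ_[p] ℚ_[p] p ε, cbar (Mwa.mk (DP ε P.1) (hD P)) = c P) ∧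
    (∀ cbar' : Mwa p ε → ℙ ℚ_[p] (Fin 2 → ℚ_[p]),
      (∀ P : Ydf ℚ_[p] ℚ_[p] p ε, cbar' (Mwa.mk (DP ε P.1) (hD P)) = c P) → cbar' = cbar) ∧
    -- injectivity outside the fiber over `[-εp : 1]`
    Set.InjOn cbar {x | cbar x ≠ affinePt (-((ε : ℚ_[p]) * p))} ∧
    -- the fiber over `[-εp : 1]`
    ((∀ t : ℚ_[p], t ^ 2 + (ε : ℚ_[p]) * p * t + (p : ℚ_[p]) ^ 2 ≠ 0) →
      (cbar ⁻¹' {affinePt (-((ε : ℚ_[p]) * p))}).encard = 1 ∧ Function.Injective cbar) ∧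
    ((Polynomial.X ^ 2 + Polynomial.C ((ε : ℚ_[p]) * p) * Polynomial.X
        + Polynomial.C ((p : ℚ_[p]) ^ 2)).Splits →
      (cbar ⁻¹' {affinePt (-((ε : ℚ_[p]) * p))}).encard = 3) := by
  have hp0 : p ≠ 0 := (Fact.out : p.Prime).ne_zero
  have hY := Ywa_eq_Ydf hp hε
  have hne : ∀ P : Ydf ℚ_[p] ℚ_[p] p ε, ¬ ∃ a, IsQuadRoot ε a ∧ P.1.1 = eigenplane ε a :=
    fun P => (mem_Ydf_iff_not_eigenplane hp hε).1 P.2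
  have hD : ∀ P : Ydf ℚ_[p] ℚ_[p] p ε, (DP ε P.1).IsSupersingular ε := fun P =>
    isSupersingular_DP hp hε ((admissible_DP_iff hp hε P.1).2 (hne P))
  have hsurj := surjective_mk_DP hp hε hD
  obtain ⟨c, hc, hc'⟩ := exists_isExtension (K := ℚ_[p]) ℚ_[p] hp0 hε
  have hmk : ∀ P Q : Ydf ℚ_[p] ℚ_[p] p ε,
      Mwa.mk (DP ε P.1) (hD P) = Mwa.mk (DP ε Q.1) (hD Q) ↔ (DP ε P.1).Iso (DP ε Q.1) :=
    fun P Q => ⟨fun h => Quotient.exact h, fun h => Quotient.sound h⟩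
  have hwd : ∀ P Q : Ydf ℚ_[p] ℚ_[p] p ε, (DP ε P.1).Iso (DP ε Q.1) → c P = c Q := by
    intro P Q h
    obtain ⟨v, w, hv⟩ := exists_spans P.1
    obtain ⟨v', w', hv', hm⟩ := mul_eq_of_iso_DP h hv
    rw [hc' P v w hv, hc' Q v' w' hv']
    exact mk_eq_mk_of_mul_eq _ _ hm
  -- Only one of the two planes has to consist of cyclic vectors and zero.
  have hinj : ∀ P Q : Ydf ℚ_[p] ℚ_[p] p ε, c P = c Q →
      (∀ x ∈ P.1.1, x ≠ 0 → IsCyclicVec p ε x) → (DP ε P.1).Iso (DP ε Q.1) := by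
    intro P Q h hcyc
    obtain ⟨v, w, hv⟩ := exists_spans P.1
    obtain ⟨v', w', hv'⟩ := exists_spans Q.1
    rw [hc' P v w hv, hc' Q v' w' hv'] at h
    exact iso_of_ratio_eq hp hε hv hv' hcyc (hne Q) (mul_eq_of_mk_eq_mk _ _ h)
  have hfib : ∀ (P : Ydf ℚ_[p] ℚ_[p] p ε) {v w}, Spans P.1 v w →
      (c P = affinePt (-((ε : ℚ_[p]) * p)) ↔ num p ε v w = -((ε : ℚ_[p]) * p) * den p ε v w) := by
    intro P v w hv
    rw [hc' P v w hv, mk_numDen_eq_affinePt_iff]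
  have hsurj' := hsurj
  -- The induced map is `c` on a chosen representative; `hwd` makes it independent of the choice.
  choose rep hrep using hsurj'
  have hcbar : ∀ P : Ydf ℚ_[p] ℚ_[p] p ε, c (rep (Mwa.mk (DP ε P.1) (hD P))) = c P :=
    fun P => hwd _ _ ((hmk _ _).1 (hrep _))
  refine ⟨hY, hD, hsurj, c, hc, becomesProjectiveGITQuotient hp0 hε _, fun x => c (rep x), hcbar,
    fun cbar' h => ?_, ?_, fun hroot => ?_, fun hsplit => ?_⟩
  · funext x
    obtain ⟨P, rfl⟩ := hsurj x
    exact (h P).trans (hcbar P).symm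
  · intro x hx y _ hxy
    obtain ⟨v, w, hv⟩ := exists_spans (rep x).1
    rw [← hrep x, ← hrep y]
    exact (hmk _ _).2 (hinj _ _ hxy (isCyclicVec_of_num_ne hp hε hv fun h => hx ((hfib _ hv).2 h)))
  -- Without roots there are no eigenplanes: every nonzero vector is cyclic, and the injectivity
  -- argument also covers the fiber over `-εp`.
  · have hcyc : ∀ x : Fin 4 → ℚ_[p], x ≠ 0 → IsCyclicVec p ε x := fun x hx =>
      isCyclicVec_of hp hε hx fun a ha => absurd ha (hroot a)
    have hI : Function.Injective fun x => c (rep x) := by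
      intro x y hxy
      rw [← hrep x, ← hrep y]
      exact (hmk _ _).2 (hinj _ _ hxy fun z _ hz => hcyc z hz)
    refine ⟨?_, hI⟩
    obtain ⟨P, v, w, hv, -, hn⟩ := exists_mem_fiber p ε
    have hP : P ∈ Ydf ℚ_[p] ℚ_[p] p ε :=
      (mem_Ydf_iff_not_eigenplane hp hε).2 fun ⟨a, ha, _⟩ => hroot a ha
    have hx : c (rep (Mwa.mk (DP ε P) (hD ⟨P, hP⟩))) = affinePt (-((ε : ℚ_[p]) * p)) :=
      (hcbar ⟨P, hP⟩).trans ((hfib ⟨P, hP⟩ hv).2 hn)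
    rw [Set.encard_eq_one]
    exact ⟨Mwa.mk (DP ε P) (hD ⟨P, hP⟩), Set.eq_singleton_iff_unique_mem.2
      ⟨hx, fun y hy => hI (Eq.trans hy hx.symm)⟩⟩
  · obtain ⟨a, ha⟩ : ∃ a : ℚ_[p], IsQuadRoot ε a := by
      obtain ⟨a, ha⟩ := hsplit.exists_eval_eq_zero (by
        rw [show Polynomial.degree _ = (2 : WithBot ℕ) by compute_degree!]
        norm_num)
      exact ⟨a, by simpa [IsQuadRoot] using ha⟩
    obtain ⟨R, hR, hRinj, hRall⟩ := exists_fiber_representatives hp hε ha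
    have hRmem : ∀ i, R i ∈ Ydf ℚ_[p] ℚ_[p] p ε := fun i =>
      (mem_Ydf_iff_not_eigenplane hp hε).2 (hR i).1
    let F : Fin 3 → Mwa p ε := fun i => Mwa.mk (DP ε (R i)) (hD ⟨R i, hRmem i⟩)
    have hF : Function.Injective F := fun i j hij =>
      hRinj i j ((hmk ⟨R i, hRmem i⟩ ⟨R j, hRmem j⟩).1 hij)
    -- The fiber is parametrized injectively by the three representatives.
    have hrange : (fun x => c (rep x)) ⁻¹' {affinePt (-((ε : ℚ_[p]) * p))} = Set.range F := by
      ext x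
      constructor
      · intro hx
        obtain ⟨v, w, hv⟩ := exists_spans (rep x).1
        obtain ⟨i, hi⟩ := hRall _ (hne (rep x)) v w hv ((hfib _ hv).1 hx)
        refine ⟨i, ?_⟩
        rw [← hrep x]
        exact ((hmk (rep x) ⟨R i, hRmem i⟩).2 hi).symm
      · rintro ⟨i, rfl⟩
        obtain ⟨v, w, hv⟩ := exists_spans (R i)
        exact (hcbar ⟨R i, hRmem i⟩).trans ((hfib ⟨R i, hRmem i⟩ hv).2 ((hR i).2 v w hv))
    rw [hrange, ← Set.image_univ, hF.encard_image, Set.encard_univ]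
    simp
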